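/- Let $k$ be a field of characteristic zero and let $n$ be a positive integer. **Conventions.** A *Poisson bracket* on a commutative $k$-algebra $A$ is a $k$-bilinear Lie bracket $\{-,-\}$ that is a derivation in each variable. A *Poisson ideal* is an ideal $I$ with $\{A,I\}\subseteq I$; a *Poisson prime* is a prime ideal that is a Poisson ideal; the set $\operatorname{P.spec}A$ of Poisson primes carries the relative Zariski topology of $\operatorname{spec}A$. The *Poisson primitive* ideals are the Poisson cores of the maximal ideals, where the Poisson core of an ideal $J$ is the largest Poisson ideal contained in $J$. A Poisson prime $P$ is *Poisson rational* if the Poisson center $\{z : \{z,-\}=0\}$ of $\operatorname{Fract}(A/P)$, with the unique Poisson bracket extending the one induced on $A/P$, is algebraic over $k$. $A$ satisfies the *Poisson Dixmier–Moeglin equivalence* if the set of Poisson primitive ideals, the set of locally closed points of $\operatorname{P.spec}A$, and the set of Poisson rational Poisson primes coincide. An action of a torus $H=(k^\times)^r$ on $A$ by $k$-algebra automorphisms is *rational* if $A$ is generated as a $k$-algebra by $H$-eigenvectors whose eigenvalues are rational characters $h\mapsto h_1^{m_1}\cdots h_r^{m_r}$ ($m_i\in\mathbb Z$); it is a *rational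 Poisson action* if moreover $H$ preserves the bracket. **Claim.** In each of the cases (1)–(5) below there is exactly one Poisson bracket on the polynomial algebra $A$ with the stated values, the stated action of $H$ on $A$ is a rational Poisson action, $A$ has at most $2^N$ $H$-stable Poisson primes, where $N$ is the number of indeterminates of $A$, and $A$ satisfies the Poisson Dixmier–Moeglin equivalence. 1. (Semiclassical limits of quantum matrices; $N=n^2$.) $A=\mathcal O(M_n(k))=k[X_{ij}\mid 1\le i,j\le n]$; $\lambda\in k$ is nonzero, $(p_{ij})\in M_n(k)$ is antisymmetric, and $$\{X_{lm},X_{ij}\}=\begin{cases}(p_{li}+p_{jm})X_{ij}X_{lm}+\lambda X_{im}X_{lj}&(l>i,\ m>j)\\(\lambda+p_{li}+p_{jm})X_{ij}X_{lm}&(l>i,\ m\le j)\\p_{jm}X_{ij}X_{lm}&(l=i,\ m>j);\end{cases}$$ $H=(k^\times)^{2n}$ acts by $h.X_{ij}=h_ih_{n+j}X_{ij}$. 2. (The Poisson algebra $A^{P,Q}_{n,\Gamma}(k)$: semiclassical limits of quantum symplectic and even-dimensional euclidean spaces; $N=2n$.) $A=k[x_1,y_1,\dots,x_n,y_n]$;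 $\Gamma=(\gamma_{ij})\in M_n(k)$ is antisymmetric, $P=(p_1,\dots,p_n)$ and $Q=(q_1,\dots,q_n)$ lie in $k^n$ with $p_i\ne q_i$ for all $i$, and $$\begin{aligned}\{y_i,y_j\}&=\gamma_{ij}y_iy_j &&(\text{all } i,j)\\ \{x_i,y_j\}&=(p_j+\gamma_{ji})x_iy_j&&(i<j)\\ \{x_i,y_j\}&=(q_j+\gamma_{ji})x_iy_j&&(i>j)\\ \{x_i,x_j\}&=(q_i-p_j+\gamma_{ij})x_ix_j&&(i<j)\\ \{x_i,y_i\}&=q_ix_iy_i+\textstyle\sum_{\ell<i}(q_\ell-p_\ell)x_\ell y_\ell&&(\text{all } i);\end{aligned}$$ $H=(k^\times)^{n+1}$ acts by $h.x_i=h_ix_i$ and $h.y_i=h_1h_{n+1}h_i^{-1}y_i$. 3. (Odd-dimensional analogues; $N=2n+1$.) $A=k[z_0,x_1,y_1,\dots,x_n,y_n]$; $\Gamma,P,Q$ are as in (2), $\lambda\in k$ is arbitrary, $\{y_i,y_j\}$, $\{x_i,y_j\}$ for $i\neq j$, and $\{x_i,x_j\}$ for $i<j$ are as in (2), and, for all $i$,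 $$\{z_0,x_i\}=-\tfrac{p_i}{2}z_0x_i,\quad \{z_0,y_i\}=\tfrac{p_i}{2}z_0y_i,\quad \{x_i,y_i\}=q_ix_iy_i+\sum_{\ell<i}(q_\ell-p_\ell)x_\ell y_\ell+\lambda z_0^2;$$ $H=(k^\times)^{n+1}$ acts by $h.x_i=h_ix_i$, $h.z_0=h_{n+1}z_0$ and $h.y_i=h_{n+1}^2h_i^{-1}y_i$. 4. (Semiclassical limit of quantum symmetric matrices; $N=n(n+1)/2$.) $A=k[y_{ij}\mid 1\le i\le j\le n]$ with $y_{ji}=y_{ij}$, and for $i\le j$ and $l\le m$ $$\{y_{ij},y_{lm}\}=(\operatorname{sign}(l-j)+\operatorname{sign}(m-i))\,y_{il}y_{jm}+(\operatorname{sign}(l-i)+\operatorname{sign}(m-j))\,y_{im}y_{jl};$$ $H=(k^\times)^n$ acts by $h.y_{ij}=h_ih_jy_{ij}$. 5. (Semiclassical limit of quantum antisymmetric matrices; $N=n(n-1)/2$.) $A=k[y_{ij}\mid 1\le i<j\le n]$ with $y_{ji}=-y_{ij}$, $y_{ii}=0$, and for $i<j$ and $l<m$ $$\{y_{ij},y_{lm}\}=(\operatorname{sign}(l-j)+\operatorname{sign}(m-i))\,y_{il}y_{jm}-(\operatorname{sign}(l-i)+\operatorname{sign}(m-j))\,y_{im}y_{jl};$$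 $H=(k^\times)^n$ acts by $h.y_{ij}=h_ih_jy_{ij}$. Here $\operatorname{sign}(t)\in\{1,0,-1\}$ is the sign of the integer $t$. -/

import Mathlib

open MvPolynomial

noncomputable section

namespace PoissonDME

universe u v

/-! ### Poisson algebras -/

/-- A Poisson bracket on a commutative `k`-algebra `A`: a `k`-bilinear Lie bracket which is a
derivation in each variable (the derivation property in the first variable follows by
antisymmetry). -/
@[ext]
structure PoissonBracket (k : Type u) (A : Type v) [Field k] [CommRing A] [Algebra k A] where
  br : A →ₗ[k] A →ₗ[k] A
  self_eq_zero : ∀ a, br a a = 0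
  jacobi : ∀ a b c, br a (br b c) + br b (br c a) + br c (br a b) = 0
  leibniz : ∀ a b c, br a (b * c) = br a b * c + b * br a c

section General

variable {k : Type u} {A : Type v} [Field k] [CommRing A] [Algebra k A]

/-- Poisson ideals: `{A, I} ⊆ I`. -/
def IsPoissonIdeal (π : PoissonBracket k A) (I : Ideal A) : Prop :=
  ∀ a : A, ∀ b ∈ I, π.br a b ∈ I

/-- Poisson prime ideals. -/
def IsPoissonPrime (π : PoissonBracket k A) (I : Ideal A) : Prop :=
  I.IsPrime ∧ IsPoissonIdeal π I

/-- The Poisson prime spectrum, a subspace of the prime spectrum with the Zariski topology. -/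
abbrev PoissonSpectrum (π : PoissonBracket k A) : Type v :=
  {P : PrimeSpectrum A // IsPoissonIdeal π P.asIdeal}

/-- `C` is the Poisson core of `J`, that is, the largest Poisson ideal contained in `J`. -/
def IsPoissonCore (π : PoissonBracket k A) (J C : Ideal A) : Prop :=
  IsGreatest {I : Ideal A | IsPoissonIdeal π I ∧ I ≤ J} C

/-- Poisson primitive ideals: the Poisson cores of the maximal ideals. -/
def IsPoissonPrimitive (π : PoissonBracket k A) (I : Ideal A) : Prop :=
  ∃ M : Ideal A, M.IsMaximal ∧ IsPoissonCore π M I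

/-- The Poisson center `{z | {z, -} = 0}`. -/
def poissonCenter (π : PoissonBracket k A) : Set A :=
  {z | ∀ a, π.br z a = 0}

/-- `β` is the Poisson bracket on `Fract (A / P)` extending the bracket on `A / P` induced from
that of `A`. For a Poisson prime `P` there is exactly one such `β`. -/
def IsInducedOnFract (π : PoissonBracket k A) (P : Ideal A)
    (β : PoissonBracket k (FractionRing (A ⧸ P))) : Prop :=
  ∀ a b : A,
    β.br (algebraMap (A ⧸ P) (FractionRing (A ⧸ P)) (Ideal.Quotient.mk P a))
        (algebraMap (A ⧸ P) (FractionRing (A ⧸ P)) (Ideal.Quotient.mk P b)) =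
      algebraMap (A ⧸ P) (FractionRing (A ⧸ P)) (Ideal.Quotient.mk P (π.br a b))

/-- Poisson rational Poisson primes: the Poisson center of `Fract (A / P)`, with its induced
Poisson bracket, is algebraic over `k`. -/
def IsPoissonRational (π : PoissonBracket k A) (P : Ideal A) : Prop :=
  IsPoissonPrime π P ∧
    ∃ β : PoissonBracket k (FractionRing (A ⧸ P)), IsInducedOnFract π P β ∧
      ∀ z ∈ poissonCenter β, IsAlgebraic k z

/-- Ideals that are locally closed points of the Poisson prime spectrum. -/
def IsLocallyClosedPoint (π : PoissonBracket k A) (I : Ideal A) : Prop :=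
  ∃ P : PoissonSpectrum π, P.1.asIdeal = I ∧ IsLocallyClosed ({P} : Set (PoissonSpectrum π))

/-- The Poisson Dixmier-Moeglin equivalence: the sets of Poisson primitive ideals, of locally
closed points of the Poisson prime spectrum, and of Poisson rational Poisson primes coincide. -/
def PoissonDixmierMoeglin (π : PoissonBracket k A) : Prop :=
  {I | IsPoissonPrimitive π I} = {I | IsLocallyClosedPoint π I} ∧
    {I | IsLocallyClosedPoint π I} = {I | IsPoissonRational π I}

/-! ### Torus actions -/

/-- A torus `(kˣ)^r` acts rationally if `A` is generated, as a `k`-algebra, by eigenvectors whose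
eigenvalues are rational characters `h ↦ h₁ ^ m₁ ⋯ h_r ^ m_r`. -/
def IsRationalAction {r : ℕ} (ρ : (Fin r → kˣ) →* (A ≃ₐ[k] A)) : Prop :=
  Algebra.adjoin k {a : A | ∃ m : Fin r → ℤ, ∀ h : Fin r → kˣ,
    ρ h a = ((∏ i, h i ^ m i : kˣ) : k) • a} = ⊤

/-- A rational action by Poisson automorphisms. -/
def IsRationalPoissonAction {r : ℕ} (π : PoissonBracket k A)
    (ρ : (Fin r → kˣ) →* (A ≃ₐ[k] A)) : Prop :=
  IsRationalAction ρ ∧ ∀ h a b, ρ h (π.br a b) = π.br (ρ h a) (ρ h b)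

/-- The set of `H`-stable Poisson primes, for a group `H` acting on `A`. -/
def stablePoissonPrimes {H : Type*} [Group H] (π : PoissonBracket k A)
    (ρ : H →* (A ≃ₐ[k] A)) : Set (Ideal A) :=
  {P | IsPoissonPrime π P ∧ ∀ h, ∀ a ∈ P, ρ h a ∈ P}

end General

/-- The endomorphism `x_s ↦ c_s x_s` of a polynomial algebra. -/
def scaleHom {k : Type u} [Field k] {σ : Type*} (c : σ → kˣ) :
    MvPolynomial σ k →ₐ[k] MvPolynomial σ k :=
  aeval fun s => C (c s : k) * X s

theorem scaleHom_X {k : Type u} [Field k] {σ : Type*} (c : σ → kˣ) (s : σ) :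
    scaleHom c (X s) = C (c s : k) * X s :=
  aeval_X _ _

theorem scaleHom_one {k : Type u} [Field k] {σ : Type*} :
    scaleHom (1 : σ → kˣ) = AlgHom.id k (MvPolynomial σ k) := by
  ext1 s
  simp [scaleHom_X]

theorem scaleHom_mul {k : Type u} [Field k] {σ : Type*} (c d : σ → kˣ) :
    scaleHom (c * d) = (scaleHom c).comp (scaleHom d) := by
  ext1 s
  rw [AlgHom.comp_apply, scaleHom_X, scaleHom_X, map_mul, scaleHom_X, algHom_C, algebraMap_eq,
    Pi.mul_apply, Units.val_mul, C_mul]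
  ring

/-- The action of a group `H` on a polynomial algebra that rescales the variables:
`h . x_s = χ(h)_s x_s`. -/
def scalingAction {k : Type u} [Field k] {H σ : Type*} [Group H] (χ : H →* (σ → kˣ)) :
    H →* (MvPolynomial σ k ≃ₐ[k] MvPolynomial σ k) where
  toFun h := AlgEquiv.ofAlgHom (scaleHom (χ h)) (scaleHom (χ h⁻¹))
    (by rw [← scaleHom_mul, ← map_mul, mul_inv_cancel, map_one, scaleHom_one])
    (by rw [← scaleHom_mul, ← map_mul, inv_mul_cancel, map_one, scaleHom_one])
  map_one' := AlgEquiv.ext fun f => by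
    change scaleHom (χ 1) f = f
    rw [map_one, scaleHom_one, AlgHom.id_apply]
  map_mul' g h := AlgEquiv.ext fun f => by
    change scaleHom (χ (g * h)) f = scaleHom (χ g) (scaleHom (χ h) f)
    rw [map_mul, scaleHom_mul, AlgHom.comp_apply]

theorem scalingAction_X {k : Type u} [Field k] {H σ : Type*} [Group H] (χ : H →* (σ → kˣ))
    (h : H) (s : σ) : scalingAction χ h (X s) = C (χ h s : k) * X s :=
  scaleHom_X _ _

section Families

variable {k : Type u} [Field k]

/-! ### Quantum matrices -/

/-- `O(M_n(k)) = k[X_ij | i, j = 1, …, n]`. -/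
abbrev MatrixAlg (k : Type u) [Field k] (n : ℕ) : Type u := MvPolynomial (Fin n × Fin n) k

/-- The multiparameter Poisson bracket on `O(M_n(k))` with parameters `lam` and `p`. -/
structure IsMatrixBracket {n : ℕ} (lam : k) (p : Matrix (Fin n) (Fin n) k)
    (π : PoissonBracket k (MatrixAlg k n)) : Prop where
  gt_gt : ∀ l m i j : Fin n, i < l → j < m →
    π.br (X (l, m)) (X (i, j)) =
      C (p l i + p j m) * X (i, j) * X (l, m) + C lam * X (i, m) * X (l, j)
  gt_le : ∀ l m i j : Fin n, i < l → m ≤ j →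
    π.br (X (l, m)) (X (i, j)) = C (lam + p l i + p j m) * X (i, j) * X (l, m)
  eq_gt : ∀ l m i j : Fin n, l = i → j < m →
    π.br (X (l, m)) (X (i, j)) = C (p j m) * X (i, j) * X (l, m)

/-- `h . X_ij = h_i h_{n+j} X_ij` for `h ∈ (kˣ)^{2n}`. -/
def matrixAction (k : Type u) [Field k] (n : ℕ) :
    (Fin (n + n) → kˣ) →* (MatrixAlg k n ≃ₐ[k] MatrixAlg k n) :=
  scalingAction
    { toFun := fun h s => h (Fin.castAdd n s.1) * h (Fin.natAdd n s.2)
      map_one' := by ext; simp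
      map_mul' := fun g h => by
        funext s
        exact mul_mul_mul_comm _ _ _ _ }

/-! ### The Poisson algebras `A^{P,Q}_{n,Γ}` -/

/-- `k[x_1, y_1, …, x_n, y_n]`. -/
abbrev EvenAlg (k : Type u) [Field k] (n : ℕ) : Type u := MvPolynomial (Fin n ⊕ Fin n) k

namespace EvenAlg

/-- The variable `x_i`. -/
def x {n : ℕ} (i : Fin n) : EvenAlg k n := X (Sum.inl i)

/-- The variable `y_i`. -/
def y {n : ℕ} (i : Fin n) : EvenAlg k n := X (Sum.inr i)

end EvenAlg

open EvenAlg in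
/-- The Poisson bracket of `A^{P,Q}_{n,Γ}(k)`. -/
structure IsEvenBracket {n : ℕ} (γ : Matrix (Fin n) (Fin n) k) (p q : Fin n → k)
    (π : PoissonBracket k (EvenAlg k n)) : Prop where
  y_y : ∀ i j, π.br (y i) (y j) = C (γ i j) * y i * y j
  x_y_lt : ∀ i j, i < j → π.br (x i) (y j) = C (p j + γ j i) * x i * y j
  x_y_gt : ∀ i j, j < i → π.br (x i) (y j) = C (q j + γ j i) * x i * y j
  x_x : ∀ i j, i < j → π.br (x i) (x j) = C (q i - p j + γ i j) * x i * x j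
  x_y : ∀ i, π.br (x i) (y i) =
    C (q i) * x i * y i + (∑ l ∈ Finset.Iio i, C (q l - p l) * x l * y l)

/-- `h . x_i = h_i x_i` and `h . y_i = h_1 h_{n+1} h_i⁻¹ y_i` for `h ∈ (kˣ)^{n+1}`. -/
def evenAction (k : Type u) [Field k] (n : ℕ) :
    (Fin (n + 1) → kˣ) →* (EvenAlg k n ≃ₐ[k] EvenAlg k n) :=
  scalingAction
    { toFun := fun h => Sum.elim (fun i => h i.castSucc)
        (fun i => h 0 * h (Fin.last n) * (h i.castSucc)⁻¹)
      map_one' := by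
        funext s
        cases s <;> simp
      map_mul' := fun g h => by
        funext s
        cases s
        · rfl
        · simp only [Sum.elim_inr, Pi.mul_apply, mul_inv]
          ac_rfl }

/-! ### Odd-dimensional analogues -/

/-- `k[z_0, x_1, y_1, …, x_n, y_n]`. -/
abbrev OddAlg (k : Type u) [Field k] (n : ℕ) : Type u :=
  MvPolynomial (Option (Fin n ⊕ Fin n)) k

namespace OddAlg

/-- The variable `z_0`. -/
def z {n : ℕ} : OddAlg k n := X none

/-- The variable `x_i`. -/
def x {n : ℕ} (i : Fin n) : OddAlg k n := X (some (Sum.inl i))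

/-- The variable `y_i`. -/
def y {n : ℕ} (i : Fin n) : OddAlg k n := X (some (Sum.inr i))

end OddAlg

open OddAlg in
/-- The odd-dimensional analogue of the bracket of `A^{P,Q}_{n,Γ}(k)`, with one more
parameter `lam`. -/
structure IsOddBracket {n : ℕ} (γ : Matrix (Fin n) (Fin n) k) (p q : Fin n → k) (lam : k)
    (π : PoissonBracket k (OddAlg k n)) : Prop where
  z_x : ∀ i, π.br z (x i) = C (-(p i / 2)) * z * x i
  z_y : ∀ i, π.br z (y i) = C (p i / 2) * z * y i
  y_y : ∀ i j, π.br (y i) (y j) = C (γ i j) * y i * y j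
  x_y_lt : ∀ i j, i < j → π.br (x i) (y j) = C (p j + γ j i) * x i * y j
  x_y_gt : ∀ i j, j < i → π.br (x i) (y j) = C (q j + γ j i) * x i * y j
  x_x : ∀ i j, i < j → π.br (x i) (x j) = C (q i - p j + γ i j) * x i * x j
  x_y : ∀ i, π.br (x i) (y i) =
    C (q i) * x i * y i + (∑ l ∈ Finset.Iio i, C (q l - p l) * x l * y l) + C lam * z ^ 2

/-- `h . x_i = h_i x_i`, `h . z_0 = h_{n+1} z_0` and `h . y_i = h_{n+1}² h_i⁻¹ y_i` for
`h ∈ (kˣ)^{n+1}`. -/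
def oddAction (k : Type u) [Field k] (n : ℕ) :
    (Fin (n + 1) → kˣ) →* (OddAlg k n ≃ₐ[k] OddAlg k n) :=
  scalingAction
    { toFun := fun h s => s.elim (h (Fin.last n)) (Sum.elim (fun i => h i.castSucc)
        (fun i => h (Fin.last n) ^ 2 * (h i.castSucc)⁻¹))
      map_one' := by
        funext s
        rcases s with _ | s | s <;> simp
      map_mul' := fun g h => by
        funext s
        rcases s with _ | s | s
        · rfl
        · rfl
        · simp only [Option.elim_some, Sum.elim_inr, Pi.mul_apply, mul_inv, mul_pow]
          ac_rfl }

/-! ### Quantum symmetric and antisymmetric matrices -/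

/-- `sgn a b` is `sign (a - b)`. -/
def sgn {n : ℕ} (a b : Fin n) : ℤ := Int.sign ((a : ℤ) - (b : ℤ))

/-- `k[y_ij | 1 ≤ i ≤ j ≤ n]`. -/
abbrev SymMatAlg (k : Type u) [Field k] (n : ℕ) : Type u :=
  MvPolynomial {s : Fin n × Fin n // s.1 ≤ s.2} k

/-- The variable `y_ij` for `i ≤ j`, extended by `y_ji = y_ij`. -/
def SymMatAlg.y {n : ℕ} (i j : Fin n) : SymMatAlg k n :=
  if h : i ≤ j then X ⟨(i, j), h⟩ else X ⟨(j, i), (not_le.mp h).le⟩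

open SymMatAlg in
/-- The Poisson bracket on `k[y_ij | i ≤ j]`, the semiclassical limit of quantum symmetric
matrices. -/
def IsSymBracket {n : ℕ} (π : PoissonBracket k (SymMatAlg k n)) : Prop :=
  ∀ i j l m : Fin n, i ≤ j → l ≤ m →
    π.br (y i j) (y l m) =
      ((sgn l j + sgn m i : ℤ) : SymMatAlg k n) * y i l * y j m +
        ((sgn l i + sgn m j : ℤ) : SymMatAlg k n) * y i m * y j l

/-- `h . y_ij = h_i h_j y_ij` for `h ∈ (kˣ)^n`. -/
def symAction (k : Type u) [Field k] (n : ℕ) :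
    (Fin n → kˣ) →* (SymMatAlg k n ≃ₐ[k] SymMatAlg k n) :=
  scalingAction
    { toFun := fun h s => h s.1.1 * h s.1.2
      map_one' := by ext; simp
      map_mul' := fun g h => by
        funext s
        exact mul_mul_mul_comm _ _ _ _ }

/-- `k[y_ij | 1 ≤ i < j ≤ n]`. -/
abbrev AntisymMatAlg (k : Type u) [Field k] (n : ℕ) : Type u :=
  MvPolynomial {s : Fin n × Fin n // s.1 < s.2} k

/-- The variable `y_ij` for `i < j`, extended by `y_ji = - y_ij` and `y_ii = 0`. -/
def AntisymMatAlg.y {n : ℕ} (i j : Fin n) : AntisymMatAlg k n :=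
  if h : i < j then X ⟨(i, j), h⟩ else if h' : j < i then -X ⟨(j, i), h'⟩ else 0

open AntisymMatAlg in
/-- The Poisson bracket on `k[y_ij | i < j]`, the semiclassical limit of quantum antisymmetric
matrices. -/
def IsAntisymBracket {n : ℕ} (π : PoissonBracket k (AntisymMatAlg k n)) : Prop :=
  ∀ i j l m : Fin n, i < j → l < m →
    π.br (y i j) (y l m) =
      ((sgn l j + sgn m i : ℤ) : AntisymMatAlg k n) * y i l * y j m -
        ((sgn l i + sgn m j : ℤ) : AntisymMatAlg k n) * y i m * y j l

/-- `h . y_ij = h_i h_j y_ij` for `h ∈ (kˣ)^n`. -/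
def antisymAction (k : Type u) [Field k] (n : ℕ) :
    (Fin n → kˣ) →* (AntisymMatAlg k n ≃ₐ[k] AntisymMatAlg k n) :=
  scalingAction
    { toFun := fun h s => h s.1.1 * h s.1.2
      map_one' := by ext; simp
      map_mul' := fun g h => by
        funext s
        exact mul_mul_mul_comm _ _ _ _ }

end Families

end PoissonDME

end

set_option linter.unusedSimpArgs false

/-! Existence and uniqueness come from the freeness of the polynomial algebra: a bracket is
determined by its values on pairs of variables, and antisymmetric values extend to a Poisson bracket
as soon as the Jacobi identity holds on triples of variables. For matrices this reduces to one
identity for cyclic sums of signs. For the symplectic and euclidean families it holds because the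
brackets are logarithmic up to partial sums, on which the other variables act logarithmically again.

The bound `2 ^ N` comes from building `A` as an iterated Poisson-Ore extension. When `x` is adjoined
to `B`, one has `{x, b} = η(b) x + δ(b)` with `η` induced by the Lie algebra of the torus and `η(x)
= c x`, `c ≠ 0`. A torus-stable Poisson prime `P` is stable under `η`. Either `P ∩ B[x]` is extended
from `P ∩ B`, or `P` contains some `a x + b` with `a, b ∈ B`, `a ∉ P`, and this relation is unique
up to proportionality. In both cases the key fact is that an element `u` of the fraction field with
`{u, -} = u η` and `η(u) = c u` satisfies `0 = {u, u} = c u²`, hence vanishes. So each step offers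
at most two choices (`IsPoissonExtension.exists_linear`, `IsPoissonExtension.linear_unique`).

The Dixmier-Moeglin equivalence is a cycle of three implications. Locally closed implies primitive
because `A` is a Jacobson ring and, in characteristic zero, Poisson cores of primes are prime.
Primitive implies rational because the Poisson center of `Fract (A / P)` lies in the localization at
the maximal ideal `M` whose core is `P`, where it can be compared with the finite extension `A / M`
of `k`. Rational implies locally closed by finiteness: a Poisson rational prime is the only Poisson
prime above itself with the same homogeneous elements (`IsPoissonRational.eq_of_le`), and an element
outside `P` lying in all stable Poisson primes not contained in `P` excludes every other Poisson
prime above `P`. -/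

namespace PoissonDME

universe u v

/-! ### Primes and derivations in characteristic zero -/

section Derivations

variable {k : Type u} {A : Type v} [Field k] [CommRing A] [Algebra k A]

/-- Iterated Leibniz rule. -/
theorem derivation_iterate_mul (D : Derivation k A A) (n : ℕ) (a b : A) :
    D^[n] (a * b) =
      ∑ ij ∈ Finset.HasAntidiagonal.antidiagonal n,
        (n.choose ij.1 : A) * (D^[ij.1] a * D^[ij.2] b) := by
  induction n with
  | zero => simp
  | succ n ih =>
    rw [Finset.sum_antidiagonal_choose_succ_mul (fun i j => D^[i] a * D^[j] b) n,
      Function.iterate_succ_apply', ih, map_sum, ← Finset.sum_add_distrib]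
    refine Finset.sum_congr rfl fun ij hij => ?_
    rw [Finset.HasAntidiagonal.mem_antidiagonal] at hij
    have hc : n.choose ij.2 = n.choose ij.1 := by
      rw [← hij, Nat.add_comm, Nat.choose_symm_add, Nat.add_comm]
    simp only [Derivation.leibniz, Derivation.map_natCast, smul_eq_mul,
      Function.iterate_succ_apply', hc]
    ring

/-- The elements all of whose iterated derivatives lie in an ideal. -/
def derivationCore (D : Derivation k A A) (P : Ideal A) : Ideal A where
  carrier := {a | ∀ n, D^[n] a ∈ P}
  add_mem' {a b} ha hb n := by
    rw [iterate_map_add]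
    exact P.add_mem (ha n) (hb n)
  zero_mem' n := by
    rw [iterate_map_zero]
    exact P.zero_mem
  smul_mem' c a ha n := by
    rw [smul_eq_mul, derivation_iterate_mul]
    exact P.sum_mem fun ij _ => P.mul_mem_left _ (P.mul_mem_left _ (ha _))

variable [CharZero k]

theorem natCast_notMem_of_isPrime (k : Type u) {A : Type v} [Field k] [CharZero k]
    [CommRing A] [Algebra k A] (P : Ideal A) [hP : P.IsPrime] {n : ℕ} (hn : n ≠ 0) :
    (n : A) ∉ P := by
  intro h
  have hu : IsUnit (algebraMap k A n) :=
    (isUnit_iff_ne_zero.2 (Nat.cast_ne_zero.2 hn)).map _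
  rw [map_natCast] at hu
  exact hP.ne_top (P.eq_top_of_isUnit_mem h hu)

/-- If `a` and `b` are outside the core, take the least `m`, `n` with `D^[m] a` and `D^[n] b`
outside `P`. Modulo `P` only one term of the Leibniz expansion of `D^[m + n] (a * b)` survives, with
binomial coefficient `(m + n).choose m`, which is a unit in characteristic zero. -/
theorem derivationCore_isPrime (D : Derivation k A A) (P : Ideal A) [hP : P.IsPrime] :
    (derivationCore D P).IsPrime := by
  refine ⟨fun h => hP.ne_top ?_, fun {a b} hab => ?_⟩
  · rw [Ideal.eq_top_iff_one] at h ⊢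
    exact h 0
  · by_contra! hne
    have ha : ∃ n, D^[n] a ∉ P := not_forall.1 hne.1
    have hb : ∃ n, D^[n] b ∉ P := not_forall.1 hne.2
    classical
    have key := hab (Nat.find ha + Nat.find hb)
    rw [derivation_iterate_mul, ← Finset.add_sum_erase _ _
      (Finset.HasAntidiagonal.mem_antidiagonal.2
        (rfl : (Nat.find ha, Nat.find hb).1 + (Nat.find ha, Nat.find hb).2 = _)),
      Submodule.add_mem_iff_left] at key
    · rcases hP.mem_or_mem key with h | h
      · exact natCast_notMem_of_isPrime k P
          (Nat.choose_pos (Nat.le_add_right _ _)).ne' h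
      · exact (hP.mem_or_mem h).elim (Nat.find_spec ha) (Nat.find_spec hb)
    · refine P.sum_mem fun ij hij => ?_
      rw [Finset.mem_erase, Finset.HasAntidiagonal.mem_antidiagonal] at hij
      obtain ⟨hne, hs⟩ := hij
      refine P.mul_mem_left _ ?_
      rcases lt_or_ge ij.1 (Nat.find ha) with h | h
      · exact P.mul_mem_right _ (not_not.1 (Nat.find_min ha h))
      · have h2 : ij.2 < Nat.find hb := by
          by_contra h2
          exact hne (Prod.ext (by simp only; omega) (by simp only; omega))
        exact P.mul_mem_left _ (not_not.1 (Nat.find_min hb h2))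

/-- Minimal primes over an ideal stable under a derivation are stable (characteristic zero). -/
theorem derivation_mem_of_mem_minimalPrimes (D : Derivation k A A) {I P : Ideal A}
    (hI : ∀ a ∈ I, D a ∈ I) (hP : P ∈ I.minimalPrimes) {a : A} (ha : a ∈ P) : D a ∈ P := by
  have := hP.1.1
  have hcore := derivationCore_isPrime D P
  have hle : derivationCore D P ≤ P := fun b hb => hb 0
  have hI' : I ≤ derivationCore D P := fun b hb n => by
    refine hP.1.2 ?_
    induction n with
    | zero => exact hb
    | succ n ih =>
      rw [Function.iterate_succ_apply']
      exact hI _ ih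
  -- The core is a prime between `I` and `P`, so minimality puts `a` in it; the first iterate is `D
  -- a`.
  exact hP.2 ⟨hcore, hI'⟩ hle ha 1

end Derivations

/-! ### Poisson cores and locally closed points -/

section Brackets

variable {k : Type u} {A : Type v} [Field k] [CommRing A] [Algebra k A] (π : PoissonBracket k A)

namespace PoissonBracket

theorem antisymm (a b : A) : π.br a b = -π.br b a := by
  have h := π.self_eq_zero (a + b)
  simp only [map_add, LinearMap.add_apply, π.self_eq_zero, zero_add, add_zero] at h
  exact eq_neg_of_add_eq_zero_right h

theorem leibniz_left (a b c : A) : π.br (a * b) c = π.br a c * b + a * π.br b c := by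
  rw [π.antisymm, π.leibniz, π.antisymm a c, π.antisymm b c]
  ring

/-- The Hamiltonian derivation `{a, -}`. -/
noncomputable def ad (a : A) : Derivation k A A :=
  Derivation.mk' (π.br a) fun b c => by
    rw [π.leibniz]
    simp only [smul_eq_mul]
    ring

@[simp]
theorem ad_apply (a b : A) : π.ad a b = π.br a b :=
  rfl

end PoissonBracket

variable {π}

theorem IsPoissonIdeal.br_mem_left {I : Ideal A} (hI : IsPoissonIdeal π I) {a : A} (ha : a ∈ I)
    (b : A) : π.br a b ∈ I := by
  rw [π.antisymm]
  exact I.neg_mem (hI b a ha)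

theorem isPoissonIdeal_sSup {S : Set (Ideal A)} (hS : ∀ I ∈ S, IsPoissonIdeal π I) :
    IsPoissonIdeal π (sSup S) := by
  intro a b hb
  rw [sSup_eq_iSup'] at hb
  induction hb using Submodule.iSup_induction' with
  | mem I x hx => exact Submodule.mem_sSup_of_mem I.2 (hS I I.2 a x hx)
  | zero => simp
  | add x y _ _ hx hy =>
    rw [map_add]
    exact Ideal.add_mem _ hx hy

theorem exists_isPoissonCore (J : Ideal A) : ∃ C, IsPoissonCore π J C :=
  ⟨sSup {I | IsPoissonIdeal π I ∧ I ≤ J},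
    ⟨isPoissonIdeal_sSup fun _ hI => hI.1, sSup_le fun _ hI => hI.2⟩,
    fun _ hI => le_sSup hI⟩

/-- A minimal prime over `C` inside `J` is stable under every Hamiltonian derivation, so it is a
Poisson ideal in `J` and cannot exceed the core `C`. -/
theorem IsPoissonCore.isPrime [CharZero k] {J C : Ideal A} [J.IsPrime]
    (hC : IsPoissonCore π J C) : C.IsPrime := by
  obtain ⟨P, hP, hPJ⟩ := Ideal.exists_minimalPrimes_le hC.1.2
  have hPP : IsPoissonIdeal π P := fun a b hb =>
    derivation_mem_of_mem_minimalPrimes (π.ad a) (fun c hc => hC.1.1 a c hc) hP hb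
  have : C = P := le_antisymm hP.1.2 (hC.2 ⟨hPP, hPJ⟩)
  rw [this]
  exact hP.1.1

/-- A prime `P` is a locally closed point iff some element avoids `P` but lies in all
larger Poisson primes. -/
theorem isLocallyClosedPoint_iff {P : Ideal A} :
    IsLocallyClosedPoint π P ↔ IsPoissonPrime π P ∧
      ∃ s ∉ P, ∀ P', IsPoissonPrime π P' → P ≤ P' → s ∉ P' → P' = P := by
  constructor
  · rintro ⟨⟨Q, hQ⟩, rfl, U, Z, hU, hZ, hUZ⟩
    refine ⟨⟨Q.2, hQ⟩, ?_⟩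
    obtain ⟨U', hU', rfl⟩ := isOpen_induced_iff.1 hU
    obtain ⟨Z', hZ', rfl⟩ := isClosed_induced_iff.1 hZ
    have hmem : (⟨Q, hQ⟩ : PoissonSpectrum π) ∈ Subtype.val ⁻¹' U' ∩ Subtype.val ⁻¹' Z' :=
      hUZ ▸ rfl
    obtain ⟨S, hS⟩ := (PrimeSpectrum.isOpen_iff _).1 hU'
    obtain ⟨T, hT⟩ := (PrimeSpectrum.isClosed_iff_zeroLocus _).1 hZ'
    have h1 : ¬ S ⊆ (Q.asIdeal : Set A) := fun h => by
      have h2 : Q ∈ U'ᶜ := hS ▸ h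
      exact h2 hmem.1
    obtain ⟨s, hsS, hsQ⟩ := Set.not_subset.1 h1
    refine ⟨s, hsQ, fun P' hP' hle hs => ?_⟩
    have h3 : (⟨⟨P', hP'.1⟩, hP'.2⟩ : PoissonSpectrum π) ∈
        ({⟨Q, hQ⟩} : Set (PoissonSpectrum π)) := by
      rw [hUZ]
      refine ⟨?_, ?_⟩
      · by_contra h
        have h4 : (⟨P', hP'.1⟩ : PrimeSpectrum A) ∈ U'ᶜ := h
        rw [hS] at h4
        exact hs (h4 hsS)
      · have h5 : Q ∈ Z' := hmem.2
        change (⟨P', hP'.1⟩ : PrimeSpectrum A) ∈ Z'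
        rw [hT] at h5 ⊢
        exact Set.Subset.trans h5 hle
    exact congrArg (fun x : PoissonSpectrum π => x.1.asIdeal) h3
  · rintro ⟨hP, s, hsP, hs⟩
    refine ⟨⟨⟨P, hP.1⟩, hP.2⟩, rfl, Subtype.val ⁻¹' (PrimeSpectrum.basicOpen s : Set _),
      Subtype.val ⁻¹' PrimeSpectrum.zeroLocus (P : Set A),
      (PrimeSpectrum.basicOpen s).isOpen.preimage continuous_subtype_val,
      (PrimeSpectrum.isClosed_zeroLocus _).preimage continuous_subtype_val, ?_⟩
    ext Q
    constructor
    · rintro rfl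
      exact ⟨hsP, fun _ h => h⟩
    · rintro ⟨h1, h2⟩
      exact Subtype.ext (PrimeSpectrum.ext (hs _ ⟨Q.1.2, Q.2⟩ h2 h1))

/-- In a Jacobson ring some maximal `M ⊇ P` misses the separating element `s`. The core of `M` is
then a Poisson prime above `P` that misses `s`, so it is `P`. -/
theorem IsLocallyClosedPoint.isPoissonPrimitive [CharZero k] [IsJacobsonRing A] {P : Ideal A}
    (h : IsLocallyClosedPoint π P) : IsPoissonPrimitive π P := by
  obtain ⟨hP, s, hsP, hs⟩ := isLocallyClosedPoint_iff.1 h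
  have hrad : P.jacobson = P :=
    isJacobsonRing_iff_prime_eq.1 ‹_› P hP.1
  rw [← hrad, Ideal.jacobson, Submodule.mem_sInf] at hsP
  push Not at hsP
  obtain ⟨M, ⟨hPM, hM⟩, hsM⟩ := hsP
  have := hM.isPrime
  obtain ⟨C, hC⟩ := exists_isPoissonCore (π := π) M
  have hCP := hs C ⟨hC.isPrime, hC.1.1⟩ (hC.2 ⟨hP.2, hPM⟩) fun h => hsM (hC.1.2 h)
  exact ⟨M, hM, hCP ▸ hC⟩

end Brackets

/-! ### Extension of derivations to fraction fields -/

section FractionField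

variable {k : Type u} {A : Type v} [Field k] [CommRing A] [Algebra k A]

/-- A derivation from `A` which vanishes on the kernel of `A → K` extends to the fraction
field `K` of the image. -/
theorem exists_derivation_fractionRing (P : Ideal A) [P.IsPrime] {M : Type*} [AddCommGroup M]
    [Module k M] [Module (FractionRing (A ⧸ P)) M]
    [IsScalarTower k (FractionRing (A ⧸ P)) M] (d : A →ₗ[k] M)
    (hd : ∀ a b, d (a * b) =
      algebraMap (A ⧸ P) (FractionRing (A ⧸ P)) (Ideal.Quotient.mk P a) • d b +
      algebraMap (A ⧸ P) (FractionRing (A ⧸ P)) (Ideal.Quotient.mk P b) • d a)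
    (hP : ∀ a ∈ P, d a = 0) :
    ∃ D : Derivation k (FractionRing (A ⧸ P)) M,
      ∀ a, D (algebraMap (A ⧸ P) (FractionRing (A ⧸ P)) (Ideal.Quotient.mk P a)) = d a := by
  let _ : Module (A ⧸ P) M := Module.compHom M (algebraMap (A ⧸ P) (FractionRing (A ⧸ P)))
  have : IsScalarTower (A ⧸ P) (FractionRing (A ⧸ P)) M :=
    ⟨fun x y m => by rw [Algebra.smul_def, mul_smul]; rfl⟩
  have : IsScalarTower k (A ⧸ P) M := ⟨fun x y m => by
    rw [← algebraMap_smul (FractionRing (A ⧸ P)) (x • y) m,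
      ← algebraMap_smul (FractionRing (A ⧸ P)) y m,
      Algebra.smul_def, map_mul, mul_smul, ← IsScalarTower.algebraMap_apply, algebraMap_smul]⟩
  let d₁ : (A ⧸ P) →ₗ[k] M := (P.restrictScalars k).liftQ d hP
  let d₂ : Derivation k (A ⧸ P) M := Derivation.mk' d₁ fun a b => by
    obtain ⟨a, rfl⟩ := Ideal.Quotient.mk_surjective a
    obtain ⟨b, rfl⟩ := Ideal.Quotient.mk_surjective b
    exact hd a b
  -- A localization is formally étale, so the differentials of the fraction field are the base
  -- change of those of `A / P`; a derivation on `A / P` therefore extends by linearity.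
  have := Algebra.FormallyEtale.of_isLocalization (Rₘ := FractionRing (A ⧸ P))
    (nonZeroDivisors (A ⧸ P))
  let e := KaehlerDifferential.tensorKaehlerEquivOfFormallyEtale k (A ⧸ P) (FractionRing (A ⧸ P))
  let g : TensorProduct (A ⧸ P) (FractionRing (A ⧸ P)) (Ω[(A ⧸ P)⁄k]) →ₗ[FractionRing (A ⧸ P)] M :=
    d₂.liftKaehlerDifferential.liftBaseChange _
  refine ⟨(g ∘ₗ e.symm.toLinearMap).compDer (KaehlerDifferential.D k _), fun a => ?_⟩
  change g (e.symm (KaehlerDifferential.D k _ (algebraMap _ _ _))) = _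
  rw [KaehlerDifferential.tensorKaehlerEquivOfFormallyEtale_symm_D_algebraMap]
  simp only [g, LinearMap.liftBaseChange_tmul, one_smul, Derivation.liftKaehlerDifferential_comp_D]
  rfl

/-- A function satisfying the Leibniz rule vanishes if it vanishes on the image of `A`. -/
theorem eq_zero_of_leibniz (P : Ideal A) [P.IsPrime]
    {F : FractionRing (A ⧸ P) → FractionRing (A ⧸ P)}
    (hF : ∀ a b, F (a * b) = F a * b + a * F b)
    (h0 : ∀ a, F (algebraMap (A ⧸ P) _ (Ideal.Quotient.mk P a)) = 0)
    (z : FractionRing (A ⧸ P)) : F z = 0 := by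
  obtain ⟨a, b, hb, rfl⟩ := IsFractionRing.div_surjective (A := A ⧸ P) z
  have hb' : algebraMap (A ⧸ P) (FractionRing (A ⧸ P)) b ≠ 0 :=
    IsFractionRing.to_map_ne_zero_of_mem_nonZeroDivisors hb
  obtain ⟨a, rfl⟩ := Ideal.Quotient.mk_surjective a
  obtain ⟨b, rfl⟩ := Ideal.Quotient.mk_surjective b
  have h := hF (algebraMap (A ⧸ P) (FractionRing (A ⧸ P)) (Ideal.Quotient.mk P b))
    (algebraMap (A ⧸ P) (FractionRing (A ⧸ P)) (Ideal.Quotient.mk P a) /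
      algebraMap (A ⧸ P) (FractionRing (A ⧸ P)) (Ideal.Quotient.mk P b))
  rw [mul_div_cancel₀ _ hb', h0, h0, zero_mul, zero_add] at h
  exact (mul_eq_zero.1 h.symm).resolve_left hb'

end FractionField

/-! ### The induced bracket on `Fract (A / P)`, Poisson centers and rationality -/

section InducedBracket

variable {k : Type u} {A : Type v} [Field k] [CommRing A] [Algebra k A]

/-- The canonical map from `A` to the fraction field of `A / P`. -/
noncomputable def toFract (k : Type u) {A : Type v} [Field k] [CommRing A] [Algebra k A]
    (P : Ideal A) [P.IsPrime] : A →ₐ[k] FractionRing (A ⧸ P) :=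
  (IsScalarTower.toAlgHom k (A ⧸ P) (FractionRing (A ⧸ P))).comp (Ideal.Quotient.mkₐ k P)

theorem toFract_apply (P : Ideal A) [P.IsPrime] (a : A) :
    toFract k P a = algebraMap (A ⧸ P) (FractionRing (A ⧸ P)) (Ideal.Quotient.mk P a) :=
  rfl

theorem toFract_eq_zero_iff (P : Ideal A) [P.IsPrime] {a : A} : toFract k P a = 0 ↔ a ∈ P := by
  rw [toFract_apply, map_eq_zero_iff _ (IsFractionRing.injective _ _),
    Ideal.Quotient.eq_zero_iff_mem]

theorem toFract_eq_iff (P : Ideal A) [P.IsPrime] {a b : A} :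
    toFract k P a = toFract k P b ↔ a - b ∈ P := by
  rw [← toFract_eq_zero_iff (k := k), map_sub, sub_eq_zero]

theorem exists_toFract_mul_eq (P : Ideal A) [P.IsPrime] (z : FractionRing (A ⧸ P)) :
    ∃ b ∉ P, ∃ a, toFract k P b * z = toFract k P a := by
  obtain ⟨a, b, hb, rfl⟩ := IsFractionRing.div_surjective (A := A ⧸ P) z
  have hb' : algebraMap (A ⧸ P) (FractionRing (A ⧸ P)) b ≠ 0 :=
    IsFractionRing.to_map_ne_zero_of_mem_nonZeroDivisors hb
  obtain ⟨a, rfl⟩ := Ideal.Quotient.mk_surjective a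
  obtain ⟨b, rfl⟩ := Ideal.Quotient.mk_surjective b
  exact ⟨b, fun h => hb' ((toFract_eq_zero_iff (k := k) P).2 h), a, mul_div_cancel₀ _ hb'⟩

variable {π : PoissonBracket k A}

/-- The bracket is extended in one variable at a time. Each `{a, -}` extends to a derivation of the
fraction field `K`; then `a ↦ {a, -}` is itself a derivation of `A` with values in the `K`-vector
space of derivations of `K`, and extends to `K` by the same result. -/
theorem exists_isInducedOnFract {P : Ideal A} (hP : IsPoissonPrime π P) :
    have := hP.1
    ∃ β : PoissonBracket k (FractionRing (A ⧸ P)), IsInducedOnFract π P β := by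
  intro hprime
  have had : ∀ a, ∃ D : Derivation k (FractionRing (A ⧸ P)) (FractionRing (A ⧸ P)),
      ∀ b, D (toFract k P b) = toFract k P (π.br a b) := fun a =>
    exists_derivation_fractionRing P ((toFract k P).toLinearMap ∘ₗ π.br a)
      (fun b c => by
        change toFract k P (π.br a (b * c)) =
          toFract k P b * toFract k P (π.br a c) + toFract k P c * toFract k P (π.br a b)
        rw [π.leibniz, map_add, map_mul, map_mul]
        ring)
      (fun b hb => (toFract_eq_zero_iff P).2 (hP.2 a b hb))
  choose ad had using had
  have hext : ∀ D₁ D₂ : Derivation k (FractionRing (A ⧸ P)) (FractionRing (A ⧸ P)),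
      (∀ a, D₁ (toFract k P a) = D₂ (toFract k P a)) → D₁ = D₂ := fun D₁ D₂ h => by
    ext z
    rw [← sub_eq_zero]
    refine eq_zero_of_leibniz P (F := fun z => D₁ z - D₂ z) (fun a b => ?_) (fun a => ?_) z
    · simp only [Derivation.leibniz, smul_eq_mul]
      ring
    · exact sub_eq_zero.2 (h a)
  obtain ⟨D, hD⟩ := exists_derivation_fractionRing P (k := k)
    (M := Derivation k (FractionRing (A ⧸ P)) (FractionRing (A ⧸ P)))
    { toFun := ad
      map_add' := fun a b => hext _ _ fun c => by
        simp [had]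
      map_smul' := fun r a => hext _ _ fun c => by
        simp [had] }
    (fun a b => hext _ _ fun c => by
      change ad (a * b) (toFract k P c) =
        toFract k P a * ad b (toFract k P c) + toFract k P b * ad a (toFract k P c)
      rw [had, had, had, π.leibniz_left, map_add, map_mul, map_mul]
      ring)
    (fun a ha => hext _ _ fun c => by
      change ad a (toFract k P c) = 0
      rw [had, toFract_eq_zero_iff]
      exact IsPoissonIdeal.br_mem_left hP.2 ha c)
  have hD' : ∀ a b, D (toFract k P a) (toFract k P b) = toFract k P (π.br a b) := fun a b => by
    rw [← had]
    exact congrArg (fun E : Derivation k _ _ => E (toFract k P b)) (hD a)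
  have hanti : ∀ y z, D y z = -D z y := fun y z => by
    rw [← add_eq_zero_iff_eq_neg]
    refine eq_zero_of_leibniz P (F := fun y => D y z + D z y) (fun a b => ?_) (fun a => ?_) y
    · simp only [Derivation.leibniz, smul_eq_mul, Derivation.add_apply, Derivation.smul_apply]
      ring
    · refine eq_zero_of_leibniz P
        (F := fun z => D (toFract k P a) z + D z (toFract k P a)) (fun b c => ?_) (fun b => ?_) z
      · simp only [Derivation.leibniz, smul_eq_mul, Derivation.add_apply, Derivation.smul_apply]
        ring
      · change D (toFract k P a) (toFract k P b) + D (toFract k P b) (toFract k P a) = 0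
        rw [hD', hD', π.antisymm, map_neg, neg_add_cancel]
  -- In arbitrary characteristic antisymmetry does not suffice. Instead write `b z = a` with `a, b`
  -- from `A` and expand `0 = {b z, b z}`: the mixed terms cancel and leave `b² {z, z}`.
  have hself : ∀ z, D z z = 0 := by
    intro z
    obtain ⟨b, hb, a, hab⟩ := exists_toFract_mul_eq (k := k) P z
    have hb' : toFract k P b ≠ 0 := fun h => hb ((toFract_eq_zero_iff P).1 h)
    obtain rfl : z = toFract k P a / toFract k P b := by
      rw [← hab, mul_div_cancel_left₀ _ hb']
    generalize hz : toFract k P a / toFract k P b = z at *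
    have h1 : D (toFract k P b * z) (toFract k P b * z) = 0 := by
      rw [hab, hD', π.self_eq_zero, map_zero]
    have hbb : D (toFract k P b) (toFract k P b) = 0 := by
      rw [hD', π.self_eq_zero, map_zero]
    simp only [Derivation.leibniz, smul_eq_mul, Derivation.add_apply, Derivation.smul_apply, hbb,
      hanti z (toFract k P b)] at h1
    have h2 : toFract k P b * toFract k P b * D z z = 0 := by linear_combination h1
    exact (mul_eq_zero.1 h2).resolve_left (mul_ne_zero hb' hb')
  have hjac : ∀ x y z, D x (D y z) + D y (D z x) + D z (D x y) = 0 := by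
    -- The Jacobi expression is a derivation in its last variable, so it may be checked on the image
    -- of `A` there. Its cyclic symmetry then moves the other two variables to the last place in
    -- turn.
    have step : ∀ x y, (∀ c, D x (D y (toFract k P c)) + D y (D (toFract k P c) x) +
        D (toFract k P c) (D x y) = 0) → ∀ z, D x (D y z) + D y (D z x) + D z (D x y) = 0 := by
      intro x y h
      refine eq_zero_of_leibniz P (F := fun z => D x (D y z) + D y (D z x) + D z (D x y))
        (fun b c => ?_) h
      simp only [Derivation.leibniz, smul_eq_mul, Derivation.add_apply, Derivation.smul_apply,
        map_add]
      rw [hanti x b, hanti x c]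
      ring
    intro x y
    refine step x y fun c => ?_
    suffices h : ∀ a, D (toFract k P c) (D x a) + D x (D a (toFract k P c)) +
        D a (D (toFract k P c) x) = 0 by linear_combination h y
    refine step (toFract k P c) x fun b => ?_
    suffices h : ∀ a, D (toFract k P b) (D (toFract k P c) a) +
        D (toFract k P c) (D a (toFract k P b)) +
        D a (D (toFract k P b) (toFract k P c)) = 0 by linear_combination h x
    refine step (toFract k P b) (toFract k P c) fun a => ?_
    simp only [hD', ← map_add, π.jacobi, map_zero]
  exact ⟨{  br := LinearMap.mk₂ k (fun y z => D y z) (by simp) (by simp) (by simp) (by simp)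
            self_eq_zero := hself
            jacobi := hjac
            leibniz := fun a b c => by
              simp only [LinearMap.mk₂_apply, Derivation.leibniz, smul_eq_mul]
              ring }, hD'⟩

theorem poissonCenter_inv {K : Type*} [Field K] [Algebra k K] {β : PoissonBracket k K} {z : K}
    (hz : z ∈ poissonCenter β) : z⁻¹ ∈ poissonCenter β := by
  intro b
  rcases eq_or_ne z 0 with rfl | h0
  · simp
  have h := β.leibniz_left z z⁻¹ b
  rw [mul_inv_cancel₀ h0, hz b, zero_mul, zero_add, β.antisymm 1 b, ← β.ad_apply b 1,
    Derivation.map_one_eq_zero, neg_zero] at h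
  exact (mul_eq_zero.1 h.symm).resolve_left h0

theorem poissonCenter_aeval {B : Type*} [CommRing B] [Algebra k B] {β : PoissonBracket k B} {z : B}
    (hz : z ∈ poissonCenter β) (p : Polynomial k) : p.aeval z ∈ poissonCenter β := by
  intro b
  rw [β.antisymm, ← β.ad_apply, Derivation.map_aeval, β.ad_apply, β.antisymm b z, hz b, neg_zero,
    smul_zero, neg_zero]

/-- The Poisson center of `Fract (A / C)` is contained in the localization at `M`, if `C` is the
Poisson core of `M`. -/
theorem IsPoissonCore.exists_mul_center_eq {M C : Ideal A} [C.IsPrime] (hC : IsPoissonCore π M C)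
    {β : PoissonBracket k (FractionRing (A ⧸ C))} (hβ : IsInducedOnFract π C β)
    {z : FractionRing (A ⧸ C)} (hz : z ∈ poissonCenter β) :
    ∃ b ∉ M, ∃ a, toFract k C b * z = toFract k C a := by
  -- The ideal of denominators of `z`, which is Poisson because `z` is central. It contains a
  -- denominator outside `C`, so it is not inside the core of `M`, hence not inside `M`.
  let I : Ideal A :=
    { carrier := {b | ∃ a, toFract k C b * z = toFract k C a}
      add_mem' := by
        rintro b b' ⟨a, ha⟩ ⟨a', ha'⟩
        exact ⟨a + a', by rw [map_add, map_add, add_mul, ha, ha']⟩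
      zero_mem' := ⟨0, by rw [map_zero, zero_mul]⟩
      smul_mem' := by
        rintro c b ⟨a, ha⟩
        exact ⟨c * a, by rw [smul_eq_mul, map_mul, map_mul, mul_assoc, ha]⟩ }
  have hI : IsPoissonIdeal π I := by
    rintro c b ⟨a, ha⟩
    refine ⟨π.br c a, ?_⟩
    have h := β.leibniz (toFract k C c) (toFract k C b) z
    rw [ha, β.antisymm _ z, hz, neg_zero, mul_zero, add_zero] at h
    exact ((hβ c a).symm.trans h).symm ▸ congrArg (· * z) (hβ c b).symm
  by_contra! hne
  obtain ⟨b, hb, a, hab⟩ := exists_toFract_mul_eq (k := k) C z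
  have hIM : I ≤ M := fun b hb => by
    by_contra h
    exact hne b h hb.choose hb.choose_spec
  exact hb (hC.2 ⟨hI, hIM⟩ ⟨a, hab⟩)

/-- Clearing denominators in `p(a / b)` gives `∑ p_i a^i b^(d - i)`, which is formed in `A` before
any map is applied. The same `c` therefore serves two homomorphisms, and a relation found over one
of them can be transported to the other. -/
theorem aeval_mul_pow_mem {K L : Type v} [CommRing K] [Algebra k K] [Field L] [Algebra k L]
    (f : A →ₐ[k] K) (g : A →ₐ[k] L) {a b : A} {z : K}
    (h : f b * z = f a) (hb : g b ≠ 0) (p : Polynomial k) :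
    ∃ c, f b ^ p.natDegree * p.aeval z = f c ∧
      g b ^ p.natDegree * p.aeval (g a / g b) = g c := by
  have aux : ∀ (R : Type v) [CommRing R] [Algebra k R] (φ : A →ₐ[k] R) (y : R),
      φ b * y = φ a → φ b ^ p.natDegree * p.aeval y =
        φ (∑ i ∈ Finset.range (p.natDegree + 1),
          algebraMap k A (p.coeff i) * (a ^ i * b ^ (p.natDegree - i))) := by
    intro R _ _ φ y hy
    rw [Polynomial.aeval_eq_sum_range, Finset.mul_sum, map_sum]
    refine Finset.sum_congr rfl fun i hi => ?_
    rw [Algebra.smul_def, map_mul, map_mul, map_pow, map_pow, ← hy, mul_pow, AlgHom.commutes]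
    have hpow : φ b ^ p.natDegree = φ b ^ i * φ b ^ (p.natDegree - i) := by
      rw [← pow_add, Nat.add_sub_cancel' (Nat.lt_succ_iff.1 (Finset.mem_range.1 hi))]
    rw [hpow]
    ring
  exact ⟨_, aux K f z h, aux L g _ (mul_div_cancel₀ _ hb)⟩

/-- A central `z` is `a / b` with `b ∉ M`, and its residue in the finite extension `A / M` of `k` is
a root of some `p ≠ 0`. Were `p(z)` nonzero, it would be central and invertible, with its inverse
also in the localization at `M`; but `p(z)` has residue zero there. -/
theorem IsPoissonPrimitive.isPoissonRational [CharZero k] [Algebra.FiniteType k A] {P : Ideal A}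
    (h : IsPoissonPrimitive π P) : IsPoissonRational π P := by
  obtain ⟨M, hM, hP⟩ := h
  have hMp := hM.isPrime
  have hPp := hP.isPrime
  obtain ⟨β, hβ⟩ := exists_isInducedOnFract ⟨hPp, hP.1.1⟩
  refine ⟨⟨hPp, hP.1.1⟩, β, hβ, fun z hz => ?_⟩
  let _ := Ideal.Quotient.field M
  have hfin : Module.Finite k (A ⧸ M) := finite_of_finite_type_of_isJacobsonRing k (A ⧸ M)
  obtain ⟨b, hb, a, hab⟩ := hP.exists_mul_center_eq hβ hz
  have hmk : ∀ x, Ideal.Quotient.mkₐ k M x = 0 ↔ x ∈ M := fun x =>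
    Ideal.Quotient.eq_zero_iff_mem
  have hb0 : Ideal.Quotient.mkₐ k M b ≠ 0 := fun h => hb ((hmk b).1 h)
  obtain ⟨p, hp0, hp⟩ := Algebra.IsAlgebraic.isAlgebraic (R := k)
    (Ideal.Quotient.mkₐ k M a / Ideal.Quotient.mkₐ k M b)
  refine ⟨p, hp0, ?_⟩
  by_contra hpz
  obtain ⟨c, hc, hc'⟩ := aeval_mul_pow_mem (toFract k P) (Ideal.Quotient.mkₐ k M) hab hb0 p
  rw [hp, mul_zero, eq_comm, hmk] at hc'
  -- Writing the inverse of `p(z)` as `a' / b'` with `b' ∉ M` yields `b' b ^ d ≡ a' c` modulo `P`,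
  -- where `c ∈ M`; so `b'` or `b` would lie in `M`.
  obtain ⟨b', hb', a', hab'⟩ := hP.exists_mul_center_eq hβ
    (poissonCenter_inv (poissonCenter_aeval hz p))
  have h1 : toFract k P (b' * b ^ p.natDegree) = toFract k P (a' * c) := by
    rw [map_mul, map_mul, map_pow, ← hc, ← hab']
    field_simp
  have h2 : b' * b ^ p.natDegree ∈ M := by
    have h3 := hP.1.2 ((toFract_eq_iff P).1 h1)
    exact (Submodule.sub_mem_iff_left M (M.mul_mem_left _ hc')).1 h3
  exact (hMp.mem_or_mem h2).elim hb' fun h => hb (hMp.mem_of_pow_mem _ h)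

/-- Suppose that `A` is graded by the subspaces `G i`, compatibly with the bracket. If `P ≤ P'` are
Poisson primes with the same homogeneous elements and `P` is Poisson rational, then `P' = P`. -/
theorem IsPoissonRational.eq_of_le {ι : Type*} [AddCommMonoid ι] {P P' : Ideal A}
    (hP : IsPoissonRational π P) (hP' : IsPoissonPrime π P') (hle : P ≤ P')
    (G : ι → Submodule k A)
    (hmul : ∀ i j, ∀ a ∈ G i, ∀ b ∈ G j, a * b ∈ G (i + j))
    (hbr : ∀ i j, ∀ a ∈ G i, ∀ b ∈ G j, π.br a b ∈ G (i + j))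
    (hspan : ∀ a, ∃ (n : ℕ) (d : Fin n → ι) (f : Fin n → A), (∀ i, f i ∈ G (d i)) ∧ ∑ i, f i = a)
    (hG : ∀ i, ∀ a ∈ G i, a ∈ P' → a ∈ P) : P' = P := by
  have := hP.1.1
  have := hP'.1
  obtain ⟨-, β, hβ, halg⟩ := hP
  -- Induction on the number of homogeneous summands of an element of `P'`.
  suffices h : ∀ (n : ℕ) (d : Fin n → ι) (f : Fin n → A), (∀ i, f i ∈ G (d i)) →
      ∑ i, f i ∈ P' → ∑ i, f i ∈ P by
    refine le_antisymm (fun a ha => ?_) hle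
    obtain ⟨n, d, f, hf, rfl⟩ := hspan a
    exact h n d f hf ha
  intro n
  induction n with
  | zero => simp
  | succ n ih =>
    intro d f hf ha
    by_cases hall : ∀ i, f i ∈ P'
    · exact P.sum_mem fun i _ => hG _ _ (hf i) (hall i)
    push Not at hall
    obtain ⟨g, hg⟩ := hall
    set a := ∑ i, f i with ha_def
    -- In `{b, a} f_g - a {b, f_g}` the contributions of the summand `f_g` cancel. For homogeneous
    -- `b` this is an element of `P'` with one summand fewer, hence in `P` by induction. It is the
    -- numerator of `{b, a / f_g}`, so `a / f_g` is Poisson central.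
    have hshort : ∀ i, ∀ b ∈ G i, π.br b a * f g - a * π.br b (f g) ∈ P := by
      intro i b hb
      have hsum : π.br b a * f g - a * π.br b (f g) =
          ∑ j, (π.br b (f (g.succAbove j)) * f g - f (g.succAbove j) * π.br b (f g)) := by
        rw [ha_def, map_sum, Finset.sum_mul, Finset.sum_mul, ← Finset.sum_sub_distrib,
          Fin.sum_univ_succAbove _ g, mul_comm (f g), sub_self, zero_add]
      rw [hsum]
      refine ih (fun j => i + d (g.succAbove j) + d g) _ (fun j => ?_) ?_
      · refine Submodule.sub_mem _ (hmul _ _ _ (hbr _ _ _ hb _ (hf _)) _ (hf _)) ?_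
        have h1 := hmul _ _ _ (hf (g.succAbove j)) _ (hbr _ _ _ hb _ (hf g))
        rwa [add_left_comm, ← add_assoc] at h1
      · rw [← hsum]
        exact P'.sub_mem (P'.mul_mem_right _ (hP'.2 _ _ ha)) (P'.mul_mem_right _ ha)
    have hshort' : ∀ b, π.br b a * f g - a * π.br b (f g) ∈ P := by
      intro b
      obtain ⟨m, e, c, hc, rfl⟩ := hspan b
      simp only [map_sum, LinearMap.coe_sum, Finset.sum_apply, Finset.sum_mul, Finset.mul_sum,
        ← Finset.sum_sub_distrib]
      exact P.sum_mem fun j _ => hshort _ _ (hc j)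
    have hgP : f g ∉ P := fun h => hg (hle h)
    have hg0 : toFract k P (f g) ≠ 0 := fun h => hgP ((toFract_eq_zero_iff P).1 h)
    obtain ⟨z, hz⟩ : ∃ z, toFract k P (f g) * z = toFract k P a :=
      ⟨toFract k P a / toFract k P (f g), mul_div_cancel₀ _ hg0⟩
    have hcen : z ∈ poissonCenter β := by
      intro y
      refine eq_zero_of_leibniz P (F := fun y => β.br z y) (fun b c => β.leibniz z b c)
        (fun b => ?_) y
      have h1 := (toFract_eq_zero_iff (k := k) P).2 (hshort' b)
      rw [map_sub, map_mul, map_mul, ← hz] at h1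
      have h2 : toFract k P (π.br b a) = β.br (toFract k P b) (toFract k P a) := (hβ b a).symm
      have h3 : toFract k P (π.br b (f g)) = β.br (toFract k P b) (toFract k P (f g)) :=
        (hβ b _).symm
      rw [h2, h3, ← hz, β.leibniz] at h1
      have h4 : toFract k P (f g) * toFract k P (f g) * β.br (toFract k P b) z = 0 := by
        linear_combination h1
      change β.br z (toFract k P b) = 0
      rw [β.antisymm, (mul_eq_zero.1 h4).resolve_left (mul_ne_zero hg0 hg0), neg_zero]
    by_contra haP
    have hz0 : z ≠ 0 := fun h => by
      rw [h, mul_zero] at hz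
      exact haP ((toFract_eq_zero_iff P).1 hz.symm)
    -- A nonzero algebraic `z` is a root of a polynomial with nonzero constant term. Clearing
    -- denominators moves this relation from `P` to `P'`, where `a` becomes zero and only the
    -- constant term is left: a contradiction.
    obtain ⟨p, hp0, hp⟩ := (halg z hcen).exists_nonzero_coeff_and_aeval_eq_zero
      (mem_nonZeroDivisors_of_ne_zero hz0)
    have hg0' : toFract k P' (f g) ≠ 0 := fun h => hg ((toFract_eq_zero_iff P').1 h)
    obtain ⟨c, hc, hc'⟩ := aeval_mul_pow_mem (toFract k P) (toFract k P') hz hg0' p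
    rw [hp, mul_zero, eq_comm, toFract_eq_zero_iff] at hc
    rw [(toFract_eq_zero_iff P').2 ha, (toFract_eq_zero_iff P').2 (hle hc), zero_div,
      ← Polynomial.coeff_zero_eq_aeval_zero'] at hc'
    rcases mul_eq_zero.1 hc' with h | h
    · exact hg0' (eq_zero_of_pow_eq_zero h)
    · exact hp0 ((map_eq_zero _).1 h)

end InducedBracket

/-! ### Torus weights, stable Poisson primes and the Dixmier-Moeglin equivalence -/

section GradedBrackets

variable {k : Type u} [Field k] {σ : Type v} {r : ℕ}

/-- The value of the character of weight `γ` of the torus `(kˣ)^r`. -/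
def torusCharacter (k : Type u) [Field k] {r : ℕ} (γ : Lex (Fin r → ℤ)) :
    (Fin r → kˣ) →* kˣ where
  toFun h := ∏ i, h i ^ ofLex γ i
  map_one' := by simp
  map_mul' g h := by simp [mul_zpow, Finset.prod_mul_distrib]

theorem torusCharacter_apply (γ : Lex (Fin r → ℤ)) (h : Fin r → kˣ) :
    torusCharacter k γ h = ∏ i, h i ^ ofLex γ i :=
  rfl

theorem torusCharacter_add (γ δ : Lex (Fin r → ℤ)) (h : Fin r → kˣ) :
    torusCharacter k (γ + δ) h = torusCharacter k γ h * torusCharacter k δ h := by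
  simp only [torusCharacter_apply, ofLex_add, Pi.add_apply, zpow_add, Finset.prod_mul_distrib]

theorem torusCharacter_zero (h : Fin r → kˣ) : torusCharacter k (0 : Lex (Fin r → ℤ)) h = 1 := by
  simp only [torusCharacter_apply, ofLex_zero, Pi.zero_apply, zpow_zero, Finset.prod_const_one]

/-- Evaluating at the point with `i`-th coordinate 2 and all others 1 recovers the `i`-th exponent,
since the integral powers of 2 are distinct in characteristic zero. -/
theorem torusCharacter_injective [CharZero k] :
    Function.Injective fun γ : Lex (Fin r → ℤ) =>
      (Units.coeHom k).comp (torusCharacter k γ) := by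
  intro γ δ h
  refine ofLex.injective (funext fun i => ?_)
  have h1 := DFunLike.congr_fun h
    (Function.update 1 i (Units.mk0 (2 : k) two_ne_zero) : Fin r → kˣ)
  have h2 : ∀ ε : Lex (Fin r → ℤ), torusCharacter k ε
      (Function.update 1 i (Units.mk0 (2 : k) two_ne_zero) : Fin r → kˣ) =
      Units.mk0 (2 : k) two_ne_zero ^ ofLex ε i := fun ε => by
    rw [torusCharacter_apply, Finset.prod_eq_single i]
    · rw [Function.update_self]
    · intro j _ hj
      rw [Function.update_of_ne hj, Pi.one_apply, one_zpow]
    · simp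
  simp only [MonoidHom.comp_apply, h2, Units.coeHom_apply, Units.val_zpow_eq_zpow_val,
    Units.val_mk0] at h1
  have h3 : ((2 : ℚ) ^ ofLex γ i : ℚ) = 2 ^ ofLex δ i := by
    apply (Rat.cast_injective : Function.Injective (Rat.cast : ℚ → k))
    push_cast
    exact h1
  exact zpow_right_injective₀ (by norm_num) (by norm_num) h3

variable {w : σ → Lex (Fin r → ℤ)} {χ : (Fin r → kˣ) →* (σ → kˣ)}

theorem scalingAction_monomial (hχ : ∀ h s, χ h s = torusCharacter k (w s) h) (h : Fin r → kˣ)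
    (d : σ →₀ ℕ) (c : k) :
    scalingAction χ h (monomial d c) =
      C (torusCharacter k (Finsupp.weight w d) h : k) * monomial d c := by
  induction d using Finsupp.induction_linear generalizing c with
  | zero =>
    change scaleHom (χ h) (monomial 0 c) = _
    rw [map_zero, torusCharacter_zero, Units.val_one, C_1, one_mul]
    exact algHom_C (scaleHom (χ h)) c
  | add d e hd he =>
    rw [← mul_one c, ← monomial_mul, map_mul, hd, he, map_add, torusCharacter_add, Units.val_mul,
      C_mul]
    ring
  | single s n =>
    rw [← C_mul_X_pow_eq_monomial, map_mul, map_pow, scalingAction_X]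
    have h1 : scalingAction χ h (C c : MvPolynomial σ k) = C c := algHom_C (scaleHom (χ h)) c
    rw [h1, hχ, Finsupp.weight_single]
    have h2 : torusCharacter k (n • w s) h = torusCharacter k (w s) h ^ n := by
      induction n with
      | zero => simp [torusCharacter_zero]
      | succ n ih => rw [succ_nsmul, torusCharacter_add, ih, pow_succ]
    rw [h2, mul_pow, Units.val_pow_eq_pow_val, C_pow]
    ring

theorem IsWeightedHomogeneous.scalingAction_eq (hχ : ∀ h s, χ h s = torusCharacter k (w s) h)
    {f : MvPolynomial σ k} {γ : Lex (Fin r → ℤ)} (hf : IsWeightedHomogeneous w f γ)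
    (h : Fin r → kˣ) : scalingAction χ h f = C (torusCharacter k γ h : k) * f := by
  conv_lhs => rw [f.as_sum]
  conv_rhs => rw [f.as_sum]
  rw [map_sum, Finset.mul_sum]
  refine Finset.sum_congr rfl fun d hd => ?_
  rw [scalingAction_monomial hχ, hf (mem_support_iff.1 hd)]

/-- `P` contains the homogeneous components of its elements. -/
theorem component_mem_of_stable [CharZero k] (hχ : ∀ h s, χ h s = torusCharacter k (w s) h)
    {P : Ideal (MvPolynomial σ k)} (hP : ∀ h, ∀ a ∈ P, scalingAction χ h a ∈ P)
    {f : MvPolynomial σ k} (hf : f ∈ P) (γ : Lex (Fin r → ℤ)) :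
    weightedHomogeneousComponent w γ f ∈ P := by
  by_contra hγ
  -- A linear functional vanishing on `P` but not on the component. Applied to the orbit of `f` it
  -- gives a linear relation between distinct characters of the torus, which Dedekind's theorem
  -- forbids.
  obtain ⟨φ, hφ, hφP⟩ := Submodule.exists_le_ker_of_notMem (p := P.restrictScalars k) hγ
  have hfin : (Function.support fun δ => weightedHomogeneousComponent w δ f).Finite :=
    weightedHomogeneousComponent_finsupp f
  have hsum : ∑ δ ∈ hfin.toFinset, φ (weightedHomogeneousComponent w δ f) •
      ((Units.coeHom k).comp (torusCharacter k δ) : (Fin r → kˣ) → k) = 0 := by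
    funext h
    have h1 : φ (scalingAction χ h f) = 0 := hφP (hP h f hf)
    conv at h1 => rw [← sum_weightedHomogeneousComponent w f, finsum_eq_sum _ hfin]
    rw [map_sum, map_sum] at h1
    rw [Finset.sum_apply, Pi.zero_apply, ← h1]
    refine Finset.sum_congr rfl fun δ _ => ?_
    rw [IsWeightedHomogeneous.scalingAction_eq hχ
      (weightedHomogeneousComponent_isWeightedHomogeneous δ f) h, C_mul', map_smul]
    simp [mul_comm]
  have hli := (linearIndependent_monoidHom (Fin r → kˣ) k).comp _
    (torusCharacter_injective (k := k) (r := r))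
  have h0 := linearIndependent_iff'.1 hli hfin.toFinset
    (fun δ => φ (weightedHomogeneousComponent w δ f)) hsum γ
    (by
      rw [Set.Finite.mem_toFinset, Function.mem_support]
      intro h
      exact hγ (h ▸ P.zero_mem))
  exact hφ h0

theorem exists_sum_homogeneous (w : σ → Lex (Fin r → ℤ)) (a : MvPolynomial σ k) :
    ∃ (n : ℕ) (d : Fin n → Lex (Fin r → ℤ)) (f : Fin n → MvPolynomial σ k),
      (∀ i, f i ∈ weightedHomogeneousSubmodule k w (d i)) ∧ ∑ i, f i = a := by
  induction a using MvPolynomial.induction_on' with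
  | monomial d c =>
    exact ⟨1, fun _ => Finsupp.weight w d, fun _ => monomial d c,
      fun _ => isWeightedHomogeneous_monomial w d c rfl, by simp⟩
  | add p q hp hq =>
    obtain ⟨n, d, f, hf, rfl⟩ := hp
    obtain ⟨m, e, g, hg, rfl⟩ := hq
    refine ⟨n + m, Fin.append d e, Fin.append f g, fun i => ?_, by simp [Fin.sum_univ_add]⟩
    refine Fin.addCases (fun i => ?_) (fun i => ?_) i
    · simpa using hf i
    · simpa using hg i

variable [Fintype σ]

theorem mvPolynomial_derivation_eq_sum {M : Type*} [AddCommGroup M] [Module k M]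
    [Module (MvPolynomial σ k) M] [IsScalarTower k (MvPolynomial σ k) M]
    (D : Derivation k (MvPolynomial σ k) M) (f : MvPolynomial σ k) :
    D f = ∑ s, pderiv s f • D (X s) := by
  classical
  let E : Derivation k (MvPolynomial σ k) M :=
    ∑ s, (LinearMap.toSpanSingleton _ _ (D (X s))).compDer (pderiv s)
  have hE : ∀ f, E f = ∑ s, pderiv s f • D (X s) := fun f => by
    simp only [E, ← Derivation.coeFnAddMonoidHom_apply, map_sum]
    rw [Finset.sum_apply]
    rfl
  have : D = E := derivation_ext fun s => by
    rw [hE, Finset.sum_eq_single s]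
    · simp
    · intro t _ ht
      rw [pderiv_X_of_ne ht.symm, zero_smul]
    · simp
  rw [← hE, ← this]

variable {π : PoissonBracket k (MvPolynomial σ k)}

theorem br_eq_sum (f g : MvPolynomial σ k) :
    π.br f g = ∑ s, ∑ t, pderiv s f * pderiv t g * π.br (X s) (X t) := by
  rw [← π.ad_apply, mvPolynomial_derivation_eq_sum, Finset.sum_comm]
  refine Finset.sum_congr rfl fun t _ => ?_
  rw [π.ad_apply, π.antisymm, ← π.ad_apply, mvPolynomial_derivation_eq_sum (π.ad (X t)) f,
    smul_eq_mul,
    ← Finset.sum_neg_distrib, Finset.mul_sum]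
  refine Finset.sum_congr rfl fun s _ => ?_
  rw [smul_eq_mul, π.ad_apply, π.antisymm (X t)]
  ring

theorem PoissonBracket.ext_of_X {π' : PoissonBracket k (MvPolynomial σ k)}
    (h : ∀ s t, π.br (X s) (X t) = π'.br (X s) (X t)) : π = π' := by
  ext1
  refine LinearMap.ext fun f => LinearMap.ext fun g => ?_
  rw [br_eq_sum, br_eq_sum]
  simp only [h]

theorem IsWeightedHomogeneous.br
    (hw : ∀ s t, IsWeightedHomogeneous w (π.br (X s) (X t)) (w s + w t))
    {f g : MvPolynomial σ k} {γ δ : Lex (Fin r → ℤ)} (hf : IsWeightedHomogeneous w f γ)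
    (hg : IsWeightedHomogeneous w g δ) : IsWeightedHomogeneous w (π.br f g) (γ + δ) := by
  rw [br_eq_sum]
  refine IsWeightedHomogeneous.sum _ _ _ fun s _ => IsWeightedHomogeneous.sum _ _ _ fun t _ => ?_
  have h := ((IsWeightedHomogeneous.pderiv (i := s) hf (sub_add_cancel γ (w s))).mul
    (IsWeightedHomogeneous.pderiv (i := t) hg (sub_add_cancel δ (w t)))).mul (hw s t)
  rwa [show γ - w s + (δ - w t) + (w s + w t) = γ + δ by abel] at h

theorem isRationalPoissonAction_scalingAction (hχ : ∀ h s, χ h s = torusCharacter k (w s) h)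
    (hw : ∀ s t, IsWeightedHomogeneous w (π.br (X s) (X t)) (w s + w t)) :
    IsRationalPoissonAction π (scalingAction χ) := by
  refine ⟨?_, fun h a b => ?_⟩
  · rw [IsRationalAction, eq_top_iff, ← adjoin_range_X]
    refine Algebra.adjoin_mono ?_
    rintro _ ⟨s, rfl⟩
    refine ⟨ofLex (w s), fun h => ?_⟩
    rw [scalingAction_X, hχ, C_mul']
    rfl
  · induction a using MvPolynomial.induction_on' with
    | add p q hp hq => simp only [map_add, LinearMap.add_apply, hp, hq]
    | monomial d c =>
      induction b using MvPolynomial.induction_on' with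
      | add p q hp hq => simp only [map_add, hp, hq]
      | monomial e c' =>
        have hd := isWeightedHomogeneous_monomial w d c rfl
        have he := isWeightedHomogeneous_monomial w e c' rfl
        rw [IsWeightedHomogeneous.scalingAction_eq hχ (IsWeightedHomogeneous.br hw hd he),
          IsWeightedHomogeneous.scalingAction_eq hχ hd,
          IsWeightedHomogeneous.scalingAction_eq hχ he, torusCharacter_add]
        simp only [C_mul', map_smul, LinearMap.smul_apply, smul_smul, Units.val_mul]
        rw [mul_comm]

attribute [local instance] MvPolynomial.weightedGradedAlgebra

/-- Every Poisson prime contains a torus-stable Poisson prime with the same homogeneous elements. -/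
theorem exists_stable_le (hχ : ∀ h s, χ h s = torusCharacter k (w s) h)
    (hw : ∀ s t, IsWeightedHomogeneous w (π.br (X s) (X t)) (w s + w t))
    {P : Ideal (MvPolynomial σ k)} (hP : IsPoissonPrime π P) :
    ∃ J ∈ stablePoissonPrimes π (scalingAction χ), J ≤ P ∧
      ∀ γ, ∀ a, IsWeightedHomogeneous w a γ → a ∈ P → a ∈ J := by
  classical
  have hmem : ∀ γ, ∀ a, IsWeightedHomogeneous w a γ → a ∈ P →
      a ∈ (P.homogeneousCore (weightedHomogeneousSubmodule k w)).toIdeal := fun γ a ha haP =>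
    Ideal.mem_homogeneousCore_of_homogeneous_of_mem ⟨γ, ha⟩ haP
  have hle := Ideal.toIdeal_homogeneousCore_le (weightedHomogeneousSubmodule k w) P
  -- The homogeneous core of a prime is prime because the weights form a linearly ordered group;
  -- this is why `ℤ^r` carries the lexicographic order.
  refine ⟨_, ⟨⟨hP.1.homogeneousCore, ?_⟩, ?_⟩, hle, hmem⟩
  · intro a b hb
    obtain ⟨n, d, f, hf, rfl⟩ := exists_sum_homogeneous w a
    rw [← sum_weightedHomogeneousComponent w b,
      finsum_eq_sum _ (weightedHomogeneousComponent_finsupp b)]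
    rw [map_sum]
    refine Ideal.sum_mem _ fun γ _ => ?_
    simp only [map_sum, LinearMap.coe_sum, Finset.sum_apply]
    refine Ideal.sum_mem _ fun i _ => ?_
    have hb' := weightedHomogeneousComponent_mem_of_mem k w
      (P.homogeneousCore (weightedHomogeneousSubmodule k w)).isHomogeneous hb γ
    exact hmem _ _ (IsWeightedHomogeneous.br hw (hf i)
      (weightedHomogeneousComponent_isWeightedHomogeneous γ b)) (hP.2 _ _ (hle hb'))
  · intro h b hb
    rw [← sum_weightedHomogeneousComponent w b,
      finsum_eq_sum _ (weightedHomogeneousComponent_finsupp b), map_sum]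
    refine Ideal.sum_mem _ fun γ _ => ?_
    rw [IsWeightedHomogeneous.scalingAction_eq hχ
      (weightedHomogeneousComponent_isWeightedHomogeneous γ b)]
    exact Ideal.mul_mem_left _ _ (weightedHomogeneousComponent_mem_of_mem k w
      (P.homogeneousCore (weightedHomogeneousSubmodule k w)).isHomogeneous hb γ)

/-- The Poisson Dixmier-Moeglin equivalence for graded polynomial Poisson algebras with finitely
many torus-stable Poisson primes. -/
theorem poissonDixmierMoeglin_of_finite [CharZero k]
    (hχ : ∀ h s, χ h s = torusCharacter k (w s) h)
    (hw : ∀ s t, IsWeightedHomogeneous w (π.br (X s) (X t)) (w s + w t))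
    (hfin : (stablePoissonPrimes π (scalingAction χ)).Finite) : PoissonDixmierMoeglin π := by
  have h3 : ∀ P, IsPoissonRational π P → IsLocallyClosedPoint π P := by
    intro P hP
    have hprime := hP.1.1
    rw [isLocallyClosedPoint_iff]
    refine ⟨hP.1, ?_⟩
    -- One element outside `P` is picked from each of the finitely many stable primes not contained
    -- in `P`; `s` is their product.
    obtain ⟨s, hsP, hs⟩ : ∃ s ∉ P, ∀ J ∈ stablePoissonPrimes π (scalingAction χ),
        ¬ J ≤ P → s ∈ J := by
      have hex : ∀ J : Ideal (MvPolynomial σ k), ∃ x ∉ P, ¬ J ≤ P → x ∈ J := fun J => by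
        by_cases hJ : J ≤ P
        · exact ⟨1, fun h => hprime.ne_top ((Ideal.eq_top_iff_one _).2 h), fun h => absurd hJ h⟩
        · obtain ⟨x, hx, hxP⟩ := SetLike.not_le_iff_exists.1 hJ
          exact ⟨x, hxP, fun _ => hx⟩
      choose x hxP hx using hex
      refine ⟨∏ J ∈ hfin.toFinset, x J, fun h => ?_, fun J hJ hJP => ?_⟩
      · obtain ⟨J, -, hJ⟩ := hprime.prod_mem_iff.1 h
        exact hxP J hJ
      · exact Ideal.mem_of_dvd _ (Finset.dvd_prod_of_mem x (hfin.mem_toFinset.2 hJ)) (hx J hJP)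
    refine ⟨s, hsP, fun P' hP' hle hsP' => ?_⟩
    -- If `P' ⊇ P` misses `s`, the stable prime `J` inside `P'` must lie in `P`, so `P` and `P'`
    -- have the same homogeneous elements.
    obtain ⟨J, hJ, hJP', hJmem⟩ := exists_stable_le hχ hw hP'
    have hJP : J ≤ P := by
      by_contra h
      exact hsP' (hJP' (hs J hJ h))
    exact hP.eq_of_le hP' hle (weightedHomogeneousSubmodule k w)
      (fun i j a ha b hb => IsWeightedHomogeneous.mul ha hb)
      (fun i j a ha b hb => IsWeightedHomogeneous.br hw ha hb)
      (exists_sum_homogeneous w) (fun γ a ha haP' => hJP (hJmem γ a ha haP'))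
  refine ⟨Set.ext fun P => ⟨fun h => h3 P h.isPoissonRational,
    fun h => h.isPoissonPrimitive⟩, Set.ext fun P => ⟨fun h => ?_, h3 P⟩⟩
  exact IsPoissonPrimitive.isPoissonRational (IsLocallyClosedPoint.isPoissonPrimitive h)

end GradedBrackets

/-! ### Relations of minimal degree over a subalgebra -/

section PolynomialExtension

variable {k : Type u} {A : Type v} [Field k] [CommRing A] [Algebra k A]

/-- Apply a derivation to the coefficients of a polynomial. -/
noncomputable def coeffDerivation (D : Derivation k A A) (p : Polynomial A) : Polynomial A :=
  ∑ i ∈ Finset.range (p.natDegree + 1), Polynomial.monomial i (D (p.coeff i))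

theorem coeffDerivation_coeff (D : Derivation k A A) (p : Polynomial A) (i : ℕ) :
    (coeffDerivation D p).coeff i = D (p.coeff i) := by
  rw [coeffDerivation, Polynomial.finsetSum_coeff]
  simp only [Polynomial.coeff_monomial, Finset.sum_ite_eq', Finset.mem_range]
  split_ifs with h
  · rfl
  · rw [Polynomial.coeff_eq_zero_of_natDegree_lt (by omega), map_zero]

theorem derivation_eval (D : Derivation k A A) (x : A) (p : Polynomial A) :
    D (p.eval x) = (coeffDerivation D p).eval x + p.derivative.eval x * D x := by
  rw [coeffDerivation, Polynomial.eval_finsetSum, Polynomial.eval_eq_sum_range,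
    Polynomial.derivative_eval, Polynomial.sum_over_range _ (by simp), map_sum, Finset.sum_mul,
    ← Finset.sum_add_distrib]
  refine Finset.sum_congr rfl fun i _ => ?_
  rw [Derivation.leibniz, Derivation.leibniz_pow, Polynomial.eval_monomial]
  simp only [smul_eq_mul, nsmul_eq_mul]
  ring

variable (B : Subalgebra k A) (x : A) (P : Ideal A)

/-- `P` contains a value at `x` of a polynomial over `B` not all of whose coefficients
lie in `P`. -/
def HasNewRelation : Prop :=
  ∃ p : Polynomial A, (∀ i, p.coeff i ∈ B) ∧ p.eval x ∈ P ∧ ∃ i, p.coeff i ∉ P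

/-- A relation of minimal degree as in `HasNewRelation`. -/
structure IsMinimalRelation (p : Polynomial A) : Prop where
  coeff_mem : ∀ i, p.coeff i ∈ B
  eval_mem : p.eval x ∈ P
  leading : p.coeff p.natDegree ∉ P
  minimal : ∀ q : Polynomial A, (∀ i, q.coeff i ∈ B) → q.eval x ∈ P →
    (∀ i, p.natDegree ≤ i → q.coeff i ∈ P) → ∀ i, q.coeff i ∈ P

variable {B x P}

theorem HasNewRelation.exists_minimal (h : HasNewRelation B x P) :
    ∃ p, IsMinimalRelation B x P p := by
  classical
  -- Here `n` is a strict degree bound: the coefficients vanish from index `n` on, so the least `n`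
  -- will be the degree plus one.
  have hex : ∃ n, ∃ p : Polynomial A, (∀ i, p.coeff i ∈ B) ∧ p.eval x ∈ P ∧
      (∃ i, p.coeff i ∉ P) ∧ ∀ i, n < i + 1 → p.coeff i = 0 := by
    obtain ⟨p, h1, h2, h3⟩ := h
    exact ⟨p.natDegree + 1, p, h1, h2, h3, fun i hi =>
      Polynomial.coeff_eq_zero_of_natDegree_lt (by omega)⟩
  obtain ⟨p, h1, h2, h3, h4⟩ := Nat.find_spec hex
  have hp0 : p.coeff p.natDegree ≠ 0 := by
    obtain ⟨i, hi⟩ := h3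
    refine Polynomial.leadingCoeff_ne_zero.2 fun h => hi ?_
    rw [h, Polynomial.coeff_zero]
    exact P.zero_mem
  have hfind : Nat.find hex = p.natDegree + 1 := by
    refine le_antisymm (Nat.find_min' hex ⟨p, h1, h2, h3, fun i hi =>
      Polynomial.coeff_eq_zero_of_natDegree_lt (by omega)⟩) ?_
    by_contra! h
    exact hp0 (h4 _ h)
  have hmin : ∀ q : Polynomial A, (∀ i, q.coeff i ∈ B) → q.eval x ∈ P →
      (∀ i, p.natDegree ≤ i → q.coeff i ∈ P) → ∀ i, q.coeff i ∈ P := by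
    intro q hqB hqP hq
    -- Coefficients of `q` from index `p.natDegree` on lie in `P`, so truncating there changes the
    -- value at `x` only by an element of `P` and lowers the degree strictly.
    let q' : Polynomial A := ∑ i ∈ Finset.range p.natDegree, Polynomial.monomial i (q.coeff i)
    have hq' : ∀ i, q'.coeff i = if i < p.natDegree then q.coeff i else 0 := fun i => by
      simp only [q', Polynomial.finsetSum_coeff, Polynomial.coeff_monomial,
        Finset.sum_ite_eq', Finset.mem_range]
    have hdiff : (q - q').eval x ∈ P := by
      rw [Polynomial.eval_eq_sum_range]
      refine P.sum_mem fun i _ => P.mul_mem_right _ ?_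
      rw [Polynomial.coeff_sub, hq']
      split_ifs with hi
      · simp
      · simpa using hq i (not_lt.1 hi)
    have hq'P : q'.eval x ∈ P := by
      rw [Polynomial.eval_sub] at hdiff
      exact (Submodule.sub_mem_iff_right P hqP).1 hdiff
    intro i
    rcases lt_or_ge i p.natDegree with hi | hi
    · by_contra hne
      refine Nat.find_min hex (m := p.natDegree) (by omega) ⟨q', fun j => ?_, hq'P, ⟨i, ?_⟩,
        fun j hj => ?_⟩
      · rw [hq']
        split_ifs
        exacts [hqB j, B.zero_mem]
      · rwa [hq', if_pos hi]
      · rw [hq', if_neg (by omega)]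
    · exact hq i hi
  refine ⟨p, h1, h2, fun hlead => ?_, hmin⟩
  obtain ⟨i, hi⟩ := h3
  refine hi (hmin p h1 h2 (fun j hj => ?_) i)
  rcases hj.eq_or_lt with rfl | hj
  · exact hlead
  · rw [Polynomial.coeff_eq_zero_of_natDegree_lt hj]
    exact P.zero_mem

theorem IsMinimalRelation.natDegree_pos {p : Polynomial A} (h : IsMinimalRelation B x P p) :
    0 < p.natDegree := by
  by_contra h0
  have h1 : p.natDegree = 0 := by omega
  have h2 := h.eval_mem
  rw [Polynomial.eq_C_of_natDegree_eq_zero h1, Polynomial.eval_C] at h2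
  exact h.leading (h1 ▸ h2)

/-- The relation between the two top coefficients of a minimal relation imposed by a derivation. -/
theorem IsMinimalRelation.derivation_mem {p : Polynomial A} (hp : IsMinimalRelation B x P p)
    {m : ℕ} (hm : p.natDegree = m + 1)
    (D : Derivation k A A) (hDB : ∀ b ∈ B, D b ∈ B) (hDP : ∀ a ∈ P, D a ∈ P) {s t : A}
    (hs : s ∈ B) (ht : t ∈ B) (hDx : D x = s * x + t) :
    p.coeff (m + 1) * D (p.coeff m) - p.coeff m * D (p.coeff (m + 1))
      - s * p.coeff (m + 1) * p.coeff m + (m + 1 : ℕ) * t * p.coeff (m + 1) ^ 2 ∈ P := by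
  set a := p.coeff (m + 1) with ha
  have haB : a ∈ B := hp.coeff_mem _
  -- The first factor in brackets represents `D (p(x))`, since `D x = s x + t`. The multiple of `p`
  -- is chosen to cancel the coefficient of degree `m + 1`; minimality then puts all coefficients of
  -- `q` in `P`, and the one of degree `m` is the claim.
  let q : Polynomial A := Polynomial.C a *
    (coeffDerivation D p + (Polynomial.C s * Polynomial.X + Polynomial.C t) * p.derivative) -
    Polynomial.C (D a + (m + 1 : ℕ) * s * a) * p
  have hq0 : ∀ i, q.coeff (i + 1) = a * (D (p.coeff (i + 1)) + s * (p.coeff (i + 1) * (i + 1)) +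
      t * (p.coeff (i + 2) * (i + 2))) - (D a + (m + 1 : ℕ) * s * a) * p.coeff (i + 1) := by
    intro i
    simp only [q, Polynomial.coeff_sub, Polynomial.coeff_C_mul, Polynomial.coeff_add, add_mul,
      coeffDerivation_coeff, mul_assoc, Polynomial.coeff_X_mul, Polynomial.coeff_derivative]
    push_cast
    ring_nf
  have hq00 : q.coeff 0 = a * (D (p.coeff 0) +
      t * p.coeff 1) - (D a + (m + 1 : ℕ) * s * a) * p.coeff 0 := by
    simp only [q, Polynomial.coeff_sub, Polynomial.coeff_add, add_mul,
      coeffDerivation_coeff, mul_assoc, Polynomial.coeff_derivative, Polynomial.mul_coeff_zero,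
      Polynomial.coeff_X_zero, Polynomial.coeff_C_zero]
    push_cast
    ring_nf
  have hqm : q.coeff m = a * (D (p.coeff m) + s * (p.coeff m * m) +
      t * (p.coeff (m + 1) * (m + 1))) - (D a + (m + 1 : ℕ) * s * a) * p.coeff m := by
    cases m with
    | zero => rw [hq00]; simp
    | succ m => rw [hq0]; push_cast; ring
  have hnat : ∀ n : ℕ, (n : A) ∈ B := fun n => natCast_mem B n
  have hqB : ∀ i, q.coeff i ∈ B := by
    intro i
    cases i with
    | zero =>
      rw [hq00]
      exact B.sub_mem (B.mul_mem haB (B.add_mem (hDB _ (hp.coeff_mem _))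
        (B.mul_mem ht (hp.coeff_mem _)))) (B.mul_mem (B.add_mem (hDB _ haB)
        (B.mul_mem (B.mul_mem (hnat _) hs) haB)) (hp.coeff_mem _))
    | succ i =>
      rw [hq0]
      have h1 : (i + 1 : A) ∈ B := by exact_mod_cast hnat (i + 1)
      have h2 : (i + 2 : A) ∈ B := by exact_mod_cast hnat (i + 2)
      exact B.sub_mem (B.mul_mem haB (B.add_mem (B.add_mem (hDB _ (hp.coeff_mem _))
        (B.mul_mem hs (B.mul_mem (hp.coeff_mem _) h1)))
        (B.mul_mem ht (B.mul_mem (hp.coeff_mem _) h2)))) (B.mul_mem (B.add_mem (hDB _ haB)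
        (B.mul_mem (B.mul_mem (hnat _) hs) haB)) (hp.coeff_mem _))
  have hqP : q.eval x ∈ P := by
    have h := hDP _ hp.eval_mem
    rw [derivation_eval, hDx] at h
    simp only [q, Polynomial.eval_sub, Polynomial.eval_mul, Polynomial.eval_C,
      Polynomial.eval_add, Polynomial.eval_X]
    refine P.sub_mem (P.mul_mem_left _ ?_) (P.mul_mem_left _ hp.eval_mem)
    rwa [mul_comm (Polynomial.eval x p.derivative)] at h
  have hres := hp.minimal q hqB hqP (fun i hi => by
    rw [hm] at hi
    obtain ⟨i, rfl⟩ : ∃ j, i = j + 1 := ⟨i - 1, by omega⟩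
    have hz : p.coeff (i + 2) = 0 := Polynomial.coeff_eq_zero_of_natDegree_lt (by omega)
    rw [hq0, hz]
    rcases (show m ≤ i by omega).eq_or_lt with rfl | hlt
    · rw [← ha]
      convert P.zero_mem using 1
      push_cast
      ring
    · have hz' : p.coeff (i + 1) = 0 := Polynomial.coeff_eq_zero_of_natDegree_lt (by omega)
      rw [hz']
      simp) m
  rw [hqm] at hres
  convert hres using 1
  push_cast
  ring

end PolynomialExtension

/-! ### One Poisson-Ore step: at most two stable Poisson primes over each prime of `B` -/

section PoissonExtension

variable {k : Type u} {A : Type v} [Field k] [CommRing A] [Algebra k A]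

/-- `B[x]` is a Poisson-Ore extension of `B`, with `{x, b} = η(b) x + δ(b)` for a derivation `η`
which has `x` as an eigenvector with nonzero eigenvalue `c`. -/
structure IsPoissonExtension (π : PoissonBracket k A) (B : Subalgebra k A) (x : A)
    (η : Derivation k A A) (c : k) : Prop where
  br_mem : ∀ a ∈ B, ∀ b ∈ B, π.br a b ∈ B
  eta_mem : ∀ b ∈ B, η b ∈ B
  eta_self : η x = algebraMap k A c * x
  delta_mem : ∀ b ∈ B, π.br x b - η b * x ∈ B
  ne_zero : c ≠ 0

variable {π : PoissonBracket k A} {B : Subalgebra k A} {x : A} {η : Derivation k A A} {c : k}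
  {P : Ideal A}

theorem algebraMap_mul_mem_iff (P : Ideal A) {c : k} (hc : c ≠ 0) {a : A} :
    algebraMap k A c * a ∈ P ↔ a ∈ P :=
  Ideal.unit_mul_mem_iff_mem P ((isUnit_iff_ne_zero.2 hc).map _)

theorem ad_eq_neg_mul_add (η : Derivation k A A) (b x : A) :
    π.ad b x = -η b * x + -(π.br x b - η b * x) := by
  rw [π.ad_apply, π.antisymm]
  ring

/-- Let `a`, `b` be the two top coefficients of a minimal relation of degree `m + 1`, and put `v =
(m + 1) a`, `z = v x + b`, `u = z / v` in the fraction field of `A / P`. Differentiating the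
relation along `{d, -}` for `d ∈ B` gives `{u, d} = u η(d)`, and along `η` gives `η(u) = c u`. The
first identity extends to `x`, so `0 = {u, u} = c u²` and `z ∈ P`. -/
theorem IsPoissonExtension.exists_linear [CharZero k] (h : IsPoissonExtension π B x η c)
    (hP : IsPoissonPrime π P) (hη : ∀ a ∈ P, η a ∈ P) (hnew : HasNewRelation B x P) :
    ∃ a ∈ B, a ∉ P ∧ ∃ b ∈ B, a * x + b ∈ P := by
  have hprime := hP.1
  obtain ⟨p, hp⟩ := hnew.exists_minimal
  obtain ⟨m, hm⟩ : ∃ m, p.natDegree = m + 1 :=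
    ⟨p.natDegree - 1, by have := hp.natDegree_pos; omega⟩
  have hlead : p.coeff (m + 1) ∉ P := hm ▸ hp.leading
  have hrel : ∀ b ∈ B, _ := fun b hb =>
    hp.derivation_mem hm (π.ad b) (fun d hd => h.br_mem b hb d hd)
    (fun d hd => hP.2 b d hd) (B.neg_mem (h.eta_mem b hb)) (B.neg_mem (h.delta_mem b hb))
    (ad_eq_neg_mul_add η b x)
  have hrelη := hp.derivation_mem hm η h.eta_mem hη (B.algebraMap_mem c) B.zero_mem
    (by rw [h.eta_self, add_zero])
  have haB := hp.coeff_mem (m + 1)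
  have hbB := hp.coeff_mem m
  -- Otherwise `p'` would be a relation of lower degree, with the coefficient `(m + 1) a`, which is
  -- outside `P` in characteristic zero.
  have hminder : p.derivative.eval x ∉ P := by
    intro hder
    have h1 := hp.minimal p.derivative (fun i => by
      rw [Polynomial.coeff_derivative]
      exact B.mul_mem (hp.coeff_mem _) (by exact_mod_cast natCast_mem B (i + 1))) hder
      (fun i hi => by
        rw [Polynomial.coeff_derivative, Polynomial.coeff_eq_zero_of_natDegree_lt (by omega),
          zero_mul]
        exact P.zero_mem) m
    rw [Polynomial.coeff_derivative] at h1
    refine (hprime.mem_or_mem h1).elim hlead fun h2 => ?_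
    exact natCast_notMem_of_isPrime k P m.succ_ne_zero (by exact_mod_cast h2)
  set a := p.coeff (m + 1)
  set b := p.coeff m
  have hvB : ((m + 1 : ℕ) : A) * a ∈ B := B.mul_mem (natCast_mem B _) haB
  have hvP : ((m + 1 : ℕ) : A) * a ∉ P := fun h2 =>
    (hprime.mem_or_mem h2).elim (natCast_notMem_of_isPrime k P m.succ_ne_zero) hlead
  set v := ((m + 1 : ℕ) : A) * a with hv
  refine ⟨v, hvB, hvP, b, hbB, ?_⟩
  set z := v * x + b with hz
  -- Over the fraction field `E` is `v²` times `{u, -} - u η`. It maps `B` into `P`; modulo `P` it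
  -- sends the relation `p(x)` to `p'(x) E(x)`, which forces `E x ∈ P`.
  let E : Derivation k A A := v • π.ad z - z • π.ad v - (v * z) • η
  have hE : ∀ y, E y = v * π.br z y - z * π.br v y - v * z * η y := fun y => rfl
  have hDv : ∀ D : Derivation k A A, D v = (m + 1 : ℕ) * D a := fun D => by
    rw [hv, Derivation.leibniz, Derivation.map_natCast, smul_zero, add_zero, smul_eq_mul]
  have hEB : ∀ d ∈ B, E d ∈ P := by
    intro d hd
    have h1 := P.mul_mem_left (-((m + 1 : ℕ) : A)) (hrel d hd)
    convert h1 using 1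
    have h2 : π.br z d = π.br v d * x + v * π.br x d + π.br b d := by
      rw [hz, map_add, LinearMap.add_apply, π.leibniz_left]
    have h3 : π.br v d = -((m + 1 : ℕ) * π.br d a) := by
      rw [π.antisymm, ← π.ad_apply, hDv, π.ad_apply]
    rw [hE, h2, h3, π.antisymm b d, hz, hv, π.ad_apply, π.ad_apply]
    ring
  have hEP : ∀ y ∈ P, E y ∈ P := fun y hy =>
    P.sub_mem (P.sub_mem (P.mul_mem_left _ (hP.2 _ _ hy)) (P.mul_mem_left _ (hP.2 _ _ hy)))
      (P.mul_mem_left _ (hη y hy))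
  have hEx : E x ∈ P := by
    have h1 := hEP _ hp.eval_mem
    rw [derivation_eval, Submodule.add_mem_iff_right] at h1
    · exact (hprime.mem_or_mem h1).resolve_left hminder
    · rw [Polynomial.eval_eq_sum_range]
      refine P.sum_mem fun i _ => P.mul_mem_right _ ?_
      rw [coeffDerivation_coeff]
      exact hEB _ (hp.coeff_mem i)
  have hEz : E z ∈ P := by
    rw [hz, map_add, Derivation.leibniz]
    exact P.add_mem (P.add_mem (P.mul_mem_left _ hEx) (P.mul_mem_left _ (hEB v hvB))) (hEB b hbB)
  have hfinal : algebraMap k A c * (v * v * (z * z)) ∈ P := by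
    have h1 := P.sub_mem (P.mul_mem_left v hEz) (P.mul_mem_left z (hEB v hvB))
    have h2 := P.mul_mem_left (v * z * (m + 1 : ℕ)) hrelη
    convert P.neg_mem (P.add_mem h1 h2) using 1
    have h3 : η z = η v * x + v * (algebraMap k A c * x) + η b := by
      rw [hz, map_add, Derivation.leibniz, h.eta_self, smul_eq_mul, smul_eq_mul]
      ring
    rw [hE, hE, π.self_eq_zero, π.self_eq_zero, h3, hDv, π.antisymm z v, hz, hv]
    ring
  rw [algebraMap_mul_mem_iff P h.ne_zero] at hfinal
  rcases hprime.mem_or_mem hfinal with h1 | h1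
  · exact absurd ((hprime.mem_or_mem h1).elim id id) hvP
  · exact (hprime.mem_or_mem h1).elim id id

theorem derivation_mem_of_linear_mem (D : Derivation k A A) (hDP : ∀ a ∈ P, D a ∈ P) {a b s t : A}
    (hab : a * x + b ∈ P) (hDx : D x = s * x + t) :
    a * D b - b * D a - s * a * b + t * a ^ 2 ∈ P := by
  have h1 := P.sub_mem (P.mul_mem_left a (hDP _ hab)) (P.mul_mem_left (D a + s * a) hab)
  convert h1 using 1
  rw [map_add, Derivation.leibniz, hDx, smul_eq_mul, smul_eq_mul]
  ring

/-- Linear relations are unique up to proportionality. -/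
theorem IsPoissonExtension.linear_unique (h : IsPoissonExtension π B x η c) {P' : Ideal A}
    (hP : IsPoissonPrime π P) (hη : ∀ a ∈ P, η a ∈ P)
    (hP' : IsPoissonPrime π P') (hη' : ∀ a ∈ P', η a ∈ P')
    (heq : ∀ a ∈ B, (a ∈ P ↔ a ∈ P')) {a b a' b' : A} (ha : a ∈ B) (hb : b ∈ B) (ha' : a' ∈ B)
    (hb' : b' ∈ B) (haP : a ∉ P) (haP' : a' ∉ P') (hab : a * x + b ∈ P) (hab' : a' * x + b' ∈ P') :
    a' * b - a * b' ∈ P := by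
  have hprime := hP.1
  have hv : a * a' ∉ P := fun h1 => (hprime.mem_or_mem h1).elim haP fun h2 =>
    haP' ((heq a' ha').1 h2)
  -- With `u = a' b - a b'` and `v = a a'`, this says that `u / v = b / a - b' / a'` satisfies `D (u
  -- / v) = s (u / v)` modulo `P`: the inhomogeneous terms `t` cancel in the difference. The
  -- relation from `P'` is transferred to `P` because it involves only elements of `B`.
  have key : ∀ (D : Derivation k A A), (∀ d ∈ B, D d ∈ B) → (∀ y ∈ P, D y ∈ P) →
      (∀ y ∈ P', D y ∈ P') → ∀ s ∈ B, ∀ t ∈ B, D x = s * x + t →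
      (a * a') * D (a' * b - a * b') - (a' * b - a * b') * D (a * a')
        - s * (a' * b - a * b') * (a * a') ∈ P := by
    intro D hDB hDP hDP' s hs t ht hDx
    have h1 := derivation_mem_of_linear_mem D hDP hab hDx
    have h2 := derivation_mem_of_linear_mem D hDP' hab' hDx
    rw [← heq _ (B.add_mem (B.sub_mem (B.sub_mem (B.mul_mem ha' (hDB _ hb'))
      (B.mul_mem hb' (hDB _ ha'))) (B.mul_mem (B.mul_mem hs ha') hb'))
      (B.mul_mem ht (B.pow_mem ha' 2)))] at h2
    convert P.sub_mem (P.mul_mem_left (a' ^ 2) h1) (P.mul_mem_left (a ^ 2) h2) using 1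
    simp only [map_sub, Derivation.leibniz, smul_eq_mul]
    ring
  have huB : a' * b - a * b' ∈ B := B.sub_mem (B.mul_mem ha' hb) (B.mul_mem ha hb')
  have hvB : a * a' ∈ B := B.mul_mem ha ha'
  have keyB : ∀ d ∈ B, _ := fun d hd => key (π.ad d) (fun y hy => h.br_mem d hd y hy)
    (fun y hy => hP.2 d y hy) (fun y hy => hP'.2 d y hy) _ (B.neg_mem (h.eta_mem d hd))
    _ (B.neg_mem (h.delta_mem d hd)) (ad_eq_neg_mul_add η d x)
  have keyη := key η h.eta_mem hη hη' _ (B.algebraMap_mem c) 0 B.zero_mem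
    (by rw [h.eta_self, add_zero])
  have h1 := keyB _ huB
  have h2 := keyB _ hvB
  set u := a' * b - a * b'
  set v := a * a'
  have hfinal : algebraMap k A c * (u * u * (v * v)) ∈ P := by
    have h3 := P.sub_mem (P.mul_mem_left v h1) (P.mul_mem_left u h2)
    convert P.sub_mem h3 (P.mul_mem_left (u * v) keyη) using 1
    simp only [π.ad_apply, π.self_eq_zero]
    rw [π.antisymm v u]
    ring
  rw [algebraMap_mul_mem_iff P h.ne_zero] at hfinal
  rcases hprime.mem_or_mem hfinal with h3 | h3
  · exact (hprime.mem_or_mem h3).elim id id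
  · exact absurd ((hprime.mem_or_mem h3).elim id id) hv

theorem exists_polynomial_of_mem_adjoin {f : A} (hf : f ∈ Algebra.adjoin k (insert x (B : Set A))) :
    ∃ p : Polynomial A, (∀ i, p.coeff i ∈ B) ∧ p.eval x = f := by
  induction hf using Algebra.adjoin_induction with
  | mem y hy =>
    rcases hy with rfl | hy
    · refine ⟨Polynomial.X, fun i => ?_, by simp⟩
      rw [Polynomial.coeff_X]
      split_ifs
      exacts [B.one_mem, B.zero_mem]
    · refine ⟨Polynomial.C y, fun i => ?_, by simp⟩
      rw [Polynomial.coeff_C]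
      split_ifs
      exacts [hy, B.zero_mem]
  | algebraMap r =>
    refine ⟨Polynomial.C (algebraMap k A r), fun i => ?_, by simp⟩
    rw [Polynomial.coeff_C]
    split_ifs
    exacts [B.algebraMap_mem r, B.zero_mem]
  | add y z _ _ hy hz =>
    obtain ⟨p, hp, rfl⟩ := hy
    obtain ⟨q, hq, rfl⟩ := hz
    refine ⟨p + q, fun i => ?_, Polynomial.eval_add⟩
    rw [Polynomial.coeff_add]
    exact B.add_mem (hp i) (hq i)
  | mul y z _ _ hy hz =>
    obtain ⟨p, hp, rfl⟩ := hy
    obtain ⟨q, hq, rfl⟩ := hz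
    refine ⟨p * q, fun i => ?_, Polynomial.eval_mul⟩
    rw [Polynomial.coeff_mul]
    exact B.sum_mem fun j _ => B.mul_mem (hp _) (hq _)

/-- Modulo `a x + b` one has `a x = -b`, so a sufficiently high power of `a` turns any polynomial in
`x` over `B` into an element of `B`. -/
theorem exists_pow_mul_sub_mem_span {a b f : A} (ha : a ∈ B) (hb : b ∈ B)
    (hf : f ∈ Algebra.adjoin k (insert x (B : Set A))) :
    ∃ n : ℕ, ∃ g ∈ B, a ^ n * f - g ∈ Ideal.span {a * x + b} := by
  induction hf using Algebra.adjoin_induction with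
  | mem y hy =>
    rcases hy with rfl | hy
    · refine ⟨1, -b, B.neg_mem hb, ?_⟩
      rw [pow_one, sub_neg_eq_add]
      exact Ideal.mem_span_singleton_self _
    · exact ⟨0, y, hy, by simp⟩
  | algebraMap r => exact ⟨0, _, B.algebraMap_mem r, by simp⟩
  | add y z _ _ hy hz =>
    obtain ⟨n, g, hg, hn⟩ := hy
    obtain ⟨m, g', hg', hm⟩ := hz
    refine ⟨n + m, a ^ m * g + a ^ n * g', B.add_mem (B.mul_mem (B.pow_mem ha _) hg)
      (B.mul_mem (B.pow_mem ha _) hg'), ?_⟩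
    convert Ideal.add_mem _ (Ideal.mul_mem_left _ (a ^ m) hn) (Ideal.mul_mem_left _ (a ^ n) hm)
      using 1
    ring
  | mul y z _ _ hy hz =>
    obtain ⟨n, g, hg, hn⟩ := hy
    obtain ⟨m, g', hg', hm⟩ := hz
    refine ⟨n + m, g * g', B.mul_mem hg hg', ?_⟩
    convert Ideal.add_mem _ (Ideal.mul_mem_left _ (a ^ m * z) hn) (Ideal.mul_mem_left _ g hm)
      using 1
    ring

/-- Two Poisson primes lying over the same prime of `B` agree on `B[x]` if they are both
extended from `B`, or both not extended. -/
theorem IsPoissonExtension.le_of_iff [CharZero k] (h : IsPoissonExtension π B x η c) {P' : Ideal A}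
    (hP : IsPoissonPrime π P) (hη : ∀ a ∈ P, η a ∈ P)
    (hP' : IsPoissonPrime π P') (hη' : ∀ a ∈ P', η a ∈ P')
    (heq : ∀ a ∈ B, (a ∈ P ↔ a ∈ P')) (hnew : HasNewRelation B x P ↔ HasNewRelation B x P')
    {f : A} (hf : f ∈ Algebra.adjoin k (insert x (B : Set A))) (hfP : f ∈ P) : f ∈ P' := by
  by_cases hrel : HasNewRelation B x P
  · have hp := hP.1
    have hp' := hP'.1
    obtain ⟨a, ha, haP, b, hb, hab⟩ := h.exists_linear hP hη hrel
    obtain ⟨a', ha', haP', b', hb', hab'⟩ := h.exists_linear hP' hη' (hnew.1 hrel)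
    have huniq := (heq _ (B.sub_mem (B.mul_mem ha' hb) (B.mul_mem ha hb'))).1
      (h.linear_unique hP hη hP' hη' heq ha hb ha' hb' haP haP' hab hab')
    -- Proportionality makes the linear relation of `P` a relation of `P'` as well, so one reduction
    -- of `f` to `g ∈ B` decides membership in both primes.
    have hab2 : a * x + b ∈ P' := by
      have h1 : a' * (a * x + b) ∈ P' := by
        convert P'.add_mem (P'.mul_mem_left a hab') huniq using 1
        ring
      exact (hp'.mem_or_mem h1).resolve_left haP'
    obtain ⟨n, g, hg, hn⟩ := exists_pow_mul_sub_mem_span ha hb hf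
    have hn1 := (Ideal.span_singleton_le_iff_mem P).2 hab hn
    have hn2 := (Ideal.span_singleton_le_iff_mem P').2 hab2 hn
    have hgP : g ∈ P' :=
      (heq g hg).1 ((Submodule.sub_mem_iff_right P (P.mul_mem_left _ hfP)).1 hn1)
    have h2 : a ^ n * f ∈ P' := (Submodule.sub_mem_iff_left P' hgP).1 hn2
    exact (hp'.mem_or_mem h2).resolve_left fun h3 =>
      haP ((heq a ha).2 (hp'.mem_of_pow_mem n h3))
  · obtain ⟨p, hpB, rfl⟩ := exists_polynomial_of_mem_adjoin hf
    have hall : ∀ i, p.coeff i ∈ P := by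
      by_contra! hne
      exact hrel ⟨p, hpB, hfP, hne⟩
    rw [Polynomial.eval_eq_sum_range]
    exact P'.sum_mem fun i _ => P'.mul_mem_right _ ((heq _ (hpB i)).1 (hall i))

end PoissonExtension

/-! ### Iterated extensions and the bound on stable Poisson primes -/

section Counting

variable {k : Type u} [Field k] {σ : Type v} {r : ℕ}
  {w : σ → Lex (Fin r → ℤ)} {χ : (Fin r → kˣ) →* (σ → kˣ)}
  {π : PoissonBracket k (MvPolynomial σ k)}

/-- The derivation by which the element `e` of the Lie algebra of the torus acts. -/
noncomputable def torusDerivation (w : σ → Lex (Fin r → ℤ)) (e : Fin r → k) :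
    Derivation k (MvPolynomial σ k) (MvPolynomial σ k) :=
  mkDerivation k fun s => C (∑ i, e i * (ofLex (w s) i : k)) * X s

theorem torusDerivation_X (e : Fin r → k) (s : σ) :
    torusDerivation w e (X s) = C (∑ i, e i * (ofLex (w s) i : k)) * X s :=
  mkDerivation_X _ _ _

theorem torusDerivation_monomial (e : Fin r → k) (d : σ →₀ ℕ) (c : k) :
    torusDerivation w e (monomial d c) =
      C (∑ i, e i * (ofLex (Finsupp.weight w d) i : k)) * monomial d c := by
  induction d using Finsupp.induction_linear generalizing c with
  | zero =>
    have h1 : (monomial 0 c : MvPolynomial σ k) = algebraMap k _ c := rfl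
    rw [h1, Derivation.map_algebraMap, map_zero]
    simp only [ofLex_zero, Pi.zero_apply, Int.cast_zero, mul_zero, Finset.sum_const_zero, C_0,
      zero_mul]
  | add d d' hd hd' =>
    rw [← mul_one c, ← monomial_mul, Derivation.leibniz, hd, hd', smul_eq_mul, smul_eq_mul, map_add]
    simp only [ofLex_add, Pi.add_apply, Int.cast_add, mul_add, Finset.sum_add_distrib, C_add]
    ring
  | single s n =>
    rw [← C_mul_X_pow_eq_monomial, Derivation.leibniz, Derivation.leibniz_pow, torusDerivation_X]
    have h1 : (C c : MvPolynomial σ k) = algebraMap k _ c := rfl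
    rw [h1, Derivation.map_algebraMap, smul_zero, add_zero, Finsupp.weight_single]
    have h2 : ∑ i, e i * (ofLex (n • w s) i : k) = n * ∑ i, e i * (ofLex (w s) i : k) := by
      rw [Finset.mul_sum]
      refine Finset.sum_congr rfl fun i _ => ?_
      have h3 : ofLex (n • w s) i = n • ofLex (w s) i := rfl
      rw [h3, nsmul_eq_mul, Int.cast_mul, Int.cast_natCast]
      ring
    rw [h2]
    rcases n with _ | n
    · simp
    · simp only [smul_eq_mul, nsmul_eq_mul, C_mul, Nat.add_sub_cancel]
      rw [map_natCast]
      ring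

/-- A stable ideal contains the homogeneous components of its elements, and the derivation
multiplies each component by a scalar. -/
theorem torusDerivation_mem_of_stable [CharZero k] (hχ : ∀ h s, χ h s = torusCharacter k (w s) h)
    {P : Ideal (MvPolynomial σ k)} (hP : ∀ h, ∀ a ∈ P, scalingAction χ h a ∈ P) (e : Fin r → k)
    {f : MvPolynomial σ k} (hf : f ∈ P) : torusDerivation w e f ∈ P := by
  rw [← sum_weightedHomogeneousComponent w f,
    finsum_eq_sum _ (weightedHomogeneousComponent_finsupp f), map_sum]
  refine P.sum_mem fun γ _ => ?_
  have hhom := weightedHomogeneousComponent_isWeightedHomogeneous (w := w) γ f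
  have hmem := component_mem_of_stable hχ hP hf γ
  generalize weightedHomogeneousComponent w γ f = g at *
  have : torusDerivation w e g = C (∑ i, e i * (ofLex γ i : k)) * g := by
    conv_lhs => rw [g.as_sum]
    conv_rhs => rw [g.as_sum]
    rw [map_sum, Finset.mul_sum]
    refine Finset.sum_congr rfl fun d hd => ?_
    rw [torusDerivation_monomial, hhom (mem_support_iff.1 hd)]
  rw [this]
  exact P.mul_mem_left _ hmem

/-- The hypothesis of the counting theorem: `k[X_s | s]` is an iterated Poisson-Ore extension, the
variables being ordered by `rk`, where each step is twisted by an element `e s` of the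
Lie algebra of the torus for which `X s` has nonzero weight. -/
structure IsIteratedPoissonExtension (π : PoissonBracket k (MvPolynomial σ k))
    (w : σ → Lex (Fin r → ℤ)) (rk : σ → ℕ) (e : σ → Fin r → k) : Prop where
  injective : Function.Injective rk
  br_sub_mem : ∀ s t, rk t < rk s →
    π.br (X s) (X t) - C (∑ i, e s i * (ofLex (w t) i : k)) * X t * X s ∈
      supported k {u | rk u < rk s}
  ne_zero : ∀ s, ∑ i, e s i * (ofLex (w s) i : k) ≠ 0

variable {rk : σ → ℕ} {e : σ → Fin r → k}

theorem derivation_mem_of_forall_X {A : Type*} [CommRing A] [Algebra k A] {S : Set A}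
    (D : Derivation k A A) (h : ∀ a ∈ S, D a ∈ Algebra.adjoin k S) {f : A}
    (hf : f ∈ Algebra.adjoin k S) : D f ∈ Algebra.adjoin k S := by
  induction hf using Algebra.adjoin_induction with
  | mem y hy => exact h y hy
  | algebraMap r => rw [Derivation.map_algebraMap]; exact Subalgebra.zero_mem _
  | add y z _ _ hy hz => rw [map_add]; exact Subalgebra.add_mem _ hy hz
  | mul y z hy' hz' hy hz =>
    rw [Derivation.leibniz]
    exact Subalgebra.add_mem _ (Subalgebra.mul_mem _ hy' hz) (Subalgebra.mul_mem _ hz' hy)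

theorem IsIteratedPoissonExtension.br_mem (h : IsIteratedPoissonExtension π w rk e) (n : ℕ)
    {a b : MvPolynomial σ k} (ha : a ∈ supported k {u | rk u < n})
    (hb : b ∈ supported k {u | rk u < n}) : π.br a b ∈ supported k {u | rk u < n} := by
  have hlt : ∀ s t, rk s < n → rk t < rk s →
      π.br (X s) (X t) ∈ supported k {u | rk u < n} := fun s t hs hst => by
    have h1 := supported_mono (R := k) (s := {u | rk u < rk s}) (t := {u | rk u < n})
      (fun u hu => lt_trans hu hs) (h.br_sub_mem s t hst)
    refine (sub_add_cancel (π.br (X s) (X t)) _) ▸ Subalgebra.add_mem _ h1 ?_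
    exact Subalgebra.mul_mem _ (Subalgebra.mul_mem _ (Subalgebra.algebraMap_mem _ _)
      (X_mem_supported.2 (hst.trans hs))) (X_mem_supported.2 hs)
  have hX : ∀ s t, rk s < n → rk t < n →
      π.br (X s) (X t) ∈ supported k {u | rk u < n} := fun s t hs ht => by
    rcases lt_trichotomy (rk s) (rk t) with hst | hst | hst
    · rw [π.antisymm]
      exact Subalgebra.neg_mem _ (hlt t s ht hst)
    · rw [h.injective hst, π.self_eq_zero]
      exact Subalgebra.zero_mem _
    · exact hlt s t hs hst
  refine derivation_mem_of_forall_X (π.ad a) ?_ hb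
  rintro _ ⟨t, ht, rfl⟩
  rw [π.ad_apply, π.antisymm]
  refine Subalgebra.neg_mem _ (derivation_mem_of_forall_X (π.ad (X t)) ?_ ha)
  rintro _ ⟨s, hs, rfl⟩
  exact hX t s ht hs

theorem IsIteratedPoissonExtension.isPoissonExtension (h : IsIteratedPoissonExtension π w rk e)
    (s : σ) : IsPoissonExtension π (supported k {u | rk u < rk s}) (X s)
      (torusDerivation w (e s)) (∑ i, e s i * (ofLex (w s) i : k)) where
  br_mem _ ha _ hb := h.br_mem _ ha hb
  eta_mem b hb := by
    refine derivation_mem_of_forall_X _ ?_ hb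
    rintro _ ⟨t, ht, rfl⟩
    rw [torusDerivation_X]
    exact Subalgebra.mul_mem _ (Subalgebra.algebraMap_mem _ _)
      (Algebra.subset_adjoin ⟨t, ht, rfl⟩)
  eta_self := torusDerivation_X _ _
  delta_mem b hb := by
    rw [mul_comm]
    -- The map `δ = {X s, -} - X s • η` is a derivation, so it suffices to see that it sends the
    -- earlier variables into the earlier subalgebra.
    refine derivation_mem_of_forall_X (π.ad (X s) - (X s : MvPolynomial σ k) •
      torusDerivation w (e s)) ?_ hb
    rintro _ ⟨t, ht, rfl⟩
    have h1 : (π.ad (X s) - (X s : MvPolynomial σ k) • torusDerivation w (e s)) (X t) =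
        π.br (X s) (X t) - C (∑ i, e s i * (ofLex (w t) i : k)) * X t * X s := by
      rw [Derivation.sub_apply, Derivation.smul_apply, torusDerivation_X, π.ad_apply, smul_eq_mul]
      ring
    rw [h1]
    exact h.br_sub_mem s t ht
  ne_zero := h.ne_zero s

/-- An iterated Poisson-Ore extension in `N` variables has at most `2 ^ N` torus-stable Poisson
primes. -/
theorem IsIteratedPoissonExtension.finite_and_ncard_le [CharZero k] [Fintype σ]
    (h : IsIteratedPoissonExtension π w rk e)
    (hχ : ∀ h s, χ h s = torusCharacter k (w s) h) :
    (stablePoissonPrimes π (scalingAction χ)).Finite ∧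
      (stablePoissonPrimes π (scalingAction χ)).ncard ≤ 2 ^ Fintype.card σ := by
  classical
  -- `F P` records the variables at whose adjunction `P` is not extended from below; a stable
  -- Poisson prime is determined by this subset of the `N` variables.
  let F : Ideal (MvPolynomial σ k) → Set σ := fun P =>
    {s | HasNewRelation (supported k {u | rk u < rk s}) (X s) P}
  have hinj : Set.InjOn F (stablePoissonPrimes π (scalingAction χ)) := by
    intro P hP P' hP' hF
    have hF' : ∀ s, HasNewRelation (supported k {u | rk u < rk s}) (X s) P ↔
        HasNewRelation (supported k {u | rk u < rk s}) (X s) P' := fun s =>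
      Set.ext_iff.1 hF s
    have key : ∀ n, ∀ f ∈ supported k {u | rk u < n}, (f ∈ P ↔ f ∈ P') := by
      intro n
      induction n with
      | zero =>
        intro f hf
        have : {u | rk u < 0} = ∅ := by
          ext u
          simp
        rw [this, supported_empty, Algebra.mem_bot] at hf
        obtain ⟨c, rfl⟩ := hf
        rcases eq_or_ne c 0 with rfl | hc
        · simp
        · have hu : IsUnit (algebraMap k (MvPolynomial σ k) c) :=
            (isUnit_iff_ne_zero.2 hc).map _
          exact ⟨fun h1 => absurd (P.eq_top_of_isUnit_mem h1 hu) hP.1.1.ne_top,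
            fun h1 => absurd (P'.eq_top_of_isUnit_mem h1 hu) hP'.1.1.ne_top⟩
      | succ n ih =>
        intro f hf
        by_cases hs : ∃ s, rk s = n
        · obtain ⟨s, rfl⟩ := hs
          have hf' : f ∈ Algebra.adjoin k (insert (X s)
              (supported k {u | rk u < rk s} : Set (MvPolynomial σ k))) := by
            refine Algebra.adjoin_le ?_ hf
            rintro _ ⟨t, ht, rfl⟩
            refine Algebra.subset_adjoin ?_
            rcases (Nat.lt_succ_iff.1 ht).eq_or_lt with hts | hts
            · exact Or.inl (congrArg X (h.injective hts))
            · exact Or.inr (X_mem_supported.2 hts)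
          have hη := fun a (ha : a ∈ P) => torusDerivation_mem_of_stable hχ hP.2 (e s) ha
          have hη' := fun a (ha : a ∈ P') => torusDerivation_mem_of_stable hχ hP'.2 (e s) ha
          exact ⟨(h.isPoissonExtension s).le_of_iff hP.1 hη hP'.1 hη' ih (hF' s) hf',
            (h.isPoissonExtension s).le_of_iff hP'.1 hη' hP.1 hη (fun a ha => (ih a ha).symm)
              (hF' s).symm hf'⟩
        -- If no variable has rank `n`, the subalgebra does not grow at this stage.
        · refine ih f ?_
          convert hf using 3
          ext u
          refine ⟨fun hu => Nat.lt_succ_of_lt hu, fun hu => ?_⟩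
          exact lt_of_le_of_ne (Nat.lt_succ_iff.1 hu) fun h1 => hs ⟨u, h1⟩
    obtain ⟨N, hN⟩ := (Set.finite_range rk).bddAbove
    have hall : {u | rk u < N + 1} = Set.univ := Set.eq_univ_of_forall fun u =>
      Nat.lt_succ_of_le (hN ⟨u, rfl⟩)
    ext f
    exact key (N + 1) f (by rw [hall, supported_univ]; trivial)
  have hfin : (stablePoissonPrimes π (scalingAction χ)).Finite :=
    Set.Finite.of_injOn (fun _ _ => Set.mem_univ _) hinj Set.finite_univ
  refine ⟨hfin, ?_⟩
  have h1 := Set.ncard_le_ncard_of_injOn F (fun _ _ => Set.mem_univ _) hinj Set.finite_univ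
  rwa [Set.ncard_univ, Nat.card_eq_fintype_card, Fintype.card_set] at h1

end Counting

/-! ### Poisson brackets prescribed on variables -/

section Existence

variable {k : Type u} [Field k] {σ : Type v}

theorem mvPolynomial_eq_zero_of_leibniz {F : MvPolynomial σ k → MvPolynomial σ k}
    (hadd : ∀ a b, F (a + b) = F a + F b) (hmul : ∀ a b, F (a * b) = F a * b + a * F b)
    (hC : ∀ c, F (C c) = 0) (hX : ∀ s, F (X s) = 0) (f : MvPolynomial σ k) : F f = 0 := by
  induction f using MvPolynomial.induction_on with
  | C c => exact hC c
  | add p q hp hq => rw [hadd, hp, hq, add_zero]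
  | mul_X p s hp => rw [hmul, hp, hX, zero_mul, mul_zero, add_zero]

/-- A Poisson bracket on a polynomial algebra can be prescribed on the variables, provided
that the values are antisymmetric and satisfy the Jacobi identity. -/
theorem exists_poissonBracket [CharZero k] (c : σ → σ → MvPolynomial σ k)
    (hanti : ∀ s t, c s t = -c t s)
    (hjac : ∀ s t u, mkDerivation k (c s) (c t u) + mkDerivation k (c t) (c u s) +
      mkDerivation k (c u) (c s t) = 0) :
    ∃ π : PoissonBracket k (MvPolynomial σ k), ∀ s t, π.br (X s) (X t) = c s t := by
  -- The universal property of the polynomial algebra is used twice: each variable acts by a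
  -- derivation, and these derivations are the values of a derivation into derivations.
  let D : Derivation k (MvPolynomial σ k) (Derivation k (MvPolynomial σ k) (MvPolynomial σ k)) :=
    mkDerivation k fun s => mkDerivation k (c s)
  have hDX : ∀ s, D (X s) = mkDerivation k (c s) := fun s => mkDerivation_X _ _ _
  have hDXX : ∀ s t, D (X s) (X t) = c s t := fun s t => by rw [hDX, mkDerivation_X]
  have hDC : ∀ a, D (C a) = 0 := fun a => D.map_algebraMap a
  have hDC' : ∀ f a, D f (C a) = 0 := fun f a => (D f).map_algebraMap a
  have hanti' : ∀ f g, D f g = -D g f := fun f g => by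
    rw [← add_eq_zero_iff_eq_neg]
    refine mvPolynomial_eq_zero_of_leibniz (F := fun f => D f g + D g f) (fun a b => ?_)
      (fun a b => ?_) (fun a => ?_) (fun s => ?_) f
    · simp only [map_add, Derivation.add_apply]
      ring
    · simp only [Derivation.leibniz, smul_eq_mul, Derivation.add_apply, Derivation.smul_apply]
      ring
    · simp only [hDC, hDC', Derivation.zero_apply, add_zero]
    · refine mvPolynomial_eq_zero_of_leibniz (F := fun g => D (X s) g + D g (X s)) (fun a b => ?_)
        (fun a b => ?_) (fun a => ?_) (fun t => ?_) g
      · simp only [map_add, Derivation.add_apply]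
        ring
      · simp only [Derivation.leibniz, smul_eq_mul, Derivation.add_apply, Derivation.smul_apply]
        ring
      · simp only [hDC, hDC', Derivation.zero_apply, add_zero]
      · simp only [hDXX]
        rw [hanti s t, neg_add_cancel]
  have hself : ∀ f, D f f = 0 := fun f => by
    have h2 : (2 : MvPolynomial σ k) ≠ 0 := two_ne_zero
    have h1 := hanti' f f
    have h3 : 2 * D f f = 0 := by linear_combination h1
    exact (mul_eq_zero.1 h3).resolve_left h2
  have hjac' : ∀ x y z, D x (D y z) + D y (D z x) + D z (D x y) = 0 := by
    have step : ∀ x y, (∀ s, D x (D y (X s)) + D y (D (X s) x) +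
        D (X s) (D x y) = 0) → ∀ z, D x (D y z) + D y (D z x) + D z (D x y) = 0 := by
      intro x y h
      refine mvPolynomial_eq_zero_of_leibniz
        (F := fun z => D x (D y z) + D y (D z x) + D z (D x y))
        (fun b c => ?_) (fun b c => ?_) (fun a => ?_) h
      · simp only [map_add, Derivation.add_apply]
        ring
      · simp only [Derivation.leibniz, smul_eq_mul, Derivation.add_apply, Derivation.smul_apply,
          map_add]
        rw [hanti' x b, hanti' x c]
        ring
      · simp only [hDC, hDC', Derivation.zero_apply, add_zero, map_zero]
    intro x y
    refine step x y fun s => ?_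
    suffices h : ∀ a, D (X s) (D x a) + D x (D a (X s)) + D a (D (X s) x) = 0 by
      linear_combination h y
    refine step (X s) x fun t => ?_
    suffices h : ∀ a, D (X t) (D (X s) a) + D (X s) (D a (X t)) + D a (D (X t) (X s)) = 0 by
      linear_combination h x
    refine step (X t) (X s) fun u => ?_
    simp only [hDXX]
    simp only [hDX]
    exact hjac t s u
  exact ⟨{  br := LinearMap.mk₂ k (fun y z => D y z) (by simp) (by simp) (by simp) (by simp)
            self_eq_zero := hself
            jacobi := hjac'
            leibniz := fun a b c => by
              simp only [LinearMap.mk₂_apply, Derivation.leibniz, smul_eq_mul]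
              ring }, hDXX⟩

end Existence

/-! ### The Jacobi identity for each type of bracket -/

section Jacobi

variable {k : Type u} {A : Type v} [Field k] [CommRing A] [Algebra k A]

/-- The quadratic expression in signs which enters the Jacobi identity. -/
theorem sgn_cyclic {n : ℕ} (a b c : Fin n) :
    (a = b ∧ b = c) ∨ sgn a b * sgn b c + sgn b c * sgn c a + sgn c a * sgn a b = -1 := by
  have h : ∀ x y : Fin n,
      (x = y ∧ sgn x y = 0) ∨ (x < y ∧ sgn x y = -1) ∨ (y < x ∧ sgn x y = 1) := by
    intro x y
    rcases lt_trichotomy x y with hxy | hxy | hxy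
    · exact Or.inr (Or.inl ⟨hxy, Int.sign_eq_neg_one_of_neg (by have := Fin.lt_def.1 hxy; omega)⟩)
    · exact Or.inl ⟨hxy, by rw [hxy, sgn, sub_self, Int.sign_zero]⟩
    · exact Or.inr (Or.inr ⟨hxy, Int.sign_eq_one_of_pos (by have := Fin.lt_def.1 hxy; omega)⟩)
  rcases h a b with ⟨h1, e1⟩ | ⟨h1, e1⟩ | ⟨h1, e1⟩ <;>
  rcases h b c with ⟨h2, e2⟩ | ⟨h2, e2⟩ | ⟨h2, e2⟩ <;>
  rcases h c a with ⟨h3, e3⟩ | ⟨h3, e3⟩ | ⟨h3, e3⟩ <;>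
  first
  | exact Or.inl ⟨h1, h2⟩
  | (right; rw [e1, e2, e3]; norm_num; done)
  | (exfalso; subst_vars; simp only [Fin.lt_def] at *; omega)

theorem sgn_swap {n : ℕ} (a b : Fin n) : sgn b a = -sgn a b := by
  rw [sgn, sgn, ← Int.sign_neg, neg_sub]

theorem sgn_self {n : ℕ} (a : Fin n) : sgn a a = 0 := by
  rw [sgn, sub_self, Int.sign_zero]

theorem sgn_of_lt {n : ℕ} {a b : Fin n} (h : a < b) : sgn a b = -1 :=
  Int.sign_eq_neg_one_of_neg (by have := Fin.lt_def.1 h; omega)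

theorem sgn_of_gt {n : ℕ} {a b : Fin n} (h : b < a) : sgn a b = 1 :=
  Int.sign_eq_one_of_pos (by have := Fin.lt_def.1 h; omega)

/-- The cyclic sums of signs of two triples of indices agree up to terms which vanish by
commutativity. -/
theorem sgn_cyclic_sub_mul {n m : ℕ} (y : Fin n → Fin m → A) (a c e : Fin n) (b d f : Fin m) :
    (((sgn a c * sgn c e + sgn c e * sgn e a + sgn e a * sgn a c : ℤ) : A) -
      ((sgn b d * sgn d f + sgn d f * sgn f b + sgn f b * sgn b d : ℤ) : A)) *
      (y a d * y c f * y e b - y a f * y c b * y e d) = 0 := by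
  -- If one of the triples is constant, the two monomials coincide; otherwise both cyclic sums are
  -- -1.
  rcases sgn_cyclic a c e with ⟨rfl, rfl⟩ | h1
  · ring
  rcases sgn_cyclic b d f with ⟨rfl, rfl⟩ | h2
  · ring
  rw [h1, h2, sub_self, zero_mul]

/-- The Jacobi identity for quantum matrices. -/
theorem jacobi_matrix {n : ℕ} (y : Fin n → Fin n → A) (h : k) (τ τ' : Fin n → Fin n → k)
    (hτ : ∀ i j, τ j i = -τ i j) (hτ' : ∀ i j, τ' j i = -τ' i j)
    {a b c d e f : Fin n} (D₁ D₂ D₃ : Derivation k A A)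
    (F : Fin n → Fin n → Fin n → Fin n → A)
    (hF : ∀ l m i j, F l m i j = algebraMap k A (τ l i + τ' m j) * y i j * y l m +
      algebraMap k A h * ((sgn l i + sgn m j : ℤ) : A) * y i m * y l j)
    (h₁ : ∀ l m, D₁ (y l m) = F a b l m) (h₂ : ∀ l m, D₂ (y l m) = F c d l m)
    (h₃ : ∀ l m, D₃ (y l m) = F e f l m) :
    D₁ (F c d e f) + D₂ (F e f a b) + D₃ (F a b c d) = 0 := by
  have key := sgn_cyclic_sub_mul y a c e b d f
  simp only [hF, map_add, Derivation.leibniz, Derivation.map_algebraMap, Derivation.map_intCast,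
    smul_eq_mul, h₁, h₂, h₃]
  rw [hτ c a, hτ e a, hτ e c, hτ' d b, hτ' f b, hτ' f d, sgn_swap a c, sgn_swap a e, sgn_swap c e,
    sgn_swap b d, sgn_swap b f, sgn_swap d f]
  rw [sgn_swap a e, sgn_swap b f] at key
  push_cast at key ⊢
  -- All terms involving `τ` or `τ'` cancel by antisymmetry; only the terms quadratic in `h` remain.
  linear_combination -(algebraMap k A h) ^ 2 * key

/-- The Jacobi identity for quantum symmetric (`ε = 1`) and antisymmetric (`ε = -1`) matrices. -/
theorem jacobi_symmetric {n : ℕ} (y : Fin n → Fin n → A) (ε : A) (hε : ε = 1 ∨ ε = -1)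
    (hy : ∀ i j, y j i = ε * y i j)
    {a b c d e f : Fin n} (D₁ D₂ D₃ : Derivation k A A) (hε₁ : D₁ ε = 0) (hε₂ : D₂ ε = 0)
    (hε₃ : D₃ ε = 0)
    (F : Fin n → Fin n → Fin n → Fin n → A)
    (hF : ∀ i j l m, F i j l m = ((sgn l j + sgn m i : ℤ) : A) * y i l * y j m +
      ε * ((sgn l i + sgn m j : ℤ) : A) * y i m * y j l)
    (h₁ : ∀ l m, D₁ (y l m) = F a b l m) (h₂ : ∀ l m, D₂ (y l m) = F c d l m)
    (h₃ : ∀ l m, D₃ (y l m) = F e f l m) :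
    D₁ (F c d e f) + D₂ (F e f a b) + D₃ (F a b c d) = 0 := by
  -- The four identities are the four ways of splitting the pairs `(a, b)`, `(c, d)`, `(e, f)` into
  -- two triples that each contain one index from every pair.
  have key₁ := sgn_cyclic_sub_mul y a c e b d f
  have key₂ := sgn_cyclic_sub_mul y b c e a d f
  have key₃ := sgn_cyclic_sub_mul y a d e b c f
  have key₄ := sgn_cyclic_sub_mul y a c f b d e
  simp only [hF, map_add, Derivation.leibniz, hε₁, hε₂, hε₃, Derivation.map_intCast,
    smul_eq_mul, h₁, h₂, h₃]
  simp only [hy a c, hy a d, hy a e, hy a f, hy b c, hy b d, hy b e, hy b f, hy c e, hy c f,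
    hy d e, hy d f] at key₁ key₂ key₃ key₄ ⊢
  simp only [sgn_swap a c, sgn_swap a d, sgn_swap a e, sgn_swap a f, sgn_swap b c, sgn_swap b d,
    sgn_swap b e, sgn_swap b f, sgn_swap c e, sgn_swap c f,
    sgn_swap d e, sgn_swap d f] at key₁ key₂ key₃ key₄ ⊢
  push_cast at key₁ key₂ key₃ key₄ ⊢
  rcases hε with rfl | rfl
  · linear_combination -key₁ - key₂ - key₃ - key₄
  · linear_combination -key₁ + key₂ + key₃ + key₄

/-- The Jacobi identity for brackets which are logarithmic up to terms `o s t`. -/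
theorem jacobi_log [CharZero k] {σ : Type*} (c o : σ → σ → MvPolynomial σ k) (a : σ → σ → k)
    (ha : ∀ s t, a t s = -a s t) (ho : ∀ s t, o t s = -o s t)
    (hc : ∀ s t, c s t = C (a s t) * X s * X t + o s t)
    (h : ∀ s t u, s ≠ t → s ≠ u →
      mkDerivation k (c s) (o t u) = C (a s t + a s u) * X s * o t u) (s t u : σ) :
    mkDerivation k (c s) (c t u) + mkDerivation k (c t) (c u s) +
      mkDerivation k (c u) (c s t) = 0 := by
  have hanti : ∀ s t, c t s = -c s t := fun s t => by
    rw [hc, hc, ha, ho, C_neg]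
    ring
  have hself : ∀ s, c s s = 0 := fun s => by
    have h2 : 2 * c s s = 0 := by linear_combination hanti s s
    exact (mul_eq_zero.1 h2).resolve_left two_ne_zero
  -- The hypothesis on `o` requires distinct indices; when two coincide, the Jacobi sum vanishes by
  -- antisymmetry alone.
  rcases eq_or_ne s t with rfl | hst
  · rw [hself, map_zero, add_zero, ← map_add, hanti u s, neg_add_cancel, map_zero]
  rcases eq_or_ne s u with rfl | hsu
  · rw [hself, map_zero, add_zero, ← map_add, hanti t s, add_neg_cancel, map_zero]
  rcases eq_or_ne t u with rfl | htu
  · rw [hself, map_zero, zero_add, ← map_add, hanti t s, add_neg_cancel, map_zero]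
  -- In the cyclic sum `X s * o t u` gets the coefficient `a s t + a s u` from the first term, and
  -- `a u s` and `-a s t` from the other two, so it cancels.
  have hD : ∀ x y z, x ≠ y → x ≠ z → mkDerivation k (c x) (c y z) = C (a y z) *
      (X y * (C (a x z) * X x * X z + o x z) + X z * (C (a x y) * X x * X y + o x y)) +
      C (a x y + a x z) * X x * o y z := fun x y z hxy hxz => by
    rw [hc y z, map_add, h x y z hxy hxz, mul_assoc, Derivation.leibniz, Derivation.leibniz,
      mkDerivation_X, mkDerivation_X, show mkDerivation k (c x) (C (a y z)) = 0 from
        Derivation.map_algebraMap _ _, smul_zero, add_zero, hc x y, hc x z]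
    simp only [smul_eq_mul]
  rw [hD s t u hst hsu, hD t u s htu hst.symm, hD u s t hsu.symm htu.symm, ha s t, ha t u, ha s u,
    ho t s, ho u s, ho u t]
  simp only [C_add, C_neg]
  ring

/-- A derivation acting logarithmically on the summands `t l` with `l ≠ j` acts
logarithmically on the partial sums if it acts suitably on `t j`. -/
theorem derivation_partialSum {n : ℕ} (D : Derivation k A A) (t : Fin n → A) (ω u p q : A)
    (j : Fin n) (hω : D ω = p * u * ω) (hlt : ∀ l < j, D (t l) = p * u * t l)
    (hgt : ∀ l, j < l → D (t l) = q * u * t l)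
    (hj : D (t j) = u * (q * t j + (q - p) * (ω + ∑ l ∈ Finset.Iio j, t l))) (i : Fin n) :
    D (ω + ∑ l ∈ Finset.Iio i, t l) =
      (if j < i then q else p) * u * (ω + ∑ l ∈ Finset.Iio i, t l) := by
  -- Induction over the number of summands. The eigenvalue is `p * u` until `t j` enters and `q * u`
  -- afterwards: for `S` the sum before `t j`, one has `p u S + u (q t_j + (q - p) S) = q u (S +
  -- t_j)`.
  have key : ∀ m : ℕ, D (ω + ∑ l with l.val < m, t l) =
      (if j.val < m then q else p) * u * (ω + ∑ l with l.val < m, t l) := by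
    intro m
    induction m with
    | zero => simpa using hω
    | succ m ih =>
      by_cases hm : m < n
      · have hins : (Finset.univ.filter fun l : Fin n => l.val < m + 1) =
            insert ⟨m, hm⟩ (Finset.univ.filter fun l : Fin n => l.val < m) := by
          ext l
          simp only [Finset.mem_filter, Finset.mem_univ, true_and, Finset.mem_insert, Fin.ext_iff]
          omega
        rw [hins, Finset.sum_insert (by simp), add_left_comm, map_add, ih]
        rcases lt_trichotomy j.val m with hjm | hjm | hjm
        · rw [if_pos hjm, if_pos (by omega), hgt _ hjm]
          ring
        · obtain rfl : j = ⟨m, hm⟩ := Fin.ext hjm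
          rw [if_neg (lt_irrefl _), if_pos (Nat.lt_succ_self m), hj]
          have : Finset.Iio (⟨m, hm⟩ : Fin n) = Finset.univ.filter fun l : Fin n => l.val < m := by
            ext l
            simp only [Finset.mem_Iio, Finset.mem_filter, Finset.mem_univ, true_and, Fin.lt_def]
          rw [this]
          ring
        · rw [if_neg (by omega), if_neg (by omega), hlt _ hjm]
          ring
      · have hsame : (Finset.univ.filter fun l : Fin n => l.val < m + 1) =
            Finset.univ.filter fun l : Fin n => l.val < m := by
          ext l
          simp only [Finset.mem_filter, Finset.mem_univ, true_and]
          omega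
        rw [hsame, ih, if_pos (by omega), if_pos (by omega)]
  have hi : Finset.Iio i = Finset.univ.filter fun l : Fin n => l.val < i.val := by
    ext l
    simp only [Finset.mem_Iio, Finset.mem_filter, Finset.mem_univ, true_and, Fin.lt_def]
  rw [hi]
  exact key i.val

end Jacobi

/-! ### All conclusions for an iterated Poisson-Ore extension -/

section Assembly

variable {k : Type u} [Field k] [CharZero k] {σ : Type v} [Fintype σ] {r : ℕ}
  {w : σ → Lex (Fin r → ℤ)} {χ : (Fin r → kˣ) →* (σ → kˣ)}
  {π : PoissonBracket k (MvPolynomial σ k)} {rk : σ → ℕ} {e : σ → Fin r → k}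

theorem IsIteratedPoissonExtension.conclusion (h : IsIteratedPoissonExtension π w rk e)
    (hχ : ∀ h s, χ h s = torusCharacter k (w s) h)
    (hw : ∀ s t, IsWeightedHomogeneous w (π.br (X s) (X t)) (w s + w t)) {N : ℕ}
    (hN : Fintype.card σ = N) :
    IsRationalPoissonAction π (scalingAction χ) ∧
      (stablePoissonPrimes π (scalingAction χ)).Finite ∧
      (stablePoissonPrimes π (scalingAction χ)).ncard ≤ 2 ^ N ∧ PoissonDixmierMoeglin π := by
  obtain ⟨hfin, hcard⟩ := h.finite_and_ncard_le hχ
  exact ⟨isRationalPoissonAction_scalingAction hχ hw, hfin, hN ▸ hcard,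
    poissonDixmierMoeglin_of_finite hχ hw hfin⟩

end Assembly

/-! ### Coordinate weights of the torus and their differentials -/

section Weights

variable {k : Type u} [Field k] {r : ℕ}

/-- The weight of the `i`-th coordinate character of the torus. -/
def unitWeight (i : Fin r) : Lex (Fin r → ℤ) :=
  toLex (Pi.single i 1)

theorem torusCharacter_unitWeight (i : Fin r) (h : Fin r → kˣ) :
    torusCharacter k (unitWeight i) h = h i := by
  rw [torusCharacter_apply, Finset.prod_eq_single i]
  · simp [unitWeight]
  · intro j _ hj
    simp [unitWeight, hj]
  · simp

theorem torusCharacter_neg (γ : Lex (Fin r → ℤ)) (h : Fin r → kˣ) :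
    torusCharacter k (-γ) h = (torusCharacter k γ h)⁻¹ := by
  rw [eq_inv_iff_mul_eq_one, ← torusCharacter_add, neg_add_cancel, torusCharacter_zero]

/-- The differential of a character at an element of the Lie algebra of the torus. -/
def lieWeight (e : Fin r → k) (γ : Lex (Fin r → ℤ)) : k :=
  ∑ i, e i * (ofLex γ i : k)

theorem lieWeight_unitWeight (e : Fin r → k) (i : Fin r) : lieWeight e (unitWeight i) = e i := by
  rw [lieWeight, Finset.sum_eq_single i]
  · simp [unitWeight]
  · intro j _ hj
    simp [unitWeight, hj]
  · simp

theorem lieWeight_add (e : Fin r → k) (γ δ : Lex (Fin r → ℤ)) :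
    lieWeight e (γ + δ) = lieWeight e γ + lieWeight e δ := by
  simp only [lieWeight, ofLex_add, Pi.add_apply, Int.cast_add, mul_add, Finset.sum_add_distrib]

theorem lieWeight_neg (e : Fin r → k) (γ : Lex (Fin r → ℤ)) :
    lieWeight e (-γ) = -lieWeight e γ := by
  simp only [lieWeight, ofLex_neg, Pi.neg_apply, Int.cast_neg, mul_neg, Finset.sum_neg_distrib]

end Weights

/-! ### Reduction to data on the variables, and the first family -/

section Families

variable {k : Type u} [Field k]

theorem isWeightedHomogeneous_C_mul_X_mul_X {σ : Type v} {r : ℕ} {w : σ → Lex (Fin r → ℤ)} (a : k)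
    {s t : σ} {γ : Lex (Fin r → ℤ)} (h : w s + w t = γ) :
    IsWeightedHomogeneous w (C a * X s * X t) γ := by
  rw [mul_assoc]
  exact ((isWeightedHomogeneous_X k w s).mul (isWeightedHomogeneous_X k w t) |>.C_mul a) |>
    fun h1 => h ▸ h1

theorem C_mul_X_mul_X_mem_supported {σ : Type v} {S : Set σ} (a : k) {s t : σ} (hs : s ∈ S)
    (ht : t ∈ S) : C a * X s * X t ∈ supported k S :=
  Subalgebra.mul_mem _ (Subalgebra.mul_mem _ (Subalgebra.algebraMap_mem _ a)
    (X_mem_supported.2 hs)) (X_mem_supported.2 ht)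

/-- The conclusions for a polynomial Poisson algebra given by the brackets `c s t` of the
variables. -/
theorem family_conclusion [CharZero k] {σ : Type v} [Fintype σ] {r : ℕ} {w : σ → Lex (Fin r → ℤ)}
    {χ : (Fin r → kˣ) →* (σ → kˣ)} (IsBr : PoissonBracket k (MvPolynomial σ k) → Prop)
    (c : σ → σ → MvPolynomial σ k)
    (hIs : ∀ π, IsBr π ↔ ∀ s t, π.br (X s) (X t) = c s t)
    (hanti : ∀ s t, c s t = -c t s)
    (hjac : ∀ s t u, mkDerivation k (c s) (c t u) + mkDerivation k (c t) (c u s) +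
      mkDerivation k (c u) (c s t) = 0)
    (hχ : ∀ h s, χ h s = torusCharacter k (w s) h)
    (hw : ∀ s t, IsWeightedHomogeneous w (c s t) (w s + w t))
    (rk : σ → ℕ) (e : σ → Fin r → k) (hinj : Function.Injective rk)
    (hsub : ∀ s t, rk t < rk s → c s t - C (lieWeight (e s) (w t)) * X t * X s ∈
      supported k {u | rk u < rk s})
    (hne : ∀ s, lieWeight (e s) (w s) ≠ 0) {N : ℕ} (hN : Fintype.card σ = N) :
    (∃! π, IsBr π) ∧ ∀ π, IsBr π → IsRationalPoissonAction π (scalingAction χ) ∧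
      (stablePoissonPrimes π (scalingAction χ)).Finite ∧
      (stablePoissonPrimes π (scalingAction χ)).ncard ≤ 2 ^ N ∧ PoissonDixmierMoeglin π := by
  constructor
  · obtain ⟨π, hπ⟩ := exists_poissonBracket c hanti hjac
    refine ⟨π, (hIs π).2 hπ, fun π' hπ' => ?_⟩
    refine PoissonBracket.ext_of_X fun s t => ?_
    rw [hπ, (hIs π').1 hπ']
  · intro π hπ
    have hX := (hIs π).1 hπ
    refine IsIteratedPoissonExtension.conclusion (rk := rk) (e := e) ⟨hinj, fun s t hst => ?_, hne⟩
      hχ (fun s t => ?_) hN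
    · rw [hX]
      exact hsub s t hst
    · rw [hX]
      exact hw s t

/-! ### Quantum matrices -/

/-- Lexicographic rank of pairs of indices. -/
def lexRank {n : ℕ} (s : Fin n × Fin n) : ℕ :=
  s.1.val * n + s.2.val

theorem lexRank_lt_iff {n : ℕ} {s t : Fin n × Fin n} :
    lexRank s < lexRank t ↔ s.1 < t.1 ∨ s.1 = t.1 ∧ s.2 < t.2 := by
  obtain ⟨⟨i, hi⟩, ⟨j, hj⟩⟩ := s
  obtain ⟨⟨l, hl⟩, ⟨m, hm⟩⟩ := t
  simp only [lexRank, Fin.lt_def, Fin.ext_iff]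
  rcases lt_trichotomy i l with h | rfl | h
  · have : (i + 1) * n ≤ l * n := Nat.mul_le_mul_right n h
    rw [add_mul] at this
    exact ⟨fun _ => Or.inl h, fun _ => by omega⟩
  · simp
  · have : (l + 1) * n ≤ i * n := Nat.mul_le_mul_right n h
    rw [add_mul] at this
    exact ⟨fun h1 => by omega, fun h1 => by omega⟩

theorem lexRank_injective {n : ℕ} : Function.Injective (lexRank (n := n)) := by
  intro s t h
  have h1 := mt lexRank_lt_iff.2 h.not_lt
  have h2 := mt lexRank_lt_iff.2 h.not_gt
  push Not at h1 h2
  have h3 := le_antisymm h2.1 h1.1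
  exact Prod.ext h3 (le_antisymm (h2.2 h3.symm) (h1.2 h3))

/-- The bracket of two variables of `O(M_n(k))`; the parameter `lam` is `h + h`. -/
noncomputable def matrixValue {n : ℕ} (h : k) (p : Matrix (Fin n) (Fin n) k)
    (s t : Fin n × Fin n) : MatrixAlg k n :=
  C ((p s.1 t.1 + h * (sgn s.1 t.1 : k)) + (-p s.2 t.2 - h * (sgn s.2 t.2 : k))) * X t * X s +
    C h * ((sgn s.1 t.1 + sgn s.2 t.2 : ℤ) : MatrixAlg k n) * X (t.1, s.2) * X (s.1, t.2)

theorem matrixValue_eq {n : ℕ} (h : k) (p : Matrix (Fin n) (Fin n) k) (l m i j : Fin n) :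
    matrixValue h p (l, m) (i, j) =
      C ((p l i + h * (sgn l i : k)) + (-p m j - h * (sgn m j : k))) * X (i, j) * X (l, m) +
        C (h * ((sgn l i + sgn m j : ℤ) : k)) * X (i, m) * X (l, j) := by
  rw [C_mul, map_intCast]
  rfl

theorem matrixValue_antisymm {n : ℕ} (h : k) (p : Matrix (Fin n) (Fin n) k)
    (hp : ∀ i j, p j i = -p i j) (s t : Fin n × Fin n) :
    matrixValue h p s t = -matrixValue h p t s := by
  obtain ⟨l, m⟩ := s
  obtain ⟨i, j⟩ := t
  rw [matrixValue_eq, matrixValue_eq, hp l i, hp m j, sgn_swap l i, sgn_swap m j]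
  push_cast
  simp only [C_add, C_mul, C_neg, C_sub]
  ring

theorem isMatrixBracket_iff [CharZero k] {n : ℕ} {lam h : k} (hl : lam = h + h)
    {p : Matrix (Fin n) (Fin n) k}
    (hp : ∀ i j, p j i = -p i j) (π : PoissonBracket k (MatrixAlg k n)) :
    IsMatrixBracket lam p π ↔ ∀ s t, π.br (X s) (X t) = matrixValue h p s t := by
  have hp0 : ∀ i, p i i = 0 := fun i => self_eq_neg.1 (hp i i)
  have h1 : ∀ l m i j : Fin n, i < l → j < m → matrixValue h p (l, m) (i, j) =
      C (p l i + p j m) * X (i, j) * X (l, m) + C lam * X (i, m) * X (l, j) := by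
    intro l m i j hil hjm
    rw [matrixValue_eq, sgn_of_gt hil, sgn_of_gt hjm, hl, hp m j]
    push_cast
    simp only [C_add, C_mul, C_neg, C_sub, C_1, C_0, map_ofNat]
    ring
  have h2 : ∀ l m i j : Fin n, i < l → m ≤ j → matrixValue h p (l, m) (i, j) =
      C (lam + p l i + p j m) * X (i, j) * X (l, m) := by
    intro l m i j hil hjm
    rw [hl]
    rcases hjm.eq_or_lt with rfl | hjm
    · rw [matrixValue_eq, sgn_of_gt hil, sgn_self, hp0]
      push_cast
      simp only [C_add, C_mul, C_neg, C_sub, C_1, C_0, map_ofNat]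
      ring
    · rw [matrixValue_eq, sgn_of_gt hil, sgn_of_lt hjm, hp m j]
      push_cast
      simp only [C_add, C_mul, C_neg, C_sub, C_1, C_0, map_ofNat]
      ring
  have h3 : ∀ l m i j : Fin n, l = i → j < m → matrixValue h p (l, m) (i, j) =
      C (p j m) * X (i, j) * X (l, m) := by
    rintro l m i j rfl hjm
    rw [matrixValue_eq, sgn_self, sgn_of_gt hjm, hp0, hp m j]
    push_cast
    simp only [C_add, C_mul, C_neg, C_sub, C_1, C_0, map_ofNat]
    ring
  constructor
  · intro hπ
    have key : ∀ l m i j : Fin n, i < l ∨ i = l ∧ j ≤ m →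
        π.br (X (l, m)) (X (i, j)) = matrixValue h p (l, m) (i, j) := by
      rintro l m i j (hil | ⟨rfl, hjm⟩)
      · rcases lt_or_ge j m with hjm | hjm
        · rw [hπ.gt_gt l m i j hil hjm, h1 l m i j hil hjm]
        · rw [hπ.gt_le l m i j hil hjm, h2 l m i j hil hjm]
      · rcases hjm.eq_or_lt with rfl | hjm
        · rw [π.self_eq_zero, eq_comm]
          exact self_eq_neg.1 (matrixValue_antisymm h p hp _ _)
        · rw [hπ.eq_gt i m i j rfl hjm, h3 i m i j rfl hjm]
    rintro ⟨l, m⟩ ⟨i, j⟩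
    rcases lt_trichotomy i l with hil | rfl | hil
    · exact key l m i j (Or.inl hil)
    · rcases le_total j m with hjm | hjm
      · exact key i m i j (Or.inr ⟨rfl, hjm⟩)
      · rw [π.antisymm, matrixValue_antisymm h p hp, key i j i m (Or.inr ⟨rfl, hjm⟩)]
    · rw [π.antisymm, matrixValue_antisymm h p hp, key i j l m (Or.inl hil)]
  · intro hπ
    exact ⟨fun l m i j hil hjm => by rw [hπ, h1 l m i j hil hjm],
      fun l m i j hil hjm => by rw [hπ, h2 l m i j hil hjm],
      fun l m i j hil hjm => by rw [hπ, h3 l m i j hil hjm]⟩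

theorem matrix_conclusion [CharZero k] {n : ℕ} (lam : k) (p : Matrix (Fin n) (Fin n) k)
    (hlam : lam ≠ 0)
    (hp : ∀ i j, p j i = -p i j) :
    (∃! π, IsMatrixBracket lam p π) ∧ ∀ π, IsMatrixBracket lam p π →
      IsRationalPoissonAction π (matrixAction k n) ∧
      (stablePoissonPrimes π (matrixAction k n)).Finite ∧
      (stablePoissonPrimes π (matrixAction k n)).ncard ≤ 2 ^ (n ^ 2) ∧
      PoissonDixmierMoeglin π := by
  -- Halving `lam` merges the cases of the bracket into one formula that is symmetric in the signs
  -- of rows and columns.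
  obtain ⟨h, hl⟩ : ∃ h : k, lam = h + h := ⟨lam / 2, (add_halves lam).symm⟩
  have hp0 : ∀ i, p i i = 0 := fun i => self_eq_neg.1 (hp i i)
  refine family_conclusion (w := fun s => unitWeight (Fin.castAdd n s.1) +
      unitWeight (Fin.natAdd n s.2)) (IsMatrixBracket lam p) (matrixValue h p)
    (isMatrixBracket_iff hl hp) (matrixValue_antisymm h p hp) ?_ ?_ ?_ lexRank
    -- Rows get the eigenvalues `p s.1 i`, columns `p j s.2` plus `lam` when `s.2 ≤ j`. These
    -- reproduce the logarithmic coefficients of the brackets with earlier variables, and `X s`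
    -- itself gets the weight `lam ≠ 0`, the diagonal of `p` being zero.
    (fun s => Fin.append (fun i => p s.1 i) (fun j => p j s.2 + if s.2 ≤ j then lam else 0))
    lexRank_injective ?_ ?_ (by simp [sq])
  · rintro ⟨a, b⟩ ⟨c, d⟩ ⟨e, f⟩
    refine jacobi_matrix (fun i j => (X (i, j) : MatrixAlg k n)) h
      (fun i j => p i j + h * (sgn i j : k)) (fun i j => -p i j - h * (sgn i j : k)) ?_ ?_
      (mkDerivation k (matrixValue h p (a, b))) (mkDerivation k (matrixValue h p (c, d)))
      (mkDerivation k (matrixValue h p (e, f))) (fun l m i j => matrixValue h p (l, m) (i, j)) ?_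
      (fun l m => mkDerivation_X _ _ _) (fun l m => mkDerivation_X _ _ _)
      (fun l m => mkDerivation_X _ _ _)
    · intro i j
      rw [hp i j, sgn_swap i j]
      push_cast
      ring
    · intro i j
      rw [hp i j, sgn_swap i j]
      push_cast
      ring
    · intro l m i j
      rfl
  · intro h s
    rw [torusCharacter_add, torusCharacter_unitWeight, torusCharacter_unitWeight]
    rfl
  · rintro ⟨l, m⟩ ⟨i, j⟩
    rw [matrixValue_eq]
    exact (isWeightedHomogeneous_C_mul_X_mul_X _ (by simp only; abel)).add
      (isWeightedHomogeneous_C_mul_X_mul_X _ (by simp only; abel))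
  · rintro ⟨l, m⟩ ⟨i, j⟩ hlt
    simp only [lieWeight_add, lieWeight_unitWeight, Fin.append_left, Fin.append_right]
    rcases lexRank_lt_iff.1 hlt with hil | ⟨rfl, hjm⟩
    · rcases lt_or_ge j m with hjm | hjm
      -- This is the only case with a remainder, and its factors `X (i, m)` and `X (l, j)` both
      -- precede `X (l, m)` in lexicographic order.
      · have h1 : matrixValue h p (l, m) (i, j) -
            C (p l i + (p j m + if m ≤ j then lam else 0)) * X (i, j) * X (l, m) =
            C lam * X (i, m) * X (l, j) := by
          rw [matrixValue_eq, sgn_of_gt hil, sgn_of_gt hjm, hl, hp m j, if_neg (not_le.2 hjm)]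
          push_cast
          simp only [C_add, C_mul, C_neg, C_sub, C_1, C_0, map_ofNat]
          ring
        rw [h1]
        exact C_mul_X_mul_X_mem_supported _ (lexRank_lt_iff.2 (Or.inl hil))
          (lexRank_lt_iff.2 (Or.inr ⟨rfl, hjm⟩))
      · convert Subalgebra.zero_mem _ using 1
        rw [if_pos hjm, hl]
        rcases hjm.eq_or_lt with rfl | hjm
        · rw [matrixValue_eq, sgn_of_gt hil, sgn_self, hp0]
          push_cast
          simp only [C_add, C_mul, C_neg, C_sub, C_1, C_0, map_ofNat]
          ring
        · rw [matrixValue_eq, sgn_of_gt hil, sgn_of_lt hjm, hp m j]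
          push_cast
          simp only [C_add, C_mul, C_neg, C_sub, C_1, C_0, map_ofNat]
          ring
    · change j < m at hjm
      convert Subalgebra.zero_mem _ using 1
      rw [matrixValue_eq, sgn_self, sgn_of_gt hjm, hp0, hp m j, if_neg (not_le.2 hjm)]
      push_cast
      simp only [C_add, C_mul, C_neg, C_sub, C_1, C_0, map_ofNat]
      ring
  · rintro ⟨l, m⟩
    simp only [lieWeight_add, lieWeight_unitWeight, Fin.append_left, Fin.append_right, hp0]
    simpa using hlam

end Families

/-! ### Symmetric and antisymmetric matrices, treated together by a sign `ε` -/

section SymmetricFamilies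

variable {k : Type u} [Field k]

/-- The variables `y i j` of a polynomial algebra indexed by pairs `i ≤ j` (for `ε = 1`) or
`i < j` (for `ε = -1`), extended by `y j i = ε * y i j`. -/
structure IsSymmetricFamily {σ : Type v} {n : ℕ} (ε : MvPolynomial σ k) (emb : σ → Fin n × Fin n)
    (y : Fin n → Fin n → MvPolynomial σ k) : Prop where
  sign : ε = 1 ∨ ε = -1
  injective : Function.Injective emb
  le : ∀ s, (emb s).1 ≤ (emb s).2
  X_eq : ∀ s, X s = y (emb s).1 (emb s).2
  swap : ∀ i j, y j i = ε * y i j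
  cover : ∀ i j, i ≤ j → (∃ s, emb s = (i, j)) ∨ (i = j ∧ y i j = 0 ∧ ε = -1)

/-- The bracket `{y i j, y l m}`. -/
noncomputable def symValue {σ : Type v} {n : ℕ} (ε : MvPolynomial σ k)
    (y : Fin n → Fin n → MvPolynomial σ k) (i j l m : Fin n) : MvPolynomial σ k :=
  ((sgn l j + sgn m i : ℤ) : MvPolynomial σ k) * y i l * y j m +
    ε * ((sgn l i + sgn m j : ℤ) : MvPolynomial σ k) * y i m * y j l

namespace IsSymmetricFamily

variable {σ : Type v} {n : ℕ} {ε : MvPolynomial σ k} {emb : σ → Fin n × Fin n}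
  {y : Fin n → Fin n → MvPolynomial σ k}

theorem symValue_antisymm (hy : IsSymmetricFamily ε emb y) (i j l m : Fin n) :
    symValue ε y i j l m = -symValue ε y l m i j := by
  rw [symValue, symValue, hy.swap i l, hy.swap j m, hy.swap i m, hy.swap j l, sgn_swap l j,
    sgn_swap m i, sgn_swap l i, sgn_swap m j]
  push_cast
  rcases hy.sign with rfl | rfl <;> ring

theorem symValue_swap (hy : IsSymmetricFamily ε emb y) (i j l m : Fin n) :
    symValue ε y i j m l = ε * symValue ε y i j l m := by
  rw [symValue, symValue]
  push_cast
  rcases hy.sign with rfl | rfl <;> ring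

/-- Statements about the `y i j` can be checked on the variables. -/
theorem forall_y (hy : IsSymmetricFamily ε emb y) {p : Fin n → Fin n → Prop}
    (hX : ∀ s, p (emb s).1 (emb s).2) (h0 : ∀ i, y i i = 0 → ε = -1 → p i i)
    (hswap : ∀ i j, p i j → p j i) (i j : Fin n) : p i j := by
  have key : ∀ i j, i ≤ j → p i j := fun i j hij => by
    rcases hy.cover i j hij with ⟨s, hs⟩ | ⟨rfl, h1, h2⟩
    · have := hX s
      rwa [hs] at this
    · exact h0 i h1 h2
  rcases le_total i j with hij | hij
  · exact key i j hij
  · exact hswap _ _ (key j i hij)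

/-- The derivation is prescribed on variables only. It has the expected values on transposed and
vanishing entries because `symValue` has the same symmetry in its last two indices as `y`, and
derivations kill `ε = ±1`. -/
theorem mkDerivation_y (hy : IsSymmetricFamily ε emb y) (a b : Fin n) (i j : Fin n) :
    mkDerivation k (fun t => symValue ε y a b (emb t).1 (emb t).2) (y i j) =
      symValue ε y a b i j := by
  refine hy.forall_y (p := fun i j => mkDerivation k
    (fun t => symValue ε y a b (emb t).1 (emb t).2) (y i j) = symValue ε y a b i j)
    (fun s => ?_) (fun i h1 h2 => ?_) (fun i j hij => ?_) i j
  · rw [← hy.X_eq, mkDerivation_X]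
  · rw [h1, map_zero, symValue, h2]
    push_cast
    ring
  · rw [hy.swap i j, hy.symValue_swap a b i j, Derivation.leibniz, hij]
    rcases hy.sign with rfl | rfl
    · simp
    · rw [map_neg, Derivation.map_one_eq_zero]
      simp

theorem isWeightedHomogeneous_y (hy : IsSymmetricFamily ε emb y) (i j : Fin n) :
    IsWeightedHomogeneous (fun s => unitWeight (emb s).1 + unitWeight (emb s).2) (y i j)
      (unitWeight i + unitWeight j) := by
  refine hy.forall_y (p := fun i j => IsWeightedHomogeneous
    (fun s => unitWeight (emb s).1 + unitWeight (emb s).2) (y i j)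
      (unitWeight i + unitWeight j)) (fun s => ?_) (fun i h1 h2 => ?_) (fun i j hij => ?_) i j
  · rw [← hy.X_eq]
    exact isWeightedHomogeneous_X k _ s
  · rw [h1]
    exact isWeightedHomogeneous_zero k _ _
  · rw [hy.swap i j, add_comm]
    rcases hy.sign with rfl | rfl
    · rwa [one_mul]
    · rw [neg_one_mul]
      exact hij.neg

theorem isWeightedHomogeneous_symValue (hy : IsSymmetricFamily ε emb y) (i j l m : Fin n) :
    IsWeightedHomogeneous (fun s => unitWeight (emb s).1 + unitWeight (emb s).2)
      (symValue ε y i j l m) (unitWeight i + unitWeight j + (unitWeight l + unitWeight m)) := by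
  have h1 : ∀ (a b c d : Fin n) (z : ℤ),
      unitWeight a + unitWeight b + (unitWeight c + unitWeight d) =
      unitWeight i + unitWeight j + (unitWeight l + unitWeight m) →
      IsWeightedHomogeneous (fun s => unitWeight (emb s).1 + unitWeight (emb s).2)
        ((z : MvPolynomial σ k) * y a b * y c d)
        (unitWeight i + unitWeight j + (unitWeight l + unitWeight m)) := by
    intro a b c d z h
    rw [← h, mul_assoc, ← map_intCast (C : k →+* MvPolynomial σ k)]
    exact ((hy.isWeightedHomogeneous_y a b).mul (hy.isWeightedHomogeneous_y c d)).C_mul _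
  refine (h1 i l j m _ (by abel)).add ?_
  have h2 := h1 i m j l (sgn l i + sgn m j) (by abel)
  rw [mul_assoc, mul_assoc, ← mul_assoc (Int.cast _)]
  rcases hy.sign with h | h
  · rwa [h, one_mul]
  · rw [h, neg_one_mul]
    exact h2.neg

theorem y_mem_supported (hy : IsSymmetricFamily ε emb y) {S : Set σ} (a b : Fin n) (hab : a ≤ b)
    (hS : ∀ s, emb s = (a, b) → s ∈ S) : y a b ∈ supported k S := by
  rcases hy.cover a b hab with ⟨s, hs⟩ | ⟨-, h, -⟩
  · have h1 := hy.X_eq s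
    rw [hs] at h1
    rw [← h1]
    exact X_mem_supported.2 (hS s hs)
  · rw [h]
    exact Subalgebra.zero_mem _

/-- The element of the Lie algebra of the torus by which the adjunction of `y l m` is twisted. -/
def symTwist (k : Type u) [Field k] {n : ℕ} (l m : Fin n) (i : Fin n) : k :=
  -(if i = l then 1 else 0) - (if i = m then 1 else 0)

/-- The logarithmic coefficient is minus the number of coincidences between `i, j` and `l, m`. For
`i < l` the remainder has two products when `j < l`, one when `l ≤ j < m`, and none when `m ≤ j`;
for `i = l` it vanishes. Every factor that occurs is zero or a variable preceding `y l m`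
lexicographically. -/
theorem symValue_sub_mem (hy : IsSymmetricFamily ε emb y) {l m i j : Fin n} (hlm : l ≤ m)
    (hij : i ≤ j) (hlt : i < l ∨ i = l ∧ j < m) {S : Set σ}
    (hS : ∀ s, (emb s).1 < l ∨ (emb s).1 = l ∧ (emb s).2 < m → s ∈ S) :
    symValue ε y l m i j - C (symTwist k l m i + symTwist k l m j) * y i j * y l m ∈
      supported k S := by
  have hmem : ∀ a b, a ≤ b → (a < l ∨ a = l ∧ b < m) → y a b ∈ supported k S :=
    fun a b hab h => hy.y_mem_supported a b hab fun s hs => hS s (by rwa [hs])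
  have hε : ε * ε = 1 := by rcases hy.sign with h | h <;> rw [h] <;> ring
  have hεmem : ε ∈ supported k S := by
    rcases hy.sign with h | h <;> rw [h]
    · exact Subalgebra.one_mem _
    · exact Subalgebra.neg_mem _ (Subalgebra.one_mem _)
  have hnum : (2 : MvPolynomial σ k) ∈ supported k S := ofNat_mem _ 2
  have hdiag : ∀ a, ε * y a a = y a a := fun a => (hy.swap a a).symm
  have h0 : ∀ f : MvPolynomial σ k, f = 0 → f ∈ supported k S := fun f hf => by
    rw [hf]
    exact Subalgebra.zero_mem _
  rw [symValue, symTwist, symTwist]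
  rcases hlt with hil | ⟨rfl, hjm⟩
  · have him := hil.trans_le hlm
    rcases lt_trichotomy j l with hjl | rfl | hjl
    · have hjm := hjl.trans_le hlm
      rw [sgn_of_lt him, sgn_of_lt hjl, sgn_of_lt hil, sgn_of_lt hjm, if_neg hil.ne, if_neg him.ne,
        if_neg hjl.ne, if_neg hjm.ne, hy.swap i l, hy.swap j m, hy.swap j l, hy.swap i m]
      have h1 := Subalgebra.mul_mem _ (hmem i l hil.le (Or.inl hil)) (hmem j m hjm.le (Or.inl hjl))
      have h2 := Subalgebra.mul_mem _ hεmem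
        (Subalgebra.mul_mem _ (hmem j l hjl.le (Or.inl hjl)) (hmem i m him.le (Or.inl hil)))
      convert Subalgebra.neg_mem _ (Subalgebra.mul_mem _ hnum (Subalgebra.add_mem _ h1 h2)) using 1
      push_cast
      simp only [C_0, C_neg, C_sub, C_add, neg_zero, sub_zero, add_zero]
      linear_combination (-2 * y i l * y j m - 2 * ε * y j l * y i m) * hε
    · rcases hlm.eq_or_lt with rfl | hjm
      · apply h0
        rw [sgn_of_lt hil, sgn_self, if_neg hil.ne, if_pos rfl, hy.swap i j]
        push_cast
        simp only [C_0, C_1, C_neg, C_sub, C_add, neg_zero, sub_zero, add_zero, zero_add]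
        linear_combination (-2 * y i j - ε * y i j) * hdiag j
      · rw [sgn_of_lt him, sgn_self, sgn_of_lt hil, sgn_of_lt hjm, if_neg hil.ne, if_neg him.ne,
          if_pos rfl, if_neg hjm.ne, hy.swap i j, hy.swap j m, hy.swap i m]
        have h2 := Subalgebra.mul_mem _ (hmem j j le_rfl (Or.inr ⟨rfl, hjm⟩))
          (hmem i m him.le (Or.inl hil))
        convert Subalgebra.neg_mem _ (Subalgebra.mul_mem _ hnum h2) using 1
        push_cast
        simp only [C_0, C_1, C_neg, C_sub, C_add, neg_zero, sub_zero, add_zero, zero_add]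
        linear_combination (-y i j * y j m - 2 * y j j * y i m) * hε
    · rcases lt_trichotomy j m with hjm | rfl | hjm
      · rw [sgn_of_lt him, sgn_of_gt hjl, sgn_of_lt hil, sgn_of_lt hjm, if_neg hil.ne,
        if_neg him.ne,
          if_neg hjl.ne', if_neg hjm.ne, hy.swap i m]
        have h2 := Subalgebra.mul_mem _ (hmem l j hjl.le (Or.inr ⟨rfl, hjm⟩))
          (hmem i m him.le (Or.inl hil))
        convert Subalgebra.neg_mem _ (Subalgebra.mul_mem _ hnum h2) using 1
        push_cast
        simp only [C_0, C_1, C_neg, C_sub, C_add, neg_zero, sub_zero, add_zero, zero_add]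
        linear_combination (-2 * y l j * y i m) * hε
      · apply h0
        rw [sgn_of_lt him, sgn_of_gt hjl, sgn_of_lt hil, sgn_self, if_neg hil.ne, if_neg him.ne,
          if_neg hjl.ne', if_pos rfl, hy.swap i j]
        push_cast
        simp only [C_0, C_1, C_neg, C_sub, C_add, neg_zero, sub_zero, add_zero, zero_add]
        linear_combination (-y l j * y i j) * hε
      · apply h0
        rw [sgn_of_lt him, sgn_of_gt hjl, sgn_of_lt hil, sgn_of_gt hjm, if_neg hil.ne,
          if_neg him.ne,
          if_neg hjl.ne', if_neg hjm.ne']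
        push_cast
        simp only [C_0, C_1, C_neg, C_sub, C_add, neg_zero, sub_zero, add_zero, zero_add]
        ring
  · apply h0
    have him := hij.trans_lt hjm
    rcases hij.eq_or_lt with rfl | hij
    · rw [sgn_of_lt hjm, sgn_self, if_pos rfl, if_neg hjm.ne, hy.swap i m]
      push_cast
      simp only [C_0, C_1, C_neg, C_sub, C_add, neg_zero, sub_zero, add_zero, zero_add]
      linear_combination (-y i m) * hdiag i - y i i * y i m * hε
    · rw [sgn_of_lt him, sgn_of_gt hij, sgn_self, sgn_of_lt hjm, if_pos rfl, if_neg him.ne,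
        if_neg hij.ne', if_neg hjm.ne, hy.swap i m]
      push_cast
      simp only [C_0, C_1, C_neg, C_sub, C_add, neg_zero, sub_zero, add_zero, zero_add]
      linear_combination (-y i j * y i m) * hε

theorem conclusion [CharZero k] [Fintype σ] (hy : IsSymmetricFamily ε emb y)
    {χ : (Fin n → kˣ) →* (σ → kˣ)} (hχ : ∀ h s, χ h s = h (emb s).1 * h (emb s).2)
    (IsBr : PoissonBracket k (MvPolynomial σ k) → Prop)
    (hIs : ∀ π, IsBr π ↔ ∀ s t, π.br (X s) (X t) =
      symValue ε y (emb s).1 (emb s).2 (emb t).1 (emb t).2) {N : ℕ} (hN : Fintype.card σ = N) :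
    (∃! π, IsBr π) ∧ ∀ π, IsBr π → IsRationalPoissonAction π (scalingAction χ) ∧
      (stablePoissonPrimes π (scalingAction χ)).Finite ∧
      (stablePoissonPrimes π (scalingAction χ)).ncard ≤ 2 ^ N ∧ PoissonDixmierMoeglin π := by
  refine family_conclusion (w := fun s => unitWeight (emb s).1 + unitWeight (emb s).2) IsBr _ hIs
    (fun s t => hy.symValue_antisymm _ _ _ _) (fun s t u => ?_) (fun h s => ?_)
    (fun s t => hy.isWeightedHomogeneous_symValue _ _ _ _) (fun s => lexRank (emb s))
    (fun s => symTwist k (emb s).1 (emb s).2) (lexRank_injective.comp hy.injective)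
    (fun s t hst => ?_) (fun s => ?_) hN
  · refine jacobi_symmetric y ε hy.sign hy.swap _ _ _ ?_ ?_ ?_ (symValue ε y) (fun _ _ _ _ => rfl)
      (hy.mkDerivation_y _ _) (hy.mkDerivation_y _ _) (hy.mkDerivation_y _ _)
    all_goals
      rcases hy.sign with h | h <;> rw [h]
      · exact Derivation.map_one_eq_zero _
      · rw [map_neg, Derivation.map_one_eq_zero, neg_zero]
  · rw [torusCharacter_add, torusCharacter_unitWeight, torusCharacter_unitWeight, hχ]
  · simp only [lieWeight_add, lieWeight_unitWeight]
    rw [hy.X_eq s, hy.X_eq t]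
    exact hy.symValue_sub_mem (hy.le s) (hy.le t) (lexRank_lt_iff.1 hst)
      (fun u hu => lexRank_lt_iff.2 hu)
  -- The variable `y l m` has weight -2 under its own twist, or -4 if `l = m`.
  · simp only [lieWeight_add, lieWeight_unitWeight, symTwist]
    split_ifs <;> norm_num

end IsSymmetricFamily

theorem sym_conclusion [CharZero k] (n : ℕ) :
    (∃! π : PoissonBracket k (SymMatAlg k n), IsSymBracket π) ∧
      ∀ π : PoissonBracket k (SymMatAlg k n), IsSymBracket π →
        IsRationalPoissonAction π (symAction k n) ∧
        (stablePoissonPrimes π (symAction k n)).Finite ∧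
        (stablePoissonPrimes π (symAction k n)).ncard ≤ 2 ^ (n * (n + 1) / 2) ∧
        PoissonDixmierMoeglin π := by
  have hlt : ∀ i j : Fin n, ∀ h : i ≤ j, SymMatAlg.y (k := k) i j = X ⟨(i, j), h⟩ :=
    fun i j h => dif_pos h
  have hy : IsSymmetricFamily (1 : SymMatAlg k n) (fun s => s.1) SymMatAlg.y := by
    refine ⟨Or.inl rfl, Subtype.val_injective, fun s => s.2, fun s => (hlt _ _ s.2).symm,
      fun i j => ?_, fun i j hij => Or.inl ⟨⟨(i, j), hij⟩, rfl⟩⟩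
    rw [one_mul]
    rcases lt_trichotomy i j with hij | rfl | hij
    · rw [hlt i j hij.le, SymMatAlg.y, dif_neg (not_le.2 hij)]
    · rfl
    · rw [hlt j i hij.le, SymMatAlg.y, dif_neg (not_le.2 hij)]
  refine hy.conclusion (fun h s => rfl) _
    (fun π => ⟨fun hπ s t => ?_, fun hπ i j l m hij hlm => ?_⟩)
    ?_
  · rw [hy.X_eq s, hy.X_eq t, hπ _ _ _ _ s.2 t.2, symValue, one_mul]
  · rw [hlt i j hij, hlt l m hlm, hπ, symValue, one_mul]
  -- Ordered pairs `i ≤ j` correspond to unordered pairs with repetition.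
  · rw [← Fintype.card_congr (Sym2.sortEquiv (α := Fin n)), Sym2.card, Fintype.card_fin,
      Nat.choose_two_right, Nat.add_sub_cancel, mul_comm]

theorem antisym_conclusion [CharZero k] (n : ℕ) :
    (∃! π : PoissonBracket k (AntisymMatAlg k n), IsAntisymBracket π) ∧
      ∀ π : PoissonBracket k (AntisymMatAlg k n), IsAntisymBracket π →
        IsRationalPoissonAction π (antisymAction k n) ∧
        (stablePoissonPrimes π (antisymAction k n)).Finite ∧
        (stablePoissonPrimes π (antisymAction k n)).ncard ≤ 2 ^ (n * (n - 1) / 2) ∧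
        PoissonDixmierMoeglin π := by
  have hlt : ∀ i j : Fin n, ∀ h : i < j, AntisymMatAlg.y (k := k) i j = X ⟨(i, j), h⟩ :=
    fun i j h => dif_pos h
  have hgt : ∀ i j : Fin n, ∀ h : j < i, AntisymMatAlg.y (k := k) i j = -X ⟨(j, i), h⟩ :=
    fun i j h => by rw [AntisymMatAlg.y, dif_neg h.not_gt, dif_pos h]
  have hdiag : ∀ i : Fin n, AntisymMatAlg.y (k := k) i i = 0 :=
    fun i => by rw [AntisymMatAlg.y, dif_neg (lt_irrefl i), dif_neg (lt_irrefl i)]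
  have hy : IsSymmetricFamily (-1 : AntisymMatAlg k n) (fun s => s.1) AntisymMatAlg.y := by
    refine ⟨Or.inr rfl, Subtype.val_injective, fun s => s.2.le, fun s => (hlt _ _ s.2).symm,
      fun i j => ?_, fun i j hij => ?_⟩
    · rcases lt_trichotomy i j with hij | rfl | hij
      · rw [hlt i j hij, hgt j i hij, neg_one_mul]
      · rw [hdiag, mul_zero]
      · rw [hlt j i hij, hgt i j hij, neg_one_mul, neg_neg]
    · rcases hij.eq_or_lt with rfl | hij
      · exact Or.inr ⟨rfl, hdiag i, rfl⟩
      · exact Or.inl ⟨⟨(i, j), hij⟩, rfl⟩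
  refine hy.conclusion (fun h s => rfl) _
    (fun π => ⟨fun hπ s t => ?_, fun hπ i j l m hij hlm => ?_⟩)
    ?_
  · rw [hy.X_eq s, hy.X_eq t, hπ _ _ _ _ s.2 t.2, symValue]
    ring
  · rw [hlt i j hij, hlt l m hlm, hπ, symValue]
    ring
  · have h1 : Fintype.card {s : Fin n × Fin n // s.1 < s.2} = n.choose 2 := by
      rw [Fintype.card_subtype, Fintype.card_product_filter_lt, Fintype.card_fin]
    rw [h1, Nat.choose_two_right]

end SymmetricFamilies

section EuclideanFamilies

variable {k : Type u} [Field k] {n : ℕ}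

/-! ### Quantum symplectic and euclidean spaces -/

/-- The coefficients of the logarithmic part of the brackets of the variables `x_i`, `y_i`. -/
def pairCoeff (γ : Matrix (Fin n) (Fin n) k) (p q : Fin n → k) :
    Fin n ⊕ Fin n → Fin n ⊕ Fin n → k
  | Sum.inl i, Sum.inl j =>
    if i < j then q i - p j + γ i j else if j < i then -(q j - p i + γ j i) else 0
  | Sum.inl i, Sum.inr j => if i < j then p j + γ j i else q j + γ j i
  | Sum.inr i, Sum.inl j => -(if j < i then p i + γ i j else q i + γ i j)
  | Sum.inr i, Sum.inr j => γ i j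

theorem pairCoeff_antisymm {γ : Matrix (Fin n) (Fin n) k} (p q : Fin n → k)
    (hγ : ∀ i j, γ j i = -γ i j) (s t : Fin n ⊕ Fin n) :
    pairCoeff γ p q t s = -pairCoeff γ p q s t := by
  rcases s with i | i <;> rcases t with j | j
  · simp only [pairCoeff]
    rcases lt_trichotomy i j with h | rfl | h
    · rw [if_neg h.not_gt, if_pos h, if_pos h]
    · simp
    · rw [if_pos h, if_neg h.not_gt, if_pos h, neg_neg]
  · rfl
  · exact (neg_neg _).symm
  · exact hγ i j

section

variable {R : Type v} [CommRing R] [Algebra k R]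

/-- The partial sums `ω + ∑_{l < i} (q_l - p_l) x_l y_l`. -/
def pairSum (p q : Fin n → k) (v : Fin n ⊕ Fin n → R) (ω : R) (i : Fin n) : R :=
  ω + ∑ l ∈ Finset.Iio i, algebraMap k R (q l - p l) * v (Sum.inl l) * v (Sum.inr l)

/-- The non-logarithmic part of the brackets of the variables `x_i`, `y_i`. -/
def pairOffset (p q : Fin n → k) (v : Fin n ⊕ Fin n → R) (ω : R) :
    Fin n ⊕ Fin n → Fin n ⊕ Fin n → R
  | Sum.inl i, Sum.inr j => if i = j then pairSum p q v ω i else 0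
  | Sum.inr i, Sum.inl j => -(if j = i then pairSum p q v ω j else 0)
  | _, _ => 0

theorem pairOffset_antisymm (p q : Fin n → k) (v : Fin n ⊕ Fin n → R) (ω : R)
    (s t : Fin n ⊕ Fin n) : pairOffset p q v ω t s = -pairOffset p q v ω s t := by
  rcases s with i | i <;> rcases t with j | j
  · exact neg_zero.symm
  · rfl
  · exact (neg_neg _).symm
  · exact neg_zero.symm

/-- The bracket of two of the variables `x_i`, `y_i`. -/
def pairValue (γ : Matrix (Fin n) (Fin n) k) (p q : Fin n → k) (v : Fin n ⊕ Fin n → R) (ω : R)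
    (s t : Fin n ⊕ Fin n) : R :=
  algebraMap k R (pairCoeff γ p q s t) * v s * v t + pairOffset p q v ω s t

/-- Every offset is zero or a partial sum up to sign, the nonzero ones occurring only between `x_i`
and `y_i`; this replaces repeated case distinctions. -/
theorem pairOffset_induction {P : Fin n ⊕ Fin n → Fin n ⊕ Fin n → R → Prop} (p q : Fin n → k)
    (v : Fin n ⊕ Fin n → R) (ω : R) (h0 : ∀ s t, P s t 0)
    (h1 : ∀ i, P (Sum.inl i) (Sum.inr i) (pairSum p q v ω i))
    (h2 : ∀ i, P (Sum.inr i) (Sum.inl i) (-pairSum p q v ω i)) (s t : Fin n ⊕ Fin n) :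
    P s t (pairOffset p q v ω s t) := by
  rcases s with i | i <;> rcases t with j | j
  · exact h0 _ _
  · simp only [pairOffset]
    split_ifs with h
    · exact h ▸ h1 i
    · exact h0 _ _
  · simp only [pairOffset]
    split_ifs with h
    · exact h ▸ h2 j
    · rw [neg_zero]
      exact h0 _ _
  · exact h0 _ _

/-- In the coefficients of `{x_j, x_l y_l}` the entries of `γ` cancel, leaving `p_j` for `l < j` and
`q_j` for `l > j`; for `y_j` the signs are reversed. At `l = j` the offset in `{x_j, y_j}` supplies
exactly the correction needed by `derivation_partialSum`. The condition on `ω` starts the sum with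
the eigenvalue of the terms `l < j`. -/
theorem derivation_pairSum {γ : Matrix (Fin n) (Fin n) k} {p q : Fin n → k}
    {v : Fin n ⊕ Fin n → R} {ω : R} (hγ : ∀ i j, γ j i = -γ i j) (D : Derivation k R R)
    (s : Fin n ⊕ Fin n) (hD : ∀ t, D (v t) = pairValue γ p q v ω s t)
    (hω : D ω = algebraMap k R (Sum.elim p (fun j => -p j) s) * v s * ω) (i : Fin n)
    (hsi : s ≠ Sum.inl i) (hsi' : s ≠ Sum.inr i) (h0 : ∀ i, γ i i = 0) :
    D (pairSum p q v ω i) = algebraMap k R (pairCoeff γ p q s (Sum.inl i) +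
      pairCoeff γ p q s (Sum.inr i)) * v s * pairSum p q v ω i := by
  have hleib : ∀ l, D (algebraMap k R (q l - p l) * v (Sum.inl l) * v (Sum.inr l)) =
      algebraMap k R (q l - p l) * (v (Sum.inl l) * pairValue γ p q v ω s (Sum.inr l) +
        v (Sum.inr l) * pairValue γ p q v ω s (Sum.inl l)) := by
    intro l
    rw [mul_assoc, Derivation.leibniz, Derivation.leibniz, hD, hD, Derivation.map_algebraMap,
      smul_zero, add_zero]
    rfl
  rcases s with j | j
  · have hne : j ≠ i := fun h => hsi (h ▸ rfl)
    unfold pairSum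
    refine (derivation_partialSum D _ ω (v (Sum.inl j)) (algebraMap k R (p j))
      (algebraMap k R (q j)) j hω (fun l hl => ?_) (fun l hl => ?_) ?_ i).trans ?_
    · rw [hleib]
      simp only [pairValue, pairCoeff, pairOffset, if_neg hl.not_gt, if_pos hl, hl.ne',
        if_false, hγ l j, map_add, map_neg, map_sub]
      ring
    · rw [hleib]
      simp only [pairValue, pairCoeff, pairOffset, if_pos hl, hl.ne,
        if_false, hγ l j, map_add, map_neg, map_sub]
      ring
    · rw [hleib]
      simp only [pairValue, pairCoeff, pairOffset, lt_irrefl, if_true, if_false, h0, pairSum,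
        map_sub, map_zero, add_zero]
      ring
    · congr 2
      rcases lt_or_gt_of_ne hne with h | h
      · rw [if_pos h]
        simp only [pairCoeff, if_pos h, hγ i j]
        congr 1
        ring
      · rw [if_neg h.not_gt]
        simp only [pairCoeff, if_neg h.not_gt, if_pos h, hγ i j]
        congr 1
        ring
  · have hne : j ≠ i := fun h => hsi' (h ▸ rfl)
    unfold pairSum
    refine (derivation_partialSum D _ ω (v (Sum.inr j)) (algebraMap k R (-p j))
      (algebraMap k R (-q j)) j hω (fun l hl => ?_) (fun l hl => ?_) ?_ i).trans ?_
    · rw [hleib]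
      simp only [pairValue, pairCoeff, pairOffset, if_pos hl, hl.ne,
        if_false, map_add, map_neg, map_sub, neg_zero]
      ring
    · rw [hleib]
      simp only [pairValue, pairCoeff, pairOffset, if_neg hl.not_gt, hl.ne',
        if_false, map_add, map_neg, map_sub, neg_zero]
      ring
    · rw [hleib]
      simp only [pairValue, pairCoeff, pairOffset, lt_irrefl, if_true, if_false, h0, pairSum,
        map_sub, map_zero, map_neg, add_zero]
      ring
    · congr 2
      rcases lt_or_gt_of_ne hne with h | h
      · rw [if_pos h]
        simp only [pairCoeff, if_neg h.not_gt]
        congr 1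
        ring
      · rw [if_neg h.not_gt]
        simp only [pairCoeff, if_pos h]
        congr 1
        ring

theorem derivation_pairOffset {γ : Matrix (Fin n) (Fin n) k} {p q : Fin n → k}
    {v : Fin n ⊕ Fin n → R} {ω : R} (hγ : ∀ i j, γ j i = -γ i j) (h0 : ∀ i, γ i i = 0)
    (D : Derivation k R R) (s : Fin n ⊕ Fin n) (hD : ∀ t, D (v t) = pairValue γ p q v ω s t)
    (hω : D ω = algebraMap k R (Sum.elim p (fun j => -p j) s) * v s * ω) (t u : Fin n ⊕ Fin n) :
    s ≠ t → s ≠ u → D (pairOffset p q v ω t u) =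
      algebraMap k R (pairCoeff γ p q s t + pairCoeff γ p q s u) * v s *
        pairOffset p q v ω t u := by
  refine pairOffset_induction (P := fun t u f => s ≠ t → s ≠ u → D f =
    algebraMap k R (pairCoeff γ p q s t + pairCoeff γ p q s u) * v s * f) p q v ω
    (fun t u _ _ => by simp) (fun i h1 h2 => ?_) (fun i h1 h2 => ?_) t u
  · exact derivation_pairSum hγ D s hD hω i h1 h2 h0
  · rw [map_neg, derivation_pairSum hγ D s hD hω i h2 h1 h0,
      add_comm (pairCoeff γ p q s (Sum.inl i)), mul_neg]

theorem forall_br_eq_pairValue_iff {γ : Matrix (Fin n) (Fin n) k} {p q : Fin n → k}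
    {v : Fin n ⊕ Fin n → R} {ω : R} (hγ : ∀ i j, γ j i = -γ i j) (h0 : ∀ i, γ i i = 0)
    (π : PoissonBracket k R) :
    (∀ s t, π.br (v s) (v t) = pairValue γ p q v ω s t) ↔
      (∀ i j, π.br (v (Sum.inr i)) (v (Sum.inr j)) =
        algebraMap k R (γ i j) * v (Sum.inr i) * v (Sum.inr j)) ∧
      (∀ i j, i < j → π.br (v (Sum.inl i)) (v (Sum.inr j)) =
        algebraMap k R (p j + γ j i) * v (Sum.inl i) * v (Sum.inr j)) ∧
      (∀ i j, j < i → π.br (v (Sum.inl i)) (v (Sum.inr j)) =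
        algebraMap k R (q j + γ j i) * v (Sum.inl i) * v (Sum.inr j)) ∧
      (∀ i j, i < j → π.br (v (Sum.inl i)) (v (Sum.inl j)) =
        algebraMap k R (q i - p j + γ i j) * v (Sum.inl i) * v (Sum.inl j)) ∧
      ∀ i, π.br (v (Sum.inl i)) (v (Sum.inr i)) =
        algebraMap k R (q i) * v (Sum.inl i) * v (Sum.inr i) + pairSum p q v ω i := by
  have hyy : ∀ i j, pairValue γ p q v ω (Sum.inr i) (Sum.inr j) =
      algebraMap k R (γ i j) * v (Sum.inr i) * v (Sum.inr j) := fun i j => add_zero _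
  have hlt : ∀ i j, i < j → pairValue γ p q v ω (Sum.inl i) (Sum.inr j) =
      algebraMap k R (p j + γ j i) * v (Sum.inl i) * v (Sum.inr j) := fun i j h => by
    simp only [pairValue, pairCoeff, pairOffset, if_pos h, if_neg h.ne, add_zero]
  have hgt : ∀ i j, j < i → pairValue γ p q v ω (Sum.inl i) (Sum.inr j) =
      algebraMap k R (q j + γ j i) * v (Sum.inl i) * v (Sum.inr j) := fun i j h => by
    simp only [pairValue, pairCoeff, pairOffset, if_neg h.not_gt, if_neg h.ne', add_zero]
  have hxx : ∀ i j, i < j → pairValue γ p q v ω (Sum.inl i) (Sum.inl j) =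
      algebraMap k R (q i - p j + γ i j) * v (Sum.inl i) * v (Sum.inl j) := fun i j h => by
    simp only [pairValue, pairCoeff, pairOffset, if_pos h, add_zero]
  have hxy : ∀ i, pairValue γ p q v ω (Sum.inl i) (Sum.inr i) =
      algebraMap k R (q i) * v (Sum.inl i) * v (Sum.inr i) + pairSum p q v ω i := fun i => by
    simp only [pairValue, pairCoeff, pairOffset, lt_irrefl, if_false, if_true, h0, add_zero]
  have hanti : ∀ s t, pairValue γ p q v ω t s = -pairValue γ p q v ω s t := fun s t => by
    rw [pairValue, pairValue, pairCoeff_antisymm p q hγ s t, pairOffset_antisymm p q v ω s t,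
      map_neg]
    ring
  constructor
  · intro h
    exact ⟨fun i j => by rw [h, hyy], fun i j hij => by rw [h, hlt i j hij],
      fun i j hij => by rw [h, hgt i j hij], fun i j hij => by rw [h, hxx i j hij],
      fun i => by rw [h, hxy]⟩
  · rintro ⟨h1, h2, h3, h4, h5⟩
    have key : ∀ i j, π.br (v (Sum.inl i)) (v (Sum.inr j)) =
        pairValue γ p q v ω (Sum.inl i) (Sum.inr j) := by
      intro i j
      rcases lt_trichotomy i j with h | rfl | h
      · rw [h2 i j h, hlt i j h]
      · rw [h5, hxy]
      · rw [h3 i j h, hgt i j h]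
    rintro (i | i) (j | j)
    · rcases lt_trichotomy i j with h | rfl | h
      · rw [h4 i j h, hxx i j h]
      · rw [π.self_eq_zero]
        simp [pairValue, pairCoeff, pairOffset]
      · rw [π.antisymm, hanti (Sum.inl j), h4 j i h, hxx j i h]
    · exact key i j
    · rw [π.antisymm, hanti (Sum.inl j), key]
    · rw [h1, hyy]

end

theorem isWeightedHomogeneous_pairOffset {σ : Type v} {M : Type*} [AddCommMonoid M] {w : σ → M}
    {v : Fin n ⊕ Fin n → MvPolynomial σ k} {ω : MvPolynomial σ k} {d : Fin n ⊕ Fin n → M} {δ : M}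
    (p q : Fin n → k) (hv : ∀ t, IsWeightedHomogeneous w (v t) (d t))
    (hd : ∀ i, d (Sum.inl i) + d (Sum.inr i) = δ) (hω : IsWeightedHomogeneous w ω δ)
    (s t : Fin n ⊕ Fin n) : IsWeightedHomogeneous w (pairOffset p q v ω s t) (d s + d t) := by
  have h1 : ∀ i, IsWeightedHomogeneous w (pairSum p q v ω i) δ := fun i =>
    hω.add (IsWeightedHomogeneous.sum _ _ _ fun l _ => by
      rw [mul_assoc, ← hd l]
      exact ((hv _).mul (hv _)).C_mul _)
  refine pairOffset_induction (P := fun s t f => IsWeightedHomogeneous w f (d s + d t)) p q v ω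
    (fun s t => isWeightedHomogeneous_zero k w _) (fun i => ?_) (fun i => ?_) s t
  · rw [hd]
    exact h1 i
  · rw [add_comm, hd]
    exact (weightedHomogeneousSubmodule k w δ).neg_mem (h1 i)

/-- The order in which the variables are adjoined: `y_1, x_1, y_2, x_2, …`. -/
def pairRank : Fin n ⊕ Fin n → ℕ :=
  Sum.elim (fun i => 2 * i.val + 2) (fun i => 2 * i.val + 1)

theorem pairRank_injective : Function.Injective (pairRank (n := n)) := by
  rintro (i | i) (j | j) h <;> simp only [pairRank, Sum.elim_inl, Sum.elim_inr] at h
  · rw [Fin.ext (by omega : i.val = j.val)]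
  · omega
  · omega
  · rw [Fin.ext (by omega : i.val = j.val)]

theorem pairOffset_mem {R : Type v} [CommRing R] [Algebra k R] (S : Subalgebra k R)
    {p q : Fin n → k} {v : Fin n ⊕ Fin n → R} {ω : R} (hω : ω ∈ S) {s t : Fin n ⊕ Fin n}
    (hv : ∀ u, pairRank u < pairRank s → v u ∈ S) (hst : pairRank t < pairRank s) :
    pairOffset p q v ω s t ∈ S := by
  revert hv hst
  refine pairOffset_induction (P := fun s t f => (∀ u, pairRank u < pairRank s → v u ∈ S) →
    pairRank t < pairRank s → f ∈ S) p q v ω (fun _ _ _ _ => S.zero_mem) (fun i hv _ => ?_)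
    (fun i _ h => ?_) s t
  · refine S.add_mem hω (S.sum_mem fun l hl => ?_)
    have hl := Fin.lt_def.1 (Finset.mem_Iio.1 hl)
    refine S.mul_mem (S.mul_mem (S.algebraMap_mem _) (hv _ ?_)) (hv _ ?_)
    · simp only [pairRank, Sum.elim_inl]
      omega
    · simp only [pairRank, Sum.elim_inl, Sum.elim_inr]
      omega
  · simp only [pairRank, Sum.elim_inl, Sum.elim_inr] at h
    omega

/-- The eigenvalues on the `x_j` of the element of the Lie algebra of the torus which is attached
to a variable. -/
def pairLie (γ : Matrix (Fin n) (Fin n) k) (p q : Fin n → k) : Fin n ⊕ Fin n → Fin n → k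
  | Sum.inl i, j => if j < i then pairCoeff γ p q (Sum.inl i) (Sum.inl j) else p i - q i
  | Sum.inr i, j => if j < i then pairCoeff γ p q (Sum.inr i) (Sum.inl j) else -p i - 1

/-- The eigenvalues on the variables. -/
def pairLieWeight (γ : Matrix (Fin n) (Fin n) k) (p q : Fin n → k) (s : Fin n ⊕ Fin n) :
    Fin n ⊕ Fin n → k :=
  Sum.elim (pairLie γ p q s) fun j => Sum.elim p (fun i => -p i) s - pairLie γ p q s j

/-- The torus forces the weights of `x_j` and `y_j` to have a sum independent of `j`. This is
consistent with the bracket: for `j < i` the coefficients of `x_i` against `x_j` and `y_j` add up to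
`p i`, those of `y_i` to `-p i`. For `x_i` the value `p i - q i` at `j = i` is what gives `y_i` the
weight `q i`. -/
theorem pairLieWeight_eq {γ : Matrix (Fin n) (Fin n) k} {p q : Fin n → k}
    (h0 : ∀ i, γ i i = 0) {s t : Fin n ⊕ Fin n}
    (hst : pairRank t < pairRank s) : pairLieWeight γ p q s t = pairCoeff γ p q s t := by
  rcases s with i | i <;> rcases t with j | j <;>
    simp only [pairRank, Sum.elim_inl, Sum.elim_inr] at hst <;>
    simp only [pairLieWeight, pairLie, Sum.elim_inl, Sum.elim_inr]
  · rw [if_pos (Fin.lt_def.2 (by omega))]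
  · rcases (show j ≤ i from Fin.le_def.2 (by omega)).eq_or_lt with rfl | h
    · simp [pairCoeff, h0]
    · simp only [if_pos h, pairCoeff, if_neg h.not_gt]
      ring
  · rw [if_pos (Fin.lt_def.2 (by omega))]
  · have h : j < i := Fin.lt_def.2 (by omega)
    simp only [if_pos h, pairCoeff]
    ring

/-- The self-weight of `x_i` is `p i - q i`. That of `y_i` is not constrained by earlier variables;
the choice `-p i - 1` for `x_i` makes it 1. -/
theorem pairLieWeight_self_ne_zero {γ : Matrix (Fin n) (Fin n) k} {p q : Fin n → k}
    (hpq : ∀ i, p i ≠ q i) (s : Fin n ⊕ Fin n) : pairLieWeight γ p q s s ≠ 0 := by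
  rcases s with i | i
  · simpa [pairLieWeight, pairLie] using sub_ne_zero.2 (hpq i)
  · simp [pairLieWeight, pairLie]

theorem even_conclusion [CharZero k] (hn : 1 ≤ n) (γ : Matrix (Fin n) (Fin n) k) (p q : Fin n → k)
    (hγ : ∀ i j, γ j i = -γ i j) (hpq : ∀ i, p i ≠ q i) :
    (∃! π, IsEvenBracket γ p q π) ∧ ∀ π, IsEvenBracket γ p q π →
      IsRationalPoissonAction π (evenAction k n) ∧
      (stablePoissonPrimes π (evenAction k n)).Finite ∧
      (stablePoissonPrimes π (evenAction k n)).ncard ≤ 2 ^ (2 * n) ∧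
      PoissonDixmierMoeglin π := by
  have h0 : ∀ i, γ i i = 0 := fun i => self_eq_neg.1 (hγ i i)
  let w : Fin n ⊕ Fin n → Lex (Fin (n + 1) → ℤ) := Sum.elim (fun i => unitWeight i.castSucc)
    (fun i => unitWeight 0 + unitWeight (Fin.last n) + -unitWeight i.castSucc)
  have he : ∀ s : Fin n ⊕ Fin n, ∃ e : Fin (n + 1) → k,
      ∀ t, lieWeight e (w t) = pairLieWeight γ p q s t := by
    intro s
    have h1 : (0 : Fin (n + 1)) = Fin.castSucc (⟨0, hn⟩ : Fin n) := rfl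
    -- The last coordinate is chosen so that its sum with the first, which is the common weight of
    -- the `x_j y_j`, equals `p i` or `-p i`.
    refine ⟨Fin.snoc (α := fun _ => k) (pairLie γ p q s)
      (Sum.elim p (fun i => -p i) s - pairLie γ p q s ⟨0, hn⟩), ?_⟩
    rintro (j | j)
    · simp only [w, Sum.elim_inl, lieWeight_unitWeight, Fin.snoc_castSucc, pairLieWeight]
    · simp only [w, Sum.elim_inr, lieWeight_unitWeight, lieWeight_add, lieWeight_neg, h1,
        Fin.snoc_castSucc, Fin.snoc_last, pairLieWeight]
      ring
  choose e he using he
  have hc : ∀ s t, pairValue γ p q X 0 s t = C (pairCoeff γ p q s t) * X s * X t +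
    pairOffset p q X (0 : EvenAlg k n) s t := fun s t => rfl
  refine family_conclusion (w := w) (IsEvenBracket γ p q) (pairValue γ p q X 0) (fun π => ?_)
    (fun s t => ?_) ?_ (fun h s => ?_) (fun s t => ?_) pairRank e pairRank_injective
    (fun s t hst => ?_) (fun s => ?_) (by simp [two_mul])
  · rw [forall_br_eq_pairValue_iff hγ h0]
    simp only [pairSum, zero_add]
    exact ⟨fun h => ⟨h.y_y, h.x_y_lt, h.x_y_gt, h.x_x, h.x_y⟩,
      fun h => ⟨h.1, h.2.1, h.2.2.1, h.2.2.2.1, h.2.2.2.2⟩⟩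
  · rw [hc, hc, pairCoeff_antisymm p q hγ t s, pairOffset_antisymm p q _ _ t s, C_neg]
    ring
  · refine jacobi_log _ _ _ (pairCoeff_antisymm p q hγ) (pairOffset_antisymm p q _ _) hc ?_
    intro s t u hst hsu
    exact derivation_pairOffset hγ h0 _ s (fun t => mkDerivation_X _ _ _) (by simp) t u hst hsu
  · rcases s with i | i <;> simp only [w, Sum.elim_inl, Sum.elim_inr, torusCharacter_add,
      torusCharacter_neg, torusCharacter_unitWeight] <;> rfl
  · exact (isWeightedHomogeneous_C_mul_X_mul_X _ rfl).add (isWeightedHomogeneous_pairOffset p q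
      (isWeightedHomogeneous_X k w) (fun i => by simp only [w, Sum.elim_inl, Sum.elim_inr]; abel)
      (isWeightedHomogeneous_zero k w (unitWeight 0 + unitWeight (Fin.last n))) s t)
  · rw [he, pairLieWeight_eq h0 hst, hc]
    have h1 := pairOffset_mem (supported k {u | pairRank u < pairRank s}) (p := p) (q := q)
      (Subalgebra.zero_mem _) (fun u hu => X_mem_supported.2 hu) hst
    convert h1 using 1
    ring
  · rw [he]
    exact pairLieWeight_self_ne_zero hpq s

/-! ### Odd-dimensional analogues: the additional variable `z_0` -/

/-- The coefficients of the logarithmic part of the brackets of the variables `z_0`, `x_i`,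
`y_i`. -/
def oddCoeff (γ : Matrix (Fin n) (Fin n) k) (p q : Fin n → k) :
    Option (Fin n ⊕ Fin n) → Option (Fin n ⊕ Fin n) → k
  | none, none => 0
  | none, some t => Sum.elim (fun i => -(p i / 2)) (fun i => p i / 2) t
  | some s, none => -Sum.elim (fun i => -(p i / 2)) (fun i => p i / 2) s
  | some s, some t => pairCoeff γ p q s t

/-- The non-logarithmic part of the brackets of the variables `z_0`, `x_i`, `y_i`. -/
noncomputable def oddOffset (p q : Fin n → k) (lam : k) :
    Option (Fin n ⊕ Fin n) → Option (Fin n ⊕ Fin n) → OddAlg k n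
  | some s, some t => pairOffset p q (fun s => X (some s)) (C lam * X none ^ 2) s t
  | _, _ => 0

/-- The bracket of two of the variables `z_0`, `x_i`, `y_i`. -/
noncomputable def oddValue (γ : Matrix (Fin n) (Fin n) k) (p q : Fin n → k) (lam : k)
    (s t : Option (Fin n ⊕ Fin n)) : OddAlg k n :=
  C (oddCoeff γ p q s t) * X s * X t + oddOffset p q lam s t

theorem oddCoeff_antisymm {γ : Matrix (Fin n) (Fin n) k} (p q : Fin n → k)
    (hγ : ∀ i j, γ j i = -γ i j) (s t : Option (Fin n ⊕ Fin n)) :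
    oddCoeff γ p q t s = -oddCoeff γ p q s t := by
  rcases s with _ | s <;> rcases t with _ | t
  · exact neg_zero.symm
  · rfl
  · exact (neg_neg _).symm
  · exact pairCoeff_antisymm p q hγ s t

theorem oddOffset_antisymm (p q : Fin n → k) (lam : k) (s t : Option (Fin n ⊕ Fin n)) :
    oddOffset p q lam t s = -oddOffset p q lam s t := by
  rcases s with _ | s <;> rcases t with _ | t
  · exact neg_zero.symm
  · exact neg_zero.symm
  · exact neg_zero.symm
  · exact pairOffset_antisymm p q _ _ s t

theorem oddValue_antisymm {γ : Matrix (Fin n) (Fin n) k} (p q : Fin n → k) (lam : k)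
    (hγ : ∀ i j, γ j i = -γ i j) (s t : Option (Fin n ⊕ Fin n)) :
    oddValue γ p q lam s t = -oddValue γ p q lam t s := by
  rw [oddValue, oddValue, oddCoeff_antisymm p q hγ t s, oddOffset_antisymm p q _ t s, C_neg]
  ring

theorem isOddBracket_iff {γ : Matrix (Fin n) (Fin n) k} {p q : Fin n → k} {lam : k}
    (hγ : ∀ i j, γ j i = -γ i j) (h0 : ∀ i, γ i i = 0) (π : PoissonBracket k (OddAlg k n)) :
    IsOddBracket γ p q lam π ↔ ∀ s t, π.br (X s) (X t) = oddValue γ p q lam s t := by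
  have h1 := forall_br_eq_pairValue_iff (p := p) (q := q) (v := fun s => X (some s))
    (ω := C lam * X none ^ 2) hγ h0 π
  have h2 : ∀ i, C (q i) * X (some (Sum.inl i)) * X (some (Sum.inr i)) +
      pairSum p q (fun s => X (some s)) (C lam * X none ^ 2) i =
      C (q i) * OddAlg.x i * OddAlg.y i + (∑ l ∈ Finset.Iio i, C (q l - p l) * OddAlg.x l *
        OddAlg.y l) + C lam * OddAlg.z ^ 2 := by
    intro i
    rw [add_assoc, add_comm (∑ l ∈ Finset.Iio i, _)]
    rfl
  constructor
  · intro h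
    have h3 := h1.2 ⟨h.y_y, h.x_y_lt, h.x_y_gt, h.x_x, fun i => (h.x_y i).trans (h2 i).symm⟩
    have h4 : ∀ t, π.br (X none) (X (some t)) = oddValue γ p q lam none (some t) := by
      rintro (i | i)
      · exact (h.z_x i).trans (add_zero _).symm
      · exact (h.z_y i).trans (add_zero _).symm
    rintro (_ | s) (_ | t)
    · rw [π.self_eq_zero]
      simp [oddValue, oddCoeff, oddOffset]
    · exact h4 t
    · rw [π.antisymm, oddValue_antisymm p q lam hγ, h4]
    · exact h3 s t
  · intro h
    obtain ⟨a1, a2, a3, a4, a5⟩ := h1.1 fun s t => h (some s) (some t)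
    exact ⟨fun i => (h _ _).trans (add_zero _), fun i => (h _ _).trans (add_zero _), a1, a2, a3, a4,
      fun i => (a5 i).trans (h2 i)⟩

/-- The variable `z_0` Poisson-commutes with `z_0²` and with each `x_l y_l`, the coefficients `±p_l
/ 2` cancelling, so it kills the partial sums. For the other variables `{x_j, z_0²} = p_j x_j z_0²`
and `{y_j, z_0²} = -p_j y_j z_0²`, so `ω = lam z_0²` is an admissible start of the partial sums. -/
theorem mkDerivation_oddOffset [CharZero k] {γ : Matrix (Fin n) (Fin n) k} {p q : Fin n → k}
    (lam : k) (hγ : ∀ i j, γ j i = -γ i j) (h0 : ∀ i, γ i i = 0) (s t u : Option (Fin n ⊕ Fin n))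
    (hst : s ≠ t) (hsu : s ≠ u) :
    mkDerivation k (oddValue γ p q lam s) (oddOffset p q lam t u) =
      C (oddCoeff γ p q s t + oddCoeff γ p q s u) * X s * oddOffset p q lam t u := by
  have hz : mkDerivation k (oddValue γ p q lam s) (C lam * X none ^ 2) =
      C (lam * 2) * X none * oddValue γ p q lam s none := by
    rw [Derivation.leibniz, sq, Derivation.leibniz, mkDerivation_X, C_mul, map_ofNat,
      show mkDerivation k (oddValue γ p q lam s) (C lam) = 0 from Derivation.map_algebraMap _ _]
    simp only [smul_eq_mul]
    ring
  rcases t with _ | t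
  · simp [oddOffset]
  rcases u with _ | u
  · simp [oddOffset]
  rcases s with _ | s
  · have h1 : ∀ i, mkDerivation k (oddValue γ p q lam none)
        (pairSum p q (fun s => X (some s)) (C lam * X none ^ 2) i) = 0 := by
      intro i
      rw [pairSum, map_add, hz, map_sum, Finset.sum_eq_zero, add_zero]
      · simp [oddValue, oddCoeff, oddOffset]
      · intro l _
        rw [mul_assoc, Derivation.leibniz, Derivation.leibniz, mkDerivation_X, mkDerivation_X,
          Derivation.map_algebraMap]
        simp only [oddValue, oddCoeff, oddOffset, Sum.elim_inl, Sum.elim_inr, C_neg, smul_eq_mul]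
        ring
    refine pairOffset_induction (P := fun t u f => mkDerivation k (oddValue γ p q lam none) f =
      C (oddCoeff γ p q none (some t) + oddCoeff γ p q none (some u)) * X none * f) p q _ _
      (fun t u => by simp) (fun i => ?_) (fun i => ?_) t u
    · rw [h1]
      simp [oddCoeff]
    · rw [map_neg, h1]
      simp [oddCoeff]
  · refine derivation_pairOffset (v := fun s => X (some s)) (ω := C lam * X none ^ 2) hγ h0
      (mkDerivation k (oddValue γ p q lam (some s))) s (fun t => mkDerivation_X _ _ _)
      (hz.trans ?_) t u
      (fun h => hst (h ▸ rfl)) (fun h => hsu (h ▸ rfl))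
    have h2 : ∀ a : k, C lam * (C a : OddAlg k n) = C (lam * 2) * C (a / 2) := fun a => by
      rw [← C_mul, ← C_mul]
      congr 1
      ring
    rcases s with j | j
    · simp only [oddValue, oddCoeff, oddOffset, Sum.elim_inl, add_zero, neg_neg, algebraMap_eq]
      linear_combination (-X (some (Sum.inl j)) * X none ^ 2) * h2 (p j)
    · simp only [oddValue, oddCoeff, oddOffset, Sum.elim_inr, add_zero, algebraMap_eq, C_neg]
      linear_combination (X (some (Sum.inr j)) * X none ^ 2) * h2 (p j)

theorem odd_conclusion [CharZero k] (γ : Matrix (Fin n) (Fin n) k) (p q : Fin n → k) (lam : k)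
    (hγ : ∀ i j, γ j i = -γ i j) (hpq : ∀ i, p i ≠ q i) :
    (∃! π, IsOddBracket γ p q lam π) ∧ ∀ π, IsOddBracket γ p q lam π →
      IsRationalPoissonAction π (oddAction k n) ∧
      (stablePoissonPrimes π (oddAction k n)).Finite ∧
      (stablePoissonPrimes π (oddAction k n)).ncard ≤ 2 ^ (2 * n + 1) ∧
      PoissonDixmierMoeglin π := by
  have h0 : ∀ i, γ i i = 0 := fun i => self_eq_neg.1 (hγ i i)
  let w' : Fin n ⊕ Fin n → Lex (Fin (n + 1) → ℤ) := Sum.elim (fun i => unitWeight i.castSucc)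
    (fun i => unitWeight (Fin.last n) + unitWeight (Fin.last n) + -unitWeight i.castSucc)
  let w : Option (Fin n ⊕ Fin n) → Lex (Fin (n + 1) → ℤ) :=
    fun s => s.elim (unitWeight (Fin.last n)) w'
  -- `pairRank` starts at 1, so rank 0 is free and `z_0` is adjoined first.
  let rk : Option (Fin n ⊕ Fin n) → ℕ := fun s => s.elim 0 pairRank
  have hpos : ∀ s : Fin n ⊕ Fin n, 0 < pairRank s := by
    rintro (i | i) <;> exact Nat.succ_pos _
  have he : ∀ s : Option (Fin n ⊕ Fin n), ∃ e : Fin (n + 1) → k, lieWeight e (w s) ≠ 0 ∧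
      ∀ t, rk t < rk s → lieWeight e (w t) = oddCoeff γ p q s t := by
    rintro (_ | s)
    · exact ⟨fun _ => 1, by simp [w, lieWeight_unitWeight], fun t ht => (Nat.not_lt_zero _ ht).elim⟩
    -- The products `x_j y_j` have the weight of `z_0²`, so the coordinate of `z_0` is half of `±p
    -- i`; this is also the coefficient in the bracket with `z_0`.
    · let e : Fin (n + 1) → k := Fin.snoc (α := fun _ => k) (pairLie γ p q s)
        (Sum.elim p (fun i => -p i) s / 2)
      have h1 : ∀ t, lieWeight e (w' t) = pairLieWeight γ p q s t := by
        rintro (j | j)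
        · simp only [e, w', Sum.elim_inl, lieWeight_unitWeight, Fin.snoc_castSucc, pairLieWeight]
        · simp only [e, w', Sum.elim_inr, lieWeight_unitWeight, lieWeight_add, lieWeight_neg,
            Fin.snoc_castSucc, Fin.snoc_last, pairLieWeight]
          ring
      refine ⟨e, (h1 s).trans_ne (pairLieWeight_self_ne_zero hpq s), ?_⟩
      rintro (_ | t) ht
      · simp only [e, w, Option.elim_none, lieWeight_unitWeight, Fin.snoc_last]
        rcases s with i | i <;> simp [oddCoeff, neg_div]
      · exact (h1 t).trans (pairLieWeight_eq h0 ht)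
  choose e hne he using he
  refine family_conclusion (w := w) (IsOddBracket γ p q lam) (oddValue γ p q lam)
    (isOddBracket_iff hγ h0) (oddValue_antisymm p q lam hγ)
    (jacobi_log _ _ _ (oddCoeff_antisymm p q hγ) (oddOffset_antisymm p q _) (fun _ _ => rfl)
      (mkDerivation_oddOffset lam hγ h0)) (fun h s => ?_) (fun s t => ?_) rk e ?_
    (fun s t hst => ?_) hne (by simp [two_mul])
  · rcases s with _ | i | i
    · exact (torusCharacter_unitWeight _ _).symm
    · exact (torusCharacter_unitWeight _ _).symm
    · simp only [w, w', Option.elim_some, Sum.elim_inr, torusCharacter_add, torusCharacter_neg,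
        torusCharacter_unitWeight, ← sq]
      rfl
  · refine (isWeightedHomogeneous_C_mul_X_mul_X _ rfl).add ?_
    rcases s with _ | s
    · exact isWeightedHomogeneous_zero k w _
    rcases t with _ | t
    · exact isWeightedHomogeneous_zero k w _
    refine isWeightedHomogeneous_pairOffset (w := w) (d := w')
      (δ := unitWeight (Fin.last n) + unitWeight (Fin.last n)) p q
      (fun t => isWeightedHomogeneous_X k w (some t))
      (fun i => by simp only [w', Sum.elim_inl, Sum.elim_inr]; abel) ?_ s t
    rw [sq]
    exact ((isWeightedHomogeneous_X k w none).mul (isWeightedHomogeneous_X k w none)).C_mul lam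
  · rintro (_ | s) (_ | t) h
    · rfl
    · exact absurd h (hpos t).ne
    · exact absurd h (hpos s).ne'
    · exact congrArg some (pairRank_injective h)
  · rw [he s t hst]
    have h1 : oddOffset p q lam s t ∈ supported k {u | rk u < rk s} := by
      rcases s with _ | s
      · exact Subalgebra.zero_mem _
      rcases t with _ | t
      · exact Subalgebra.zero_mem _
      have hz : (X none : OddAlg k n) ∈ supported k {u | rk u < rk (some s)} :=
        X_mem_supported.2 (hpos s)
      refine pairOffset_mem _ ?_ (fun u hu => X_mem_supported.2 hu) hst
      exact Subalgebra.mul_mem _ (Subalgebra.algebraMap_mem _ lam)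
        (Subalgebra.pow_mem _ hz 2)
    convert h1 using 1
    rw [oddValue]
    ring

end EuclideanFamilies

end PoissonDME

theorem mainTheorem5 {k : Type*} [Field k] [CharZero k] (n : ℕ) (hn : 1 ≤ n) :
    -- quantum matrices
    (∀ (lam : k) (p : Matrix (Fin n) (Fin n) k), lam ≠ 0 → (∀ i j, p j i = -p i j) →
      (∃! π, PoissonDME.IsMatrixBracket lam p π) ∧
      ∀ π, PoissonDME.IsMatrixBracket lam p π →
        PoissonDME.IsRationalPoissonAction π (PoissonDME.matrixAction k n) ∧
        (PoissonDME.stablePoissonPrimes π (PoissonDME.matrixAction k n)).Finite ∧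
        (PoissonDME.stablePoissonPrimes π (PoissonDME.matrixAction k n)).ncard ≤ 2 ^ (n ^ 2) ∧
        PoissonDME.PoissonDixmierMoeglin π) ∧
    -- the algebras `A^{P,Q}_{n,Γ}`
    (∀ (γ : Matrix (Fin n) (Fin n) k) (p q : Fin n → k),
      (∀ i j, γ j i = -γ i j) → (∀ i, p i ≠ q i) →
      (∃! π, PoissonDME.IsEvenBracket γ p q π) ∧
      ∀ π, PoissonDME.IsEvenBracket γ p q π →
        PoissonDME.IsRationalPoissonAction π (PoissonDME.evenAction k n) ∧
        (PoissonDME.stablePoissonPrimes π (PoissonDME.evenAction k n)).Finite ∧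
        (PoissonDME.stablePoissonPrimes π (PoissonDME.evenAction k n)).ncard ≤ 2 ^ (2 * n) ∧
        PoissonDME.PoissonDixmierMoeglin π) ∧
    -- odd-dimensional analogues
    (∀ (γ : Matrix (Fin n) (Fin n) k) (p q : Fin n → k) (lam : k),
      (∀ i j, γ j i = -γ i j) → (∀ i, p i ≠ q i) →
      (∃! π, PoissonDME.IsOddBracket γ p q lam π) ∧
      ∀ π, PoissonDME.IsOddBracket γ p q lam π →
        PoissonDME.IsRationalPoissonAction π (PoissonDME.oddAction k n) ∧
        (PoissonDME.stablePoissonPrimes π (PoissonDME.oddAction k n)).Finite ∧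
        (PoissonDME.stablePoissonPrimes π (PoissonDME.oddAction k n)).ncard ≤ 2 ^ (2 * n + 1) ∧
        PoissonDME.PoissonDixmierMoeglin π) ∧
    -- quantum symmetric matrices
    ((∃! π : PoissonDME.PoissonBracket k (PoissonDME.SymMatAlg k n), PoissonDME.IsSymBracket π) ∧
      ∀ π : PoissonDME.PoissonBracket k (PoissonDME.SymMatAlg k n), PoissonDME.IsSymBracket π →
        PoissonDME.IsRationalPoissonAction π (PoissonDME.symAction k n) ∧
        (PoissonDME.stablePoissonPrimes π (PoissonDME.symAction k n)).Finite ∧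
        (PoissonDME.stablePoissonPrimes π (PoissonDME.symAction k n)).ncard
          ≤ 2 ^ (n * (n + 1) / 2) ∧
        PoissonDME.PoissonDixmierMoeglin π) ∧
    -- quantum antisymmetric matrices
    ((∃! π : PoissonDME.PoissonBracket k (PoissonDME.AntisymMatAlg k n),
        PoissonDME.IsAntisymBracket π) ∧
      ∀ π : PoissonDME.PoissonBracket k (PoissonDME.AntisymMatAlg k n),
        PoissonDME.IsAntisymBracket π →
        PoissonDME.IsRationalPoissonAction π (PoissonDME.antisymAction k n) ∧
        (PoissonDME.stablePoissonPrimes π (PoissonDME.antisymAction k n)).Finite ∧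
        (PoissonDME.stablePoissonPrimes π (PoissonDME.antisymAction k n)).ncard
          ≤ 2 ^ (n * (n - 1) / 2) ∧
        PoissonDME.PoissonDixmierMoeglin π) := by

  exact ⟨fun lam p hlam hp => PoissonDME.matrix_conclusion lam p hlam hp,
    fun γ p q hγ hpq => PoissonDME.even_conclusion hn γ p q hγ hpq,
    fun γ p q lam hγ hpq => PoissonDME.odd_conclusion γ p q lam hγ hpq,
    PoissonDME.sym_conclusion n, PoissonDME.antisym_conclusion n⟩
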